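/- Let $N\ge 2$ and write $\langle v\rangle=\sqrt{1+|v|^2}$ for $v\in\mathbb R^N$. For $k\in\mathbb R$ and $s\ge 0$ put $$\|f\|_{L^1_k}=\int_{\mathbb R^N}|f(v)|\langle v\rangle^k\,dv,\qquad \|f\|_{H^s_k}=\big\|(1-\Delta)^{s/2}\big(\langle\cdot\rangle^k f\big)\big\|_{L^2(\mathbb R^N)} .$$ (For integer $s$ the latter is equivalent to $\big(\sum_{|\nu|\le s}\|\langle\cdot\rangle^k\partial^\nu f\|_{L^2}^2\big)^{1/2}$, and for general $s$ to the norm obtained by interpolation.) For functions $\Phi:[0,\infty)\to\mathbb R$ and $b:\mathbb R\to\mathbb R$ (with $b$ Borel measurable; only its values on $[-1,1]$ matter) let $$Q^+(g,f)(v)=\int_{\mathbb R^N}\int_{S^{N-1}}\Phi(|v-v_*|)\,b(\cos\theta)\,g(v'_*)\,f(v')\,d\sigma\,dv_*,\qquad \cos\theta=\Big\langle\frac{v-v_*}{|v-v_*|},\sigma\Big\rangle,$$ $$v'=\frac{v+v_*}{2}+\frac{|v-v_*|}{2}\sigma,\qquad v'_*=\frac{v+v_*}{2}-\frac{|v-v_*|}{2}\sigma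 .$$ **Theorem.** For all $N\ge 2$, $s\ge 0$ and $\eta\ge 0$ there is a constant $C=C(N,s,\eta)$ such that the following holds. Let $\gamma\in(0,2)$, let $\Phi$ satisfy $$\Phi(0)=0,\qquad C_\Phi=\sup_{r\ne t}\frac{|\Phi(r)-\Phi(t)|}{|r-t|^\gamma}<+\infty,$$ and let $b$ satisfy $$\|b\|_{L^2(S^{N-1})}:=\Big(\int_0^\pi b(\cos\theta)^2\sin^{N-2}\theta\,d\theta\Big)^{1/2}<+\infty .$$ Then for all complex-valued $g,f\in H^s_{\eta+\gamma+1}\cap L^1_{\eta+\gamma}$ the integral defining $Q^+(g,f)(v)$ converges absolutely for almost every $v$, the function $Q^+(g,f)$ belongs to $H^{s+\frac{N-1}{2}}_\eta$, and $$\|Q^+(g,f)\|_{H^{s+\frac{N-1}{2}}_\eta}\le C_{\rm BD}\Big[\|g\|_{H^s_{\eta+\gamma+1}}\|f\|_{H^s_{\eta+\gamma+1}}+\|g\|_{L^1_{\eta+\gamma}}\|f\|_{L^1_{\eta+\gamma}}\Big],\qquad C_{\rm BD}=C(N,s,\eta)\;C_\Phi\;\|b\|_{L^2(S^{N-1})}.$$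 -/

import Mathlib

open MeasureTheory
open scoped ENNReal NNReal FourierTransform

noncomputable section

namespace Boltzmann

/-- The velocity space `ℝ^N` with its Euclidean norm. -/
abbrev Vel (N : ℕ) := EuclideanSpace ℝ (Fin N)

/-- The unit sphere `S^{N-1}`. -/
abbrev Sph (N : ℕ) := Metric.sphere (0 : Vel N) 1

/-- The standard surface measure on `S^{N-1}`. -/
def surfaceMeasure (N : ℕ) : Measure (Sph N) := (volume : Measure (Vel N)).toSphere

/-- The Japanese bracket `⟨v⟩ = √(1 + |v|²)`. -/
def bracket {N : ℕ} (v : Vel N) : ℝ := Real.sqrt (1 + ‖v‖ ^ 2)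

/-- The function `v ↦ ⟨v⟩^k f(v)`. -/
def weighted {N : ℕ} (k : ℝ) (f : Vel N → ℂ) : Vel N → ℂ :=
  fun v => ((bracket v ^ k : ℝ) : ℂ) * f v

/-- The norm of `L^1_k`, that is `∫ |f(v)| ⟨v⟩^k dv`. -/
def normL1 {N : ℕ} (k : ℝ) (f : Vel N → ℂ) : ℝ≥0∞ :=
  eLpNorm (weighted k f) 1 volume

/-- Membership in `L^1_k`. -/
def MemL1 {N : ℕ} (k : ℝ) (f : Vel N → ℂ) : Prop :=
  MemLp (weighted k f) 1 volume

open Classical in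
/-- The norm of the weighted Sobolev space `H^s_k` for `s ≥ 0`, that is
`‖(1 - Δ)^{s/2} (⟨·⟩^k f)‖_{L²}`. It is computed on the Fourier side, with the `L²` Fourier transform
(normalised with the phase `e^{-2π i x·ξ}`, so that `1 - Δ` has the symbol `1 + |2πξ|²`).
It is `∞` if `⟨·⟩^k f` is not in `L²`. -/
def normH {N : ℕ} (s k : ℝ) (f : Vel N → ℂ) : ℝ≥0∞ :=
  if h : MemLp (weighted k f) 2 (volume : Measure (Vel N)) then
    eLpNorm (fun ξ : Vel N =>
      (((1 + (2 * Real.pi * ‖ξ‖) ^ 2) ^ (s / 2) : ℝ) : ℂ) *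
        (𝓕 (h.toLp (weighted k f)) : Lp ℂ 2 (volume : Measure (Vel N))) ξ) 2 volume
  else ∞

/-- Membership in `H^s_k`, for `s ≥ 0`. -/
def MemH {N : ℕ} (s k : ℝ) (f : Vel N → ℂ) : Prop := normH s k f < ∞

/-- The velocity `v' = (v + v_*)/2 + (|v - v_*|/2) σ`. -/
def vPrime {N : ℕ} (v vs : Vel N) (σ : Sph N) : Vel N :=
  (1 / 2 : ℝ) • (v + vs) + (‖v - vs‖ / 2) • (σ : Vel N)

/-- The velocity `v'_* = (v + v_*)/2 - (|v - v_*|/2) σ`. -/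
def vPrimeStar {N : ℕ} (v vs : Vel N) (σ : Sph N) : Vel N :=
  (1 / 2 : ℝ) • (v + vs) - (‖v - vs‖ / 2) • (σ : Vel N)

/-- `cos θ = ⟨(v - v_*)/|v - v_*|, σ⟩`. -/
def cosDev {N : ℕ} (v vs : Vel N) (σ : Sph N) : ℝ :=
  inner ℝ (‖v - vs‖⁻¹ • (v - vs)) (σ : Vel N)

/-- The integrand `Φ(|v - v_*|) b(cos θ) g(v'_*) f(v')` of the gain operator. -/
def gainIntegrand {N : ℕ} (Φ : ℝ≥0 → ℝ) (b : ℝ → ℝ) (g f : Vel N → ℂ) (v : Vel N) :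
    Vel N × Sph N → ℂ :=
  fun p => ((Φ ‖v - p.1‖₊ * b (cosDev v p.1 p.2) : ℝ) : ℂ) *
    (g (vPrimeStar v p.1 p.2) * f (vPrime v p.1 p.2))

/-- The gain operator
`Q⁺(g,f)(v) = ∫_{ℝ^N} ∫_{S^{N-1}} Φ(|v - v_*|) b(cos θ) g(v'_*) f(v') dσ dv_*`. -/
def gain {N : ℕ} (Φ : ℝ≥0 → ℝ) (b : ℝ → ℝ) (g f : Vel N → ℂ) : Vel N → ℂ :=
  fun v => ∫ p, gainIntegrand Φ b g f v p ∂((volume : Measure (Vel N)).prod (surfaceMeasure N))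

/-- The `L²(S^{N-1})` norm of the angular kernel `b` (in polar coordinates around any axis, the
constant `|S^{N-2}|^{1/2}` being left out):
`(∫_0^π b(cos θ)² sin^{N-2} θ dθ)^{1/2}`, for `N ≥ 2`. -/
def angularL2Norm (N : ℕ) (b : ℝ → ℝ) : ℝ≥0∞ :=
  (∫⁻ θ in Set.Ioo 0 Real.pi,
    ENNReal.ofReal (b (Real.cos θ) ^ 2 * Real.sin θ ^ (N - 2))) ^ (1 / 2 : ℝ)

end Boltzmann

end

/-! Change of variables. Let x be the centre of mass, w the relative velocity before the collision
and ω the direction of v - v_*. Then v' = x + w/2, v'_* = x - w/2 and v = x + |w|ω/2. Exchanging the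
direction of w with ω preserves dx dw dω (`measurePreserving_collisionMap`), and Q⁺(g,f) becomes
`collisionOp b H` for the tensor H(x,w) = Φ(|w|) g(x - w/2) f(x + w/2) (`gain_eq`).

Gain of regularity. For η = 0 the Fourier transform of Q⁺ at ξ is ∫ Ĥ(ξ,w) K(ξ,w) dw, where Ĥ is the
transform in x and K(ξ,w) = ∫ b(ω·w/|w|) e^{-πi|w|ω·ξ} dω. Now |K|² is a double integral over the
sphere, and a reflection exchanging the directions of ξ and w turns it into one in which w occurs
only in the phase. Its integral in w against a Gaussian is a Gaussian in ω - ω', to which a Schur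
test on the sphere applies. Superposing Gaussians gives ∫ ⟨w⟩^{-2}|K|² dw ≤ C ‖b‖² |ξ|^{-(N-1)}
(`exists_lintegral_angularKernel_le`). Cauchy–Schwarz in w and Plancherel in x then control (N-1)/2
derivatives of Q⁺ by the L² norm of ⟨w⟩H. The factor ⟨w⟩ costs one unit of weight.

Weight. One has ⟨v⟩^η = λ^η (1 + y·ω)^{η/2} with λ² = 1 + |x|² + |w|²/4 and |y| < 1, where λ and y
depend on (x,w) only. The binomial coefficients are absolutely summable, and (y·ω)^j splits into
tensors in y and tensors in ω. Summing the squares of the components produces |y|^{2j} and (ω·ω')^j,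
both at most 1 in modulus, so the averaging estimate holds uniformly in j
(`exists_lintegral_fourier_collisionOp_le`).

Smoothness of order s. Differences Δ_h replace derivatives. By translation invariance Δ_h acts on H
in x only, so Φ is never differenced and the Leibniz rule distributes Δ_h over g and f. Commuting
Δ_h with weights leaves errors carrying powers of |h|. Of N + 2r differences with r > s, at most N
are traded for |h|^{(N-1)/2} together with (N-1)/2 derivatives, and at most 2r fall on the tensor,
where one factor is measured by differences up to order r and the other in L²
(`exists_sq_eLpNorm_fwdDiff_gain_le`). Summing over |h| = 2^{-n} along the coordinate axes recovers
the norm of order s + (N-1)/2 on |ξ| ≥ √N from the H^s norms of the weighted g and f. Lower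
frequencies are bounded by the L¹ norm of ⟨·⟩^η Q⁺, which is the source of the second product on the
right-hand side. -/

noncomputable section

namespace Boltzmann

set_option linter.unusedSectionVars false

/-! ### The L² Fourier transform and finite differences -/

section FourierL2

variable {V : Type*} [NormedAddCommGroup V] [InnerProductSpace ℝ V] [FiniteDimensional ℝ V]
  [MeasurableSpace V] [BorelSpace V]

open Classical in
/-- The `L²` Fourier transform of a function, set to zero outside of `L²`. -/
def fourierL2 (u : V → ℂ) : V → ℂ :=
  if h : MemLp u 2 (volume : Measure V) then
    ((𝓕 (h.toLp u) : Lp ℂ 2 (volume : Measure V)) : V → ℂ) else 0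

theorem fourierL2_of_memLp {u : V → ℂ} (h : MemLp u 2 (volume : Measure V)) :
    fourierL2 u = ((𝓕 (h.toLp u) : Lp ℂ 2 (volume : Measure V)) : V → ℂ) := by
  simp [fourierL2, h]

theorem memLp_fourierL2 (u : V → ℂ) : MemLp (fourierL2 u) 2 (volume : Measure V) := by
  by_cases h : MemLp u 2 (volume : Measure V)
  · rw [fourierL2_of_memLp h]; exact Lp.memLp _
  · simp [fourierL2, h]

theorem eLpNorm_fourierL2 {u : V → ℂ} (h : MemLp u 2 (volume : Measure V)) :
    eLpNorm (fourierL2 u) 2 volume = eLpNorm u 2 volume := by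
  rw [fourierL2_of_memLp h]
  have h1 := Lp.norm_fourier_eq (h.toLp u)
  rw [Lp.norm_def, Lp.norm_def, eLpNorm_congr_ae h.coeFn_toLp] at h1
  exact (ENNReal.toReal_eq_toReal_iff' (Lp.eLpNorm_ne_top _) h.eLpNorm_ne_top).1 h1

theorem fourierL2_congr {u v : V → ℂ} (h : u =ᵐ[volume] v) : fourierL2 u = fourierL2 v := by
  by_cases hu : MemLp u 2 (volume : Measure V)
  · have hv := (memLp_congr_ae h).1 hu
    rw [fourierL2_of_memLp hu, fourierL2_of_memLp hv, (MemLp.toLp_eq_toLp_iff hu hv).2 h]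
  · have hv : ¬ MemLp v 2 (volume : Measure V) := fun hv => hu ((memLp_congr_ae h).2 hv)
    simp [fourierL2, hu, hv]

/-- The `L²` Fourier transform is self-adjoint when tested against Schwartz functions. -/
theorem integral_schwartz_mul_fourierL2 {u : V → ℂ} (h : MemLp u 2 (volume : Measure V))
    (g : SchwartzMap V ℂ) : ∫ x, g x * fourierL2 u x = ∫ x, 𝓕 (g : V → ℂ) x * u x := by
  have h1 := congrArg (fun T => T g) (Lp.fourier_toTemperedDistribution_eq (h.toLp u))
  simp only [TemperedDistribution.fourier_apply, Lp.toTemperedDistribution_apply] at h1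
  rw [fourierL2_of_memLp h]
  simp only [smul_eq_mul] at h1
  rw [← h1]
  refine integral_congr_ae ?_
  filter_upwards [h.coeFn_toLp] with x hx
  rw [hx, SchwartzMap.fourier_coe]

/-- Smooth compactly supported functions are Schwartz, so the fundamental lemma of the calculus of
variations applies; this is how identities for the L² transform are read off from duality. -/
theorem ae_eq_of_integral_schwartz_mul {u v : V → ℂ} (hu : LocallyIntegrable u volume)
    (hv : LocallyIntegrable v volume)
    (h : ∀ g : SchwartzMap V ℂ, HasCompactSupport g →
      ∫ x, g x * u x = ∫ x, g x * v x) : u =ᵐ[volume] v := by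
  refine ae_eq_of_integral_contDiff_smul_eq hu hv fun g hg hgs => ?_
  have hc : HasCompactSupport (fun x => (g x : ℂ)) := hgs.comp_left (g := fun r : ℝ => (r : ℂ)) rfl
  have hd : ContDiff ℝ (⊤ : ℕ∞) (fun x => (g x : ℂ)) := Complex.ofRealCLM.contDiff.comp hg
  have := h (hc.toSchwartzMap hd) hc
  simpa using this

theorem integral_schwartz_fourier_mul {u : V → ℂ} (h : Integrable u volume)
    (g : SchwartzMap V ℂ) : ∫ x, 𝓕 (g : V → ℂ) x * u x = ∫ x, g x * 𝓕 u x := by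
  have := VectorFourier.integral_fourierIntegral_smul_eq_flip (L := innerₗ V)
    (μ := volume) (ν := volume) (e := Real.fourierChar) (f := g) (g := u)
    Real.continuous_fourierChar continuous_inner g.integrable h
  rwa [flip_innerₗ] at this

theorem fourierL2_eq_fourier {u : V → ℂ} (h1 : Integrable u volume)
    (h2 : MemLp u 2 (volume : Measure V)) : fourierL2 u =ᵐ[volume] 𝓕 u := by
  refine ae_eq_of_integral_schwartz_mul ((memLp_fourierL2 u).locallyIntegrable (by norm_num))
    (Continuous.locallyIntegrable ?_) fun g _ => ?_
  · exact VectorFourier.fourierIntegral_continuous Real.continuous_fourierChar continuous_inner h1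
  · rw [integral_schwartz_mul_fourierL2 h2, integral_schwartz_fourier_mul h1]

/-- The L² inverse transform of `𝓕 u` has the same pairings as `u` with all test functions, hence
equals `u`. This turns a bound on the Fourier side into membership of the gain in L². -/
theorem memLp_of_memLp_fourier {u : V → ℂ} (h1 : Integrable u volume)
    (h2 : MemLp (𝓕 u) 2 (volume : Measure V)) : MemLp u 2 (volume : Measure V) := by
  set w : Lp ℂ 2 (volume : Measure V) := 𝓕⁻ (h2.toLp (𝓕 u)) with hw
  suffices (w : V → ℂ) =ᵐ[volume] u from (memLp_congr_ae this).1 (Lp.memLp w)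
  refine ae_eq_of_integral_schwartz_mul ((Lp.memLp w).locallyIntegrable (by norm_num))
    h1.locallyIntegrable fun g _ => ?_
  have hw2 : MemLp (w : V → ℂ) 2 (volume : Measure V) := Lp.memLp w
  have h3 : fourierL2 (w : V → ℂ) =ᵐ[volume] 𝓕 u := by
    rw [fourierL2_of_memLp hw2, Lp.toLp_coeFn, hw, FourierTransform.fourier_fourierInv_eq]
    exact h2.coeFn_toLp
  have h4 := integral_schwartz_mul_fourierL2 hw2 (𝓕⁻ g)
  rw [← SchwartzMap.fourier_coe, FourierTransform.fourier_fourierInv_eq] at h4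
  rw [← h4]
  have h5 := integral_schwartz_fourier_mul h1 (𝓕⁻ g)
  rw [← SchwartzMap.fourier_coe, FourierTransform.fourier_fourierInv_eq] at h5
  rw [h5]
  refine integral_congr_ae ?_
  filter_upwards [h3] with x hx
  rw [hx]

theorem continuous_fourier {u : V → ℂ} (h : Integrable u volume) : Continuous (𝓕 u) :=
  VectorFourier.fourierIntegral_continuous Real.continuous_fourierChar continuous_inner h

/-- Plancherel's identity for integrable functions; both sides may be infinite. -/
theorem eLpNorm_fourier_eq {u : V → ℂ} (h : Integrable u volume) :
    eLpNorm (𝓕 u) 2 volume = eLpNorm u 2 volume := by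
  by_cases h2 : MemLp u 2 (volume : Measure V)
  · rw [← eLpNorm_fourierL2 h2, eLpNorm_congr_ae (fourierL2_eq_fourier h h2)]
  · have h3 : ¬ MemLp (𝓕 u) 2 (volume : Measure V) := fun h3 => h2 (memLp_of_memLp_fourier h h3)
    have a : eLpNorm u 2 volume = ∞ := by
      by_contra hc; exact h2 ⟨h.aestronglyMeasurable, lt_top_iff_ne_top.2 hc⟩
    have b : eLpNorm (𝓕 u) 2 volume = ∞ := by
      by_contra hc
      exact h3 ⟨(continuous_fourier h).aestronglyMeasurable, lt_top_iff_ne_top.2 hc⟩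
    rw [a, b]

/-- The Fourier multiplier of the difference operator with step `h`. -/
def diffSymbol (h ξ : V) : ℂ := (Real.fourierChar (inner ℝ h ξ) : ℂ) - 1

theorem continuous_diffSymbol (h : V) : Continuous (diffSymbol h) := by
  unfold diffSymbol
  exact (continuous_subtype_val.comp (Real.continuous_fourierChar.comp (by fun_prop))).sub
    continuous_const

theorem norm_diffSymbol_le_two (h ξ : V) : ‖diffSymbol h ξ‖ ≤ 2 := by
  refine (norm_sub_le _ _).trans ?_
  rw [Circle.norm_coe]; norm_num

theorem norm_diffSymbol_le (h ξ : V) : ‖diffSymbol h ξ‖ ≤ 2 * Real.pi * (‖h‖ * ‖ξ‖) := by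
  have h1 : ‖diffSymbol h ξ‖ ≤ ‖2 * Real.pi * inner ℝ h ξ‖ := by
    rw [diffSymbol, Real.fourierChar_apply, mul_comm (Complex.ofReal _)]
    exact Real.norm_exp_I_mul_ofReal_sub_one_le
  refine h1.trans ?_
  rw [norm_mul, norm_mul, Real.norm_of_nonneg Real.pi_pos.le, Real.norm_of_nonneg (by norm_num)]
  have := norm_inner_le_norm (𝕜 := ℝ) h ξ
  gcongr

theorem fourier_comp_add (u : V → ℂ) (h ξ : V) :
    𝓕 (fun x => u (x + h)) ξ = (Real.fourierChar (inner ℝ h ξ) : ℂ) * 𝓕 u ξ := by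
  have := congrFun (VectorFourier.fourierIntegral_comp_add_right Real.fourierChar
    (volume : Measure V) (innerₗ V) u h) ξ
  exact this

theorem fourier_fwdDiff {u : V → ℂ} (hu : Integrable u volume) (h ξ : V) :
    𝓕 (fwdDiff h u) ξ = diffSymbol h ξ * 𝓕 u ξ := by
  have e : 𝓕 (fwdDiff h u) ξ = 𝓕 (fun x => u (x + h)) ξ - 𝓕 u ξ := by
    simp only [Real.fourier_eq, fwdDiff, smul_sub]
    exact integral_sub ((Real.fourierIntegral_convergent_iff ξ).2 (hu.comp_add_right h))
      ((Real.fourierIntegral_convergent_iff ξ).2 hu)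
  rw [e, fourier_comp_add, diffSymbol]; ring

theorem integrable_fwdDiff {u : V → ℂ} (hu : Integrable u volume) (h : V) :
    Integrable (fwdDiff h u) volume := (hu.comp_add_right h).sub hu

theorem integrable_fwdDiff_iter {u : V → ℂ} (hu : Integrable u volume) (h : V) (j : ℕ) :
    Integrable ((fwdDiff h)^[j] u) volume := by
  induction j generalizing u with
  | zero => exact hu
  | succ j ih => exact ih (integrable_fwdDiff hu h)

theorem fourier_fwdDiff_iter {u : V → ℂ} (hu : Integrable u volume) (h ξ : V) (j : ℕ) :
    𝓕 ((fwdDiff h)^[j] u) ξ = diffSymbol h ξ ^ j * 𝓕 u ξ := by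
  induction j generalizing u with
  | zero => simp
  | succ j ih =>
    rw [Function.iterate_succ_apply, ih (integrable_fwdDiff hu h), fourier_fwdDiff hu]; ring

theorem memLp_comp_add {u : V → ℂ} {p : ℝ≥0∞} (hu : MemLp u p (volume : Measure V)) (h : V) :
    MemLp (fun x => u (x + h)) p (volume : Measure V) :=
  hu.comp_measurePreserving (measurePreserving_add_right volume h)

theorem memLp_fwdDiff {u : V → ℂ} {p : ℝ≥0∞} (hu : MemLp u p (volume : Measure V)) (h : V) :
    MemLp (fwdDiff h u) p (volume : Measure V) := (memLp_comp_add hu h).sub hu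

/-- By duality: multiplying a test function by the symbol takes a difference of its transform, and
translating the integral carries that difference over to `u`. Compact support of the test function
keeps its product with the symbol Schwartz. -/
theorem fourierL2_fwdDiff {u : V → ℂ} (hu : MemLp u 2 (volume : Measure V)) (h : V) :
    fourierL2 (fwdDiff h u) =ᵐ[volume] fun ξ => diffSymbol h ξ * fourierL2 u ξ := by
  have hm : MemLp (fun ξ => diffSymbol h ξ * fourierL2 u ξ) 2 (volume : Measure V) := by
    refine (memLp_fourierL2 u).of_le_mul (c := 2)
      ((continuous_diffSymbol h).aestronglyMeasurable.mul (memLp_fourierL2 u).1)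
      (Filter.Eventually.of_forall fun ξ => ?_)
    rw [norm_mul]; gcongr; exact norm_diffSymbol_le_two h ξ
  refine ae_eq_of_integral_schwartz_mul ((memLp_fourierL2 _).locallyIntegrable (by norm_num))
    (hm.locallyIntegrable (by norm_num)) fun g hg => ?_
  rw [integral_schwartz_mul_fourierL2 (memLp_fwdDiff hu h)]
  have hd : ContDiff ℝ (⊤ : ℕ∞) (fun ξ => g ξ * diffSymbol h ξ) := by
    refine (g.smooth _).mul ?_
    unfold diffSymbol
    simp only [Real.fourierChar_apply]
    have : ContDiff ℝ (⊤ : ℕ∞) (fun ξ : V => inner ℝ h ξ) := contDiff_const.inner ℝ contDiff_id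
    have h2 : ContDiff ℝ (⊤ : ℕ∞) (fun ξ : V => ((2 * Real.pi * inner ℝ h ξ : ℝ) : ℂ)) :=
      Complex.ofRealCLM.contDiff.comp (contDiff_const.mul this)
    exact ((h2.mul contDiff_const).cexp).sub contDiff_const
  have hc : HasCompactSupport (fun ξ => g ξ * diffSymbol h ξ) := hg.mul_right
  set g' : SchwartzMap V ℂ := hc.toSchwartzMap hd with hg'
  have hg'v : ∀ ξ, g' ξ = g ξ * diffSymbol h ξ := fun ξ => rfl
  have e1 : ∫ x, g x * (diffSymbol h x * fourierL2 u x) = ∫ x, g' x * fourierL2 u x := by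
    simp only [hg'v, mul_assoc]
  rw [e1, integral_schwartz_mul_fourierL2 hu]
  have e2 : ∀ x, 𝓕 (g' : V → ℂ) x = 𝓕 (g : V → ℂ) (x - h) - 𝓕 (g : V → ℂ) x := by
    intro x
    have hgi := fun y : V => (Real.fourierIntegral_convergent_iff (f := (g : V → ℂ)) y).2
      (g.integrable (μ := volume))
    simp only [Real.fourier_eq]
    rw [← integral_sub (hgi _) (hgi _)]
    refine integral_congr_ae (Filter.Eventually.of_forall fun y => ?_)
    simp only [hg'v, diffSymbol, Circle.smul_def, smul_eq_mul, inner_sub_right]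
    have e3 : (Real.fourierChar (-(inner ℝ y x - inner ℝ y h)) : ℂ) =
        (Real.fourierChar (inner ℝ h y) : ℂ) * (Real.fourierChar (-inner ℝ y x) : ℂ) := by
      rw [← Circle.coe_mul, ← AddChar.map_add_eq_mul, real_inner_comm y h]
      congr 2; ring
    rw [e3]; ring
  simp only [e2]
  have hF2 : MemLp (𝓕 (g : V → ℂ)) 2 (volume : Measure V) := by
    rw [← SchwartzMap.fourier_coe]; exact (𝓕 g).memLp 2 volume
  have i1 : Integrable (fun x => 𝓕 (g : V → ℂ) x * u x) volume := hF2.integrable_mul hu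
  have i2 : Integrable (fun x => 𝓕 (g : V → ℂ) x * u (x + h)) volume :=
    hF2.integrable_mul (memLp_comp_add hu h)
  have i3 : Integrable (fun x => 𝓕 (g : V → ℂ) (x - h) * u x) volume := by
    have := i2.comp_sub_right h
    simpa using this
  simp only [fwdDiff, mul_sub, sub_mul]
  rw [integral_sub i2 i1, integral_sub i3 i1]
  congr 1
  rw [← integral_sub_right_eq_self _ h]
  simp

theorem fourierL2_fwdDiff_iter {u : V → ℂ} (hu : MemLp u 2 (volume : Measure V)) (h : V) (j : ℕ) :
    fourierL2 ((fwdDiff h)^[j] u) =ᵐ[volume] fun ξ => diffSymbol h ξ ^ j * fourierL2 u ξ := by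
  induction j generalizing u with
  | zero => simp
  | succ j ih =>
    rw [Function.iterate_succ_apply]
    filter_upwards [ih (memLp_fwdDiff hu h), fourierL2_fwdDiff hu h] with ξ h1 h2
    rw [h1, h2]; ring

theorem memLp_fwdDiff_iter {u : V → ℂ} {p : ℝ≥0∞} (hu : MemLp u p (volume : Measure V)) (h : V)
    (j : ℕ) : MemLp ((fwdDiff h)^[j] u) p (volume : Measure V) := by
  induction j generalizing u with
  | zero => exact hu
  | succ j ih => exact ih (memLp_fwdDiff hu h)

end FourierL2

/-! ### Differences of the weights ⟨v⟩^p -/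

section Weights

variable {N : ℕ}

theorem one_le_bracket (v : Vel N) : 1 ≤ bracket v := by
  rw [bracket, Real.one_le_sqrt]; nlinarith [sq_nonneg ‖v‖]

theorem bracket_pos (v : Vel N) : 0 < bracket v := one_pos.trans_le (one_le_bracket v)

theorem bracket_sq (v : Vel N) : bracket v ^ 2 = 1 + ‖v‖ ^ 2 := Real.sq_sqrt (by positivity)

theorem norm_le_bracket (v : Vel N) : ‖v‖ ≤ bracket v :=
  Real.le_sqrt_of_sq_le (by linarith)

theorem continuous_bracket : Continuous (bracket : Vel N → ℝ) := by
  unfold bracket; fun_prop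

theorem continuous_bracket_rpow (p : ℝ) : Continuous fun v : Vel N => bracket v ^ p :=
  continuous_bracket.rpow_const fun v => Or.inl (bracket_pos v).ne'

theorem bracket_add_le (v h : Vel N) : bracket (v + h) ≤ (1 + ‖h‖) * bracket v := by
  refine Real.sqrt_le_iff.2 ⟨by have := bracket_pos v; positivity, ?_⟩
  rw [mul_pow, bracket_sq]
  have h1 := norm_add_le v h
  have h2 : ‖v + h‖ ^ 2 ≤ (‖v‖ + ‖h‖) ^ 2 := by gcongr
  have h3 : ‖v‖ * ‖h‖ ≤ (1 + ‖v‖ ^ 2) * ‖h‖ := by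
    gcongr; nlinarith [sq_nonneg (‖v‖ - 1)]
  have : 0 ≤ ‖h‖ ^ 2 * ‖v‖ ^ 2 := by positivity
  nlinarith [norm_nonneg h, norm_nonneg v]

/-- Peetre's inequality. The constant depends only on a bound `P` for the exponent; this is how the
final constant becomes independent of `γ`, which enters the exponent η + γ + 1. -/
theorem bracket_rpow_add_le {p P : ℝ} (hp : |p| ≤ P) (v h : Vel N) :
    bracket (v + h) ^ p ≤ (1 + ‖h‖) ^ P * bracket v ^ p := by
  have hb := bracket_pos v
  have hb' := bracket_pos (v + h)
  have h1 : (1 : ℝ) ≤ 1 + ‖h‖ := by linarith [norm_nonneg h]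
  rcases le_total 0 p with h0 | h0
  · calc bracket (v + h) ^ p ≤ ((1 + ‖h‖) * bracket v) ^ p :=
          Real.rpow_le_rpow hb'.le (bracket_add_le v h) h0
      _ = (1 + ‖h‖) ^ p * bracket v ^ p := Real.mul_rpow (by positivity) hb.le
      _ ≤ _ := by
        gcongr ?_ * _
        exact Real.rpow_le_rpow_of_exponent_le h1 ((le_abs_self p).trans hp)
  · have h2 : bracket v ≤ (1 + ‖h‖) * bracket (v + h) := by
      have := bracket_add_le (v + h) (-h)
      simpa using this
    have h3 : ((1 + ‖h‖) * bracket (v + h)) ^ p ≤ bracket v ^ p :=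
      Real.rpow_le_rpow_of_nonpos hb h2 h0
    rw [Real.mul_rpow (by positivity) hb'.le] at h3
    calc bracket (v + h) ^ p
        = (1 + ‖h‖) ^ (-p) * ((1 + ‖h‖) ^ p * bracket (v + h) ^ p) := by
          rw [← mul_assoc, ← Real.rpow_add (by positivity)]; simp
      _ ≤ (1 + ‖h‖) ^ (-p) * bracket v ^ p := by gcongr
      _ ≤ _ := by
        gcongr ?_ * _
        exact Real.rpow_le_rpow_of_exponent_le h1 ((neg_le_abs p).trans hp)

/-- `p ↦ ⟨v⟩^p ⟨v, h⟩^a`, the functions arising from derivatives of `⟨v⟩^p` along `h`. -/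
def weightMonomial (h : Vel N) (p : ℝ) (a : ℕ) (v : Vel N) : ℝ := bracket v ^ p * inner ℝ v h ^ a

theorem hasDerivAt_bracket_rpow_line (v h : Vel N) (p t : ℝ) :
    HasDerivAt (fun t : ℝ => bracket (v + t • h) ^ p)
      (p * weightMonomial h (p - 2) 1 (v + t • h)) t := by
  have hl : HasDerivAt (fun t : ℝ => v + t • h) h t := by
    simpa using ((hasDerivAt_id t).smul_const h).const_add v
  have h1 : HasDerivAt (fun t : ℝ => 1 + ‖v + t • h‖ ^ 2) (2 * inner ℝ (v + t • h) h) t :=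
    (hl.norm_sq).const_add 1
  have hpos : ∀ w : Vel N, (0 : ℝ) < 1 + ‖w‖ ^ 2 := fun w => by positivity
  have h2 := h1.rpow_const (p := p / 2) (Or.inl (hpos _).ne')
  have e : ∀ (q : ℝ) (w : Vel N), bracket w ^ q = (1 + ‖w‖ ^ 2) ^ (q / 2) := fun q w => by
    rw [bracket, Real.sqrt_eq_rpow, ← Real.rpow_mul (hpos w).le]; congr 1; ring
  simp only [e, weightMonomial]
  convert h2 using 1
  rw [show (p - 2) / 2 = p / 2 - 1 by ring]; ring

theorem hasDerivAt_weightMonomial_line (v h : Vel N) (p : ℝ) (a : ℕ) (t : ℝ) :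
    HasDerivAt (fun t : ℝ => weightMonomial h p a (v + t • h))
      (p * weightMonomial h (p - 2) (a + 1) (v + t • h) +
        (a * ‖h‖ ^ 2) * weightMonomial h p (a - 1) (v + t • h)) t := by
  have h1 := hasDerivAt_bracket_rpow_line v h p t
  have hl : HasDerivAt (fun t : ℝ => v + t • h) h t := by
    simpa using ((hasDerivAt_id t).smul_const h).const_add v
  have h2 : HasDerivAt (fun t : ℝ => inner ℝ (v + t • h) h) (‖h‖ ^ 2) t := by
    simpa using hl.inner ℝ (hasDerivAt_const t h)
  have h3 := h1.mul (h2.pow a)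
  simp only [weightMonomial] at *
  refine h3.congr_deriv ?_
  simp only [pow_one, Pi.pow_apply]
  ring

theorem hasDerivAt_fwdDiff_iter_line {g g' : Vel N → ℝ} {h : Vel N}
    (hg : ∀ v, ∀ t : ℝ, HasDerivAt (fun t : ℝ => g (v + t • h)) (g' (v + t • h)) t) (j : ℕ) :
    ∀ v, ∀ t : ℝ, HasDerivAt (fun t : ℝ => (fwdDiff h)^[j] g (v + t • h))
      ((fwdDiff h)^[j] g' (v + t • h)) t := by
  induction j generalizing g g' with
  | zero => exact hg
  | succ j ih =>
    refine ih (g := fwdDiff h g) (g' := fwdDiff h g') fun v t => ?_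
    have := (hg (v + h) t).sub (hg v t)
    simp only [add_right_comm _ h] at this
    exact this

theorem abs_weightMonomial_le (h : Vel N) (p : ℝ) (a : ℕ) (v : Vel N) :
    |weightMonomial h p a v| ≤ ‖h‖ ^ a * bracket v ^ (p + a) := by
  have hb := bracket_pos v
  rw [weightMonomial, abs_mul, abs_pow, abs_of_pos (by positivity), Real.rpow_add hb,
    Real.rpow_natCast]
  have h1 : |inner ℝ v h| ≤ bracket v * ‖h‖ :=
    (abs_real_inner_le_norm v h).trans (by gcongr; exact norm_le_bracket v)
  calc bracket v ^ p * |inner ℝ v h| ^ a ≤ bracket v ^ p * (bracket v * ‖h‖) ^ a := by gcongr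
    _ = _ := by ring

/-- Induction on `j` by the mean value inequality along `t ↦ v + t h`. The derivative of a monomial
of degree `a` consists of monomials of degree `a + 1` and, with a factor `‖h‖²`, of degree `a - 1`.
So one power of `‖h‖` is gained at each step while the growth in `v` does not increase. The first
kind has exponent `p - 2`, hence the bound `P + 2` in the induction hypothesis. -/
theorem exists_abs_fwdDiff_weightMonomial_le (j : ℕ) : ∀ (a : ℕ) (P : ℝ), ∃ C : ℝ, 0 ≤ C ∧
    ∀ p, |p| ≤ P → ∀ h : Vel N, ‖h‖ ≤ 1 → ∀ v,
      |(fwdDiff h)^[j] (weightMonomial h p a) v| ≤ C * ‖h‖ ^ (a + j) * bracket v ^ (p + a) := by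
  induction j with
  | zero =>
    intro a P
    exact ⟨1, zero_le_one, fun p _ h _ v => by simpa using abs_weightMonomial_le h p a v⟩
  | succ j ih =>
    intro a P
    obtain ⟨C₁, hC₁, H₁⟩ := ih (a + 1) (P + 2)
    obtain ⟨C₂, hC₂, H₂⟩ := ih (a - 1) (P + 2)
    refine ⟨(|P| * C₁ + a * C₂) * 2 ^ (|P| + a), by positivity, fun p hp h hh v => ?_⟩
    have hpP : |p| ≤ |P| := hp.trans (le_abs_self P)
    set g' : Vel N → ℝ := p • weightMonomial h (p - 2) (a + 1) +
      (a * ‖h‖ ^ 2 : ℝ) • weightMonomial h p (a - 1) with hg'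
    have hd := hasDerivAt_fwdDiff_iter_line (g := weightMonomial h p a) (g' := g') (h := h)
      (fun v t => hasDerivAt_weightMonomial_line v h p a t) j v
    have hbd : ∀ w, |(fwdDiff h)^[j] g' w| ≤
        (|P| * C₁ + a * C₂) * ‖h‖ ^ (a + (j + 1)) * bracket w ^ (p + a) := by
      intro w
      have hb := one_le_bracket w
      rw [hg', fwdDiff_iter_add, fwdDiff_iter_const_smul, fwdDiff_iter_const_smul]
      have p2 : |p - 2| ≤ P + 2 := (abs_sub _ _).trans (by simpa using hp)
      have e1 := H₁ (p - 2) p2 h hh w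
      have e2 := H₂ p (hp.trans (by linarith)) h hh w
      have e1' : |p * (fwdDiff h)^[j] (weightMonomial h (p - 2) (a + 1)) w| ≤
          |P| * (C₁ * ‖h‖ ^ (a + (j + 1)) * bracket w ^ (p + a)) := by
        rw [abs_mul]
        gcongr
        refine e1.trans ?_
        rw [show a + 1 + j = a + (j + 1) by ring]
        gcongr ?_ * ?_
        refine Real.rpow_le_rpow_of_exponent_le hb ?_
        push_cast; linarith
      have e2' : |(a * ‖h‖ ^ 2 : ℝ) * (fwdDiff h)^[j] (weightMonomial h p (a - 1)) w| ≤
          a * (C₂ * ‖h‖ ^ (a + (j + 1)) * bracket w ^ (p + a)) := by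
        -- For `a = 0` the truncated degree `a - 1` is harmless because of the factor `a`.
        rcases Nat.eq_zero_or_pos a with rfl | ha
        · simp
        rw [abs_mul, abs_of_nonneg (by positivity : (0 : ℝ) ≤ a * ‖h‖ ^ 2), mul_assoc]
        refine mul_le_mul_of_nonneg_left ?_ (Nat.cast_nonneg a)
        calc ‖h‖ ^ 2 * |(fwdDiff h)^[j] (weightMonomial h p (a - 1)) w|
            ≤ ‖h‖ ^ 2 * (C₂ * ‖h‖ ^ (a - 1 + j) * bracket w ^ (p + (a - 1 : ℕ))) := by gcongr
          _ = C₂ * ‖h‖ ^ (a + (j + 1)) * bracket w ^ (p + (a - 1 : ℕ)) := by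
            rw [show a + (j + 1) = 2 + (a - 1 + j) by omega, pow_add]; ring
          _ ≤ _ := by
            gcongr ?_ * ?_
            refine Real.rpow_le_rpow_of_exponent_le hb ?_
            have : ((a - 1 : ℕ) : ℝ) ≤ a := by exact_mod_cast Nat.sub_le a 1
            linarith
      simp only [Pi.add_apply, Pi.smul_apply, smul_eq_mul]
      refine (abs_add_le _ _).trans ((add_le_add e1' e2').trans (le_of_eq ?_))
      ring
    have hmv := norm_image_sub_le_of_norm_deriv_le_segment_01'
      (f := fun t : ℝ => (fwdDiff h)^[j] (weightMonomial h p a) (v + t • h))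
      (f' := fun t : ℝ => (fwdDiff h)^[j] g' (v + t • h))
      (C := (|P| * C₁ + a * C₂) * 2 ^ (|P| + a) * ‖h‖ ^ (a + (j + 1)) * bracket v ^ (p + a))
      (fun t _ => (hd t).hasDerivWithinAt) ?_
    · rw [Function.iterate_succ_apply']
      simpa [fwdDiff] using hmv
    · intro t ht
      refine (hbd _).trans ?_
      have h5 : bracket (v + t • h) ^ (p + a) ≤ 2 ^ (|P| + a) * bracket v ^ (p + a) := by
        have h6 : |p + a| ≤ |P| + a := (abs_add_le _ _).trans (by simpa using hpP)
        refine (bracket_rpow_add_le h6 v (t • h)).trans ?_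
        have h7 : ‖t • h‖ ≤ 1 := by
          rw [norm_smul, Real.norm_of_nonneg ht.1]
          exact mul_le_one₀ ht.2.le (norm_nonneg h) hh
        have := bracket_pos v
        gcongr
        linarith
      calc _ ≤ (|P| * C₁ + a * C₂) * ‖h‖ ^ (a + (j + 1)) *
            (2 ^ (|P| + a) * bracket v ^ (p + a)) := by gcongr
        _ = _ := by ring

/-- The differences of order `i` of `⟨v⟩^p`, at points at distance at most `K` from `v`, are
bounded by `|h|^i ⟨v⟩^p`. -/
theorem exists_abs_fwdDiff_bracket_rpow_le (j : ℕ) (P : ℝ) {K : ℝ} (hK : 0 ≤ K) : ∃ C : ℝ, 0 ≤ C ∧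
    ∀ p, |p| ≤ P → ∀ h : Vel N, ‖h‖ ≤ 1 → ∀ v z : Vel N, ‖z‖ ≤ K → ∀ i ≤ j,
      |(fwdDiff h)^[i] (fun v => bracket v ^ p) (v + z)| ≤ C * ‖h‖ ^ i * bracket v ^ p := by
  choose C hC H using fun i => exists_abs_fwdDiff_weightMonomial_le (N := N) i 0 P
  have hS := Finset.sum_nonneg fun i (_ : i ∈ Finset.range (j + 1)) => hC i
  refine ⟨(∑ i ∈ Finset.range (j + 1), C i) * (1 + K) ^ |P|, by positivity, ?_⟩
  · intro p hp h hh v z hz i hi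
    have e : (fun v : Vel N => bracket v ^ p) = weightMonomial h p 0 := by
      ext v; simp [weightMonomial]
    rw [e]
    have h1 := H i p hp h hh (v + z)
    have hb := bracket_pos v
    have h2 : C i ≤ ∑ i ∈ Finset.range (j + 1), C i :=
      Finset.single_le_sum (f := C) (fun i _ => hC i) (Finset.mem_range.2 (by omega))
    have h3 := bracket_rpow_add_le (hp.trans (le_abs_self P)) v z
    have h4 : (1 + ‖z‖) ^ |P| ≤ (1 + K) ^ |P| := by gcongr
    have h5 := hC i
    simp only [zero_add, Nat.cast_zero, add_zero] at h1
    calc _ ≤ _ := h1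
      _ ≤ (∑ i ∈ Finset.range (j + 1), C i) * ‖h‖ ^ i * ((1 + K) ^ |P| * bracket v ^ p) := by
        have h6 := h3.trans (mul_le_mul_of_nonneg_right h4 (by positivity : 0 ≤ bracket v ^ p))
        have := bracket_pos (v + z)
        have h7 : 0 ≤ bracket (v + z) ^ p := by positivity
        gcongr
      _ = _ := by ring

end Weights

/-! ### The Leibniz rule for iterated differences -/

section Leibniz

variable {M R : Type*} [AddCommMonoid M]

/-- Leibniz rule for iterated differences, as an inequality. -/
theorem norm_fwdDiff_iter_mul_le [NormedRing R] (h : M) (j : ℕ) (a b : M → R) (v : M) :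
    ‖(fwdDiff h)^[j] (fun v => a v * b v) v‖ ≤
      2 ^ j * ∑ ik ∈ Finset.HasAntidiagonal.antidiagonal j,
        ‖(fwdDiff h)^[ik.1] a (v + ik.2 • h)‖ * ‖(fwdDiff h)^[ik.2] b v‖ := by
  induction j generalizing a b with
  | zero => simpa using norm_mul_le _ _
  | succ j ih =>
    -- Discrete product rule. Each of the two sums it produces is the sum over the antidiagonal of
    -- `j + 1` with one term dropped, so the constant doubles at every step.
    have e : fwdDiff h (fun v => a v * b v) =
        (fun v => a (v + h) * fwdDiff h b v) + fun v => fwdDiff h a v * b v := by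
      ext v; simp only [fwdDiff, Pi.add_apply]; noncomm_ring
    rw [Function.iterate_succ_apply, e, fwdDiff_iter_add, Pi.add_apply]
    refine (norm_add_le _ _).trans ((add_le_add (ih _ _) (ih _ _)).trans ?_)
    rw [← mul_add, pow_succ, mul_assoc, two_mul]
    refine mul_le_mul_of_nonneg_left (add_le_add ?_ ?_) (by positivity)
    · rw [Finset.Nat.sum_antidiagonal_succ']
      refine le_add_of_nonneg_of_le (by positivity) (le_of_eq (Finset.sum_congr rfl fun ik _ => ?_))
      rw [fwdDiff_iter_comp_add, Function.iterate_succ_apply, succ_nsmul, add_assoc]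
    · rw [Finset.Nat.sum_antidiagonal_succ]
      refine le_add_of_nonneg_of_le (by positivity) (le_of_eq (Finset.sum_congr rfl fun ik _ => ?_))
      rw [Function.iterate_succ_apply]

end Leibniz

/-! ### Polar coordinates and the collisional change of variables -/

section Polar

variable {N : ℕ}

instance instIsFiniteMeasureSurfaceMeasure : IsFiniteMeasure (surfaceMeasure N) := by
  unfold surfaceMeasure; infer_instance

/-- The radial measure `r^{N-1} dr`. -/
def radialMeasure (N : ℕ) : Measure (Set.Ioi (0 : ℝ)) := Measure.volumeIoiPow (N - 1)

instance instSigmaFiniteRadialMeasure : SigmaFinite (radialMeasure N) := by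
  unfold radialMeasure; infer_instance

/-- Polar coordinates `(σ, r) ↦ r σ`. -/
def ofPolar (p : Sph N × Set.Ioi (0 : ℝ)) : Vel N := (p.2 : ℝ) • (p.1 : Vel N)

theorem continuous_ofPolar : Continuous (ofPolar (N := N)) := by
  unfold ofPolar; fun_prop

theorem norm_ofPolar (p : Sph N × Set.Ioi (0 : ℝ)) : ‖ofPolar p‖ = p.2 := by
  rw [ofPolar, norm_smul, norm_eq_of_mem_sphere, mul_one, Real.norm_of_nonneg (le_of_lt p.2.2)]

theorem measurePreserving_ofPolar [NeZero N] : MeasurePreserving (ofPolar (N := N))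
    ((surfaceMeasure N).prod (radialMeasure N)) volume := by
  have h1 := (volume : Measure (Vel N)).measurePreserving_homeomorphUnitSphereProd
  have h2 := MeasurePreserving.symm (homeomorphUnitSphereProd (Vel N)).toMeasurableEquiv h1
  have h3 : MeasurePreserving (Subtype.val : ({0}ᶜ : Set (Vel N)) → Vel N)
      (Measure.comap Subtype.val volume) volume := by
    refine ⟨measurable_subtype_coe, ?_⟩
    rw [map_comap_subtype_coe (measurableSet_singleton _).compl]
    exact Measure.restrict_eq_self_of_ae_mem (compl_mem_ae_iff.2 (measure_singleton 0))
  have h4 := h3.comp h2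
  rw [finrank_euclideanSpace_fin] at h4
  exact h4

theorem lintegral_ofPolar [NeZero N] {f : Vel N → ℝ≥0∞} (hf : Measurable f) :
    ∫⁻ x, f x = ∫⁻ σ, ∫⁻ r, f (ofPolar (σ, r)) ∂radialMeasure N ∂surfaceMeasure N := by
  rw [← measurePreserving_ofPolar.lintegral_comp hf,
    lintegral_prod (fun p => f (ofPolar p)) (hf.comp continuous_ofPolar.measurable).aemeasurable]

open Classical in
/-- The direction `w/|w|` of a velocity (arbitrary at the origin). -/
def direction [NeZero N] (w : Vel N) : Sph N :=
  if h : w ≠ 0 then ⟨‖w‖⁻¹ • w, by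
    rw [mem_sphere_zero_iff_norm, norm_smul, norm_inv, norm_norm,
      inv_mul_cancel₀ (norm_ne_zero_iff.2 h)]⟩
  else ⟨EuclideanSpace.single 0 1, by simp⟩

theorem norm_smul_direction [NeZero N] (w : Vel N) : ‖w‖ • (direction w : Vel N) = w := by
  rw [direction]
  split_ifs with h
  · rw [smul_smul, mul_inv_cancel₀ (norm_ne_zero_iff.2 h), one_smul]
  · simp_all

theorem measurable_direction [NeZero N] : Measurable (direction (N := N)) := by
  refine Measurable.subtype_mk (p := fun x => x ∈ Metric.sphere (0 : Vel N) 1)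
    (f := fun w : Vel N => ((direction w : Sph N) : Vel N)) ?_
    (h := fun w => (direction w).2)
  have : (fun w : Vel N => ((direction w : Sph N) : Vel N)) =
      fun w => if w ≠ 0 then ‖w‖⁻¹ • w else EuclideanSpace.single 0 1 := by
    ext1 w; rw [direction]; split_ifs <;> rfl
  rw [this]
  refine Measurable.ite (measurableSet_singleton _).compl ?_ measurable_const
  exact measurable_norm.inv.smul measurable_id

theorem direction_ofPolar [NeZero N] (p : Sph N × Set.Ioi (0 : ℝ)) :
    direction (ofPolar p) = p.1 := by
  ext1
  have h := norm_smul_direction (ofPolar p)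
  rw [norm_ofPolar] at h
  exact smul_right_injective _ (ne_of_gt p.2.2) h

/-- Exchange of the direction of `w` with `ω`. -/
def swapDirection [NeZero N] (p : Vel N × Sph N) : Vel N × Sph N :=
  (‖p.1‖ • (p.2 : Vel N), direction p.1)

theorem measurable_swapDirection [NeZero N] : Measurable (swapDirection (N := N)) := by
  refine Measurable.prodMk ?_ (measurable_direction.comp measurable_fst)
  fun_prop

/-- In polar coordinates for the first variable the map exchanges two points of the sphere and fixes
the radius, so it permutes the factors of a product measure. -/
theorem measurePreserving_swapDirection [NeZero N] : MeasurePreserving (swapDirection (N := N))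
    (volume.prod (surfaceMeasure N)) (volume.prod (surfaceMeasure N)) := by
  have h1 := (measurePreserving_ofPolar (N := N)).prod (MeasurePreserving.id (surfaceMeasure N))
  have h2 := ((Measure.measurePreserving_swap (μ := radialMeasure N)
    (ν := surfaceMeasure N)).prod (MeasurePreserving.id (surfaceMeasure N))).comp
      ((Measure.measurePreserving_swap (μ := surfaceMeasure N)
        (ν := (radialMeasure N).prod (surfaceMeasure N))).comp
      (measurePreserving_prodAssoc (surfaceMeasure N) (radialMeasure N) (surfaceMeasure N)))
  have h3 := h1.comp h2
  refine ⟨measurable_swapDirection, ?_⟩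
  rw [← h1.map_eq, Measure.map_map measurable_swapDirection h1.measurable, h1.map_eq, ← h3.map_eq]
  congr 1
  ext1 p
  obtain ⟨⟨σ, r⟩, ω⟩ := p
  simp only [swapDirection, Function.comp_apply, Prod.map_apply, norm_ofPolar, direction_ofPolar]
  rfl

/-- The pre-collisional velocities and the scattering direction in terms of the centre of mass `x`,
the post-collisional relative velocity `w` and the pre-collisional direction `ω`. -/
def collisionMap [NeZero N] (p : Vel N × (Vel N × Sph N)) : Vel N × (Vel N × Sph N) :=
  (p.1 + (1 / 2 : ℝ) • (‖p.2.1‖ • (p.2.2 : Vel N)),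
    (p.1 - (1 / 2 : ℝ) • (‖p.2.1‖ • (p.2.2 : Vel N)), direction p.2.1))

/-- The shear `x ↦ x + w/2` followed by `(a, w) ↦ (a, a - w)`; both preserve the measure fibre by
fibre, so no determinant is computed. -/
theorem measurePreserving_centre :
    MeasurePreserving (fun p : Vel N × Vel N => (p.1 + (1 / 2 : ℝ) • p.2, p.1 - (1 / 2 : ℝ) • p.2))
      (volume.prod volume) (volume.prod volume) := by
  have h1 : MeasurePreserving (fun p : Vel N × Vel N => (p.1, p.2 + (1 / 2 : ℝ) • p.1))
      (volume.prod volume) (volume.prod volume) :=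
    (MeasurePreserving.id _).skew_product (g := fun z x => x + (1 / 2 : ℝ) • z) (by fun_prop)
      (Filter.Eventually.of_forall fun z =>
        (measurePreserving_add_right volume ((1 / 2 : ℝ) • z)).map_eq)
  have h2 : MeasurePreserving (fun p : Vel N × Vel N => (p.1, p.1 - p.2))
      (volume.prod volume) (volume.prod volume) :=
    (MeasurePreserving.id _).skew_product (g := fun x z => x - z) (by fun_prop)
      (Filter.Eventually.of_forall fun x => (Measure.measurePreserving_sub_left volume x).map_eq)
  have h3 := h2.comp (Measure.measurePreserving_swap.comp (h1.comp
    (Measure.measurePreserving_swap (μ := (volume : Measure (Vel N))) (ν := (volume : Measure (Vel N))))))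
  convert h3 using 1
  ext1 p
  simp only [Function.comp_apply, Prod.swap, Prod.mk.injEq, true_and]
  module

/-- The pre/post-collisional change of variables: exchange the direction of `w` with `ω` at fixed
`|w|`, then pass from centre of mass and relative velocity to the two velocities. -/
theorem measurePreserving_collisionMap [NeZero N] : MeasurePreserving (collisionMap (N := N))
    (volume.prod (volume.prod (surfaceMeasure N)))
    (volume.prod (volume.prod (surfaceMeasure N))) := by
  have h1 := (MeasurePreserving.id (volume : Measure (Vel N))).prod
    (measurePreserving_swapDirection (N := N))
  have a := measurePreserving_prodAssoc (volume : Measure (Vel N)) (volume : Measure (Vel N))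
    (surfaceMeasure N)
  have h2 := (a.comp ((measurePreserving_centre (N := N)).prod
    (MeasurePreserving.id (surfaceMeasure N)))).comp (a.symm MeasurableEquiv.prodAssoc)
  exact h2.comp h1

end Polar

/-! ### Isometries acting on the sphere -/

section Rotation

variable {N : ℕ}

/-- The action of a linear isometry on the unit sphere. -/
def sphereMap (A : Vel N ≃ₗᵢ[ℝ] Vel N) (σ : Sph N) : Sph N :=
  ⟨A σ, by rw [mem_sphere_zero_iff_norm, A.norm_map, norm_eq_of_mem_sphere]⟩

theorem continuous_sphereMap (A : Vel N ≃ₗᵢ[ℝ] Vel N) : Continuous (sphereMap A) :=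
  (A.continuous.comp continuous_subtype_val).subtype_mk _

open scoped Pointwise in
theorem measurePreserving_sphereMap (A : Vel N ≃ₗᵢ[ℝ] Vel N) :
    MeasurePreserving (sphereMap A) (surfaceMeasure N) (surfaceMeasure N) := by
  refine ⟨(continuous_sphereMap A).measurable, ?_⟩
  ext s hs
  rw [Measure.map_apply (continuous_sphereMap A).measurable hs, surfaceMeasure,
    Measure.toSphere_apply' _ hs,
    Measure.toSphere_apply' _ ((continuous_sphereMap A).measurable hs)]
  congr 1
  rw [← A.measurePreserving.measure_preimage_emb A.toHomeomorph.measurableEmbedding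
    (Set.Ioo (0 : ℝ) 1 • ((↑) '' s : Set (Vel N)))]
  congr 1
  ext x
  simp only [Set.mem_smul, Set.mem_preimage, Set.mem_image]
  constructor
  · rintro ⟨r, hr, _, ⟨σ, hσ, rfl⟩, rfl⟩
    refine ⟨r, hr, _, ⟨sphereMap A σ, hσ, rfl⟩, ?_⟩
    exact (A.map_smul r _).symm
  · rintro ⟨r, hr, _, ⟨σ, hσ, rfl⟩, hx⟩
    refine ⟨r, hr, _, ⟨sphereMap A.symm σ, ?_, rfl⟩, ?_⟩
    · have : sphereMap A (sphereMap A.symm σ) = σ := by ext1; simp [sphereMap]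
      rwa [this]
    · apply A.injective
      change A (r • A.symm σ) = A x
      rw [A.map_smul, A.apply_symm_apply]; exact hx

/-- The reflection exchanging two unit vectors. -/
def swapReflection (e e' : Sph N) : Vel N ≃ₗᵢ[ℝ] Vel N :=
  (ℝ ∙ ((e : Vel N) - e'))ᗮ.reflection

theorem swapReflection_left (e e' : Sph N) : swapReflection e e' e = e' :=
  Submodule.reflection_sub (by simp [norm_eq_of_mem_sphere])

theorem swapReflection_right (e e' : Sph N) : swapReflection e e' e' = e := by
  rw [← swapReflection_left e e', swapReflection, Submodule.reflection_reflection]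

end Rotation

/-! ### Integrals over the sphere -/

section SphereEstimates

variable {N : ℕ}

theorem lintegral_radialMeasure {f : ℝ → ℝ≥0∞} (hf : Measurable f) :
    ∫⁻ r : Set.Ioi (0 : ℝ), f r ∂radialMeasure N =
      ∫⁻ r in Set.Ioi (0 : ℝ), ENNReal.ofReal (r ^ (N - 1)) * f r := by
  rw [radialMeasure, Measure.volumeIoiPow, lintegral_withDensity_eq_lintegral_mul _
    (by fun_prop) (g := fun r : Set.Ioi (0 : ℝ) => f r) (hf.comp measurable_subtype_coe)]
  exact lintegral_subtype_comap measurableSet_Ioi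
    (fun r : ℝ => ENNReal.ofReal (r ^ (N - 1)) * f r)

theorem lintegral_gaussian {a : ℝ} (ha : 0 < a) (y : Vel N) :
    ∫⁻ x : Vel N, ENNReal.ofReal (Real.exp (-a * ‖x - y‖ ^ 2)) =
      ENNReal.ofReal ((Real.pi / a) ^ ((N : ℝ) / 2)) := by
  rw [lintegral_sub_right_eq_self (fun x : Vel N => ENNReal.ofReal (Real.exp (-a * ‖x‖ ^ 2))) y]
  have h := GaussianFourier.integral_rexp_neg_mul_sq_norm (V := Vel N) ha
  rw [finrank_euclideanSpace_fin] at h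
  rw [← h, ofReal_integral_eq_lintegral_ofReal _ (Filter.Eventually.of_forall fun _ => by positivity)]
  -- Integrability comes from the known value of the integral: it is positive, whereas the integral
  -- of a non-integrable function is 0 by convention.
  by_contra hc
  rw [integral_undef hc] at h
  have : (0 : ℝ) < (Real.pi / a) ^ ((N : ℝ) / 2) := by positivity
  linarith

/-- Gaussian integrals over the sphere. -/
theorem exists_lintegral_sphere_gaussian_le (N : ℕ) [NeZero N] : ∃ C : ℝ≥0, ∀ a : ℝ, 0 < a → ∀ τ : Sph N,
    ∫⁻ σ : Sph N, ENNReal.ofReal (Real.exp (-a * ‖(σ : Vel N) - τ‖ ^ 2)) ∂surfaceMeasure N ≤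
      C * ENNReal.ofReal (a ^ (-((N : ℝ) - 1) / 2)) := by
  refine ⟨(Real.exp 1 * (2 * Real.pi) ^ ((N : ℝ) / 2)).toNNReal, fun a ha τ => ?_⟩
  -- Thicken the sphere to a shell of width `δ = a^{-1/2}`. There ‖rσ - τ‖² ≤ 2‖σ - τ‖² + 2δ² and
  -- `aδ² = 1`, so `e` times the Gaussian of parameter `a/2` dominates the one on the sphere. Hence
  -- δ times the sphere integral is at most `e` times a Gaussian integral over the whole space.
  set δ : ℝ := a ^ (-(1 / 2) : ℝ) with hδ
  have hδ0 : 0 < δ := by positivity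
  have haδ : a * δ ^ 2 = 1 := by
    rw [hδ, ← Real.rpow_natCast, ← Real.rpow_mul ha.le]
    norm_num [Real.rpow_neg_one, ha.ne']
  have key : ∀ σ : Sph N, ENNReal.ofReal δ *
      ENNReal.ofReal (Real.exp (-a * ‖(σ : Vel N) - τ‖ ^ 2)) ≤
      ∫⁻ r, ENNReal.ofReal (Real.exp 1) *
        ENNReal.ofReal (Real.exp (-(a / 2) * ‖ofPolar (σ, r) - τ‖ ^ 2)) ∂radialMeasure N := by
    intro σ
    have e := lintegral_radialMeasure (N := N) (f := fun r : ℝ => ENNReal.ofReal (Real.exp 1) *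
        ENNReal.ofReal (Real.exp (-(a / 2) * ‖r • (σ : Vel N) - τ‖ ^ 2))) (by fun_prop)
    simp only [ofPolar]
    rw [e]
    calc ENNReal.ofReal δ * ENNReal.ofReal (Real.exp (-a * ‖(σ : Vel N) - τ‖ ^ 2))
        = ∫⁻ r in Set.Ioo 1 (1 + δ), ENNReal.ofReal (Real.exp (-a * ‖(σ : Vel N) - τ‖ ^ 2)) := by
          rw [setLIntegral_const, Real.volume_Ioo, add_sub_cancel_left, mul_comm]
      _ ≤ ∫⁻ r in Set.Ioo 1 (1 + δ), ENNReal.ofReal (r ^ (N - 1)) * (ENNReal.ofReal (Real.exp 1) *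
          ENNReal.ofReal (Real.exp (-(a / 2) * ‖r • (σ : Vel N) - τ‖ ^ 2))) := by
        refine setLIntegral_mono' measurableSet_Ioo fun r hr => ?_
        rw [← ENNReal.ofReal_mul (by positivity), ← ENNReal.ofReal_mul (pow_nonneg (by linarith [hr.1]) _)]
        refine ENNReal.ofReal_le_ofReal ?_
        rw [← Real.exp_add]
        have h1 : 1 ≤ r ^ (N - 1) := one_le_pow₀ hr.1.le
        refine le_trans ?_ (le_mul_of_one_le_left (Real.exp_pos _).le h1)
        refine Real.exp_le_exp.2 ?_
        have h2 : ‖r • (σ : Vel N) - τ‖ ≤ ‖(σ : Vel N) - τ‖ + δ := by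
          have : r • (σ : Vel N) - τ = ((σ : Vel N) - τ) + (r - 1) • (σ : Vel N) := by module
          rw [this]
          refine (norm_add_le _ _).trans (add_le_add_right ?_ _)
          rw [norm_smul, norm_eq_of_mem_sphere, mul_one, Real.norm_of_nonneg (by linarith [hr.1])]
          linarith [hr.2]
        have h3 : ‖r • (σ : Vel N) - τ‖ ^ 2 ≤ 2 * ‖(σ : Vel N) - τ‖ ^ 2 + 2 * δ ^ 2 := by
          have := pow_le_pow_left₀ (norm_nonneg _) h2 2
          nlinarith [sq_nonneg (‖(σ : Vel N) - τ‖ - δ)]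
        nlinarith
      _ ≤ _ := lintegral_mono_set fun r hr => lt_trans one_pos hr.1
  have h1 : ENNReal.ofReal δ *
      ∫⁻ σ : Sph N, ENNReal.ofReal (Real.exp (-a * ‖(σ : Vel N) - τ‖ ^ 2)) ∂surfaceMeasure N ≤
      ENNReal.ofReal (Real.exp 1) * ENNReal.ofReal ((Real.pi / (a / 2)) ^ ((N : ℝ) / 2)) := by
    rw [← lintegral_const_mul _ (by fun_prop)]
    refine (lintegral_mono key).trans (le_of_eq ?_)
    rw [← lintegral_gaussian (by positivity) (τ : Vel N), ← lintegral_const_mul _ (by fun_prop),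
      lintegral_ofPolar (by fun_prop)]
  have h2 : ENNReal.ofReal δ⁻¹ * ENNReal.ofReal δ = 1 := by
    rw [← ENNReal.ofReal_mul (by positivity), inv_mul_cancel₀ hδ0.ne', ENNReal.ofReal_one]
  calc _ = ENNReal.ofReal δ⁻¹ * (ENNReal.ofReal δ *
      ∫⁻ σ : Sph N, ENNReal.ofReal (Real.exp (-a * ‖(σ : Vel N) - τ‖ ^ 2)) ∂surfaceMeasure N) := by
        rw [← mul_assoc, h2, one_mul]
    _ ≤ ENNReal.ofReal δ⁻¹ * (ENNReal.ofReal (Real.exp 1) *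
        ENNReal.ofReal ((Real.pi / (a / 2)) ^ ((N : ℝ) / 2))) := by gcongr
    _ = _ := by
      rw [← ENNReal.ofReal_mul (by positivity), ← ENNReal.ofReal_mul (by positivity),
        ← ENNReal.ofReal.eq_1, ← ENNReal.ofReal_mul (by positivity)]
      congr 1
      rw [show Real.pi / (a / 2) = (2 * Real.pi) * a⁻¹ by field_simp,
        Real.mul_rpow (by positivity) (by positivity), Real.inv_rpow ha.le, ← Real.rpow_neg ha.le,
        ← Real.rpow_neg ha.le]
      have : a ^ (-((N : ℝ) - 1) / 2) = a ^ (-(-(1 / 2)) : ℝ) * a ^ (-((N : ℝ) / 2)) := by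
        rw [← Real.rpow_add ha]; congr 1; ring
      rw [this]; ring

theorem exists_lintegral_radial (m : ℕ) : ∃ C : ℝ≥0, ∀ f : ℝ → ℝ≥0∞, Measurable f →
    ∫⁻ y : Vel (m + 1), f ‖y‖ = C * ∫⁻ r in Set.Ioi (0 : ℝ), ENNReal.ofReal (r ^ m) * f r := by
  refine ⟨(surfaceMeasure (m + 1) Set.univ).toNNReal, fun f hf => ?_⟩
  rw [lintegral_ofPolar (by fun_prop)]
  simp only [norm_ofPolar]
  rw [lintegral_const, lintegral_radialMeasure hf, ENNReal.coe_toNNReal (measure_ne_top _ _), mul_comm]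
  simp

theorem exists_lintegral_cylindrical (m : ℕ) : ∃ C : ℝ≥0, ∀ f : ℝ × ℝ → ℝ≥0∞, Measurable f →
    ∫⁻ x : Vel (m + 2), f (x 0, Real.sqrt (‖x‖ ^ 2 - x 0 ^ 2)) =
      C * ∫⁻ t : ℝ, ∫⁻ r in Set.Ioi (0 : ℝ), ENNReal.ofReal (r ^ m) * f (t, r) := by
  obtain ⟨C, hC⟩ := exists_lintegral_radial m
  refine ⟨C, fun f hf => ?_⟩
  have hmeas : Measurable fun x : Vel (m + 2) => f (x 0, Real.sqrt (‖x‖ ^ 2 - x 0 ^ 2)) := by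
    refine hf.comp (Measurable.prodMk (by fun_prop) ?_)
    exact Real.continuous_sqrt.measurable.comp (by fun_prop)
  rw [← (PiLp.volume_preserving_toLp (Fin (m + 2))).lintegral_comp hmeas]
  have h1 := volume_preserving_piFinSuccAbove (fun _ : Fin (m + 2) => ℝ) 0
  have h2 := (MeasurePreserving.id (volume : Measure ℝ)).prod
    (PiLp.volume_preserving_toLp (Fin (m + 1)))
  have h3 := h2.comp h1
  have hm2 : Measurable fun p : ℝ × Vel (m + 1) => f (p.1, ‖p.2‖) := hf.comp (by fun_prop)
  have h4 := h3.lintegral_comp hm2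
  rw [lintegral_prod _ hm2.aemeasurable] at h4
  rw [← lintegral_const_mul' _ _ ENNReal.coe_ne_top]
  calc _ = ∫⁻ (t : ℝ), ∫⁻ (y : Vel (m + 1)), f (t, ‖y‖) := ?_
    _ = _ := lintegral_congr fun t => hC (fun r => f (t, r)) (by fun_prop)
  rw [← h4]
  refine lintegral_congr fun x => ?_
  simp only [Function.comp_apply, Prod.map_apply, MeasurableEquiv.piFinSuccAbove_apply,
    Fin.insertNthEquiv_symm_apply]
  congr 2
  rw [EuclideanSpace.norm_eq, EuclideanSpace.norm_eq, Real.sq_sqrt (by positivity),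
    Fin.sum_univ_succ]
  simp
  rfl

/-- Integrals over the sphere of functions of one coordinate. -/
theorem exists_lintegral_sphere_coord_le (m : ℕ) : ∃ C : ℝ≥0, ∀ F : ℝ → ℝ≥0∞, Measurable F →
    ∫⁻ ω : Sph (m + 2), F ((ω : Vel (m + 2)) 0) ∂surfaceMeasure (m + 2) ≤
      C * ∫⁻ θ in Set.Ioo 0 Real.pi, F (Real.cos θ) * ENNReal.ofReal (Real.sin θ ^ m) := by
  obtain ⟨C, hC⟩ := exists_lintegral_cylindrical m
  refine ⟨(m + 2) * C, fun F hF => ?_⟩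
  -- In cylindrical coordinates `G` is the function 1_{|x|<1} F(x₀/|x|). Its integral is computed
  -- twice: in spherical coordinates it is 1/(m+2) times the integral over the sphere, and in plane
  -- polar coordinates for (x₀, distance to the axis) it is bounded by the integral over `θ`.
  set G : ℝ × ℝ → ℝ≥0∞ := fun p => (Set.Iio 1).indicator 1 (Real.sqrt (p.1 ^ 2 + p.2 ^ 2)) *
    F (p.1 / Real.sqrt (p.1 ^ 2 + p.2 ^ 2)) with hG
  have hGm : Measurable G := by
    refine Measurable.mul ((measurable_one.indicator measurableSet_Iio).comp (by fun_prop))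
      (hF.comp (by fun_prop))
  have hl : ∫⁻ x : Vel (m + 2), G (x 0, Real.sqrt (‖x‖ ^ 2 - x 0 ^ 2)) =
      ENNReal.ofReal (1 / (m + 2)) *
        ∫⁻ ω : Sph (m + 2), F ((ω : Vel (m + 2)) 0) ∂surfaceMeasure (m + 2) := by
    have e : ∀ x : Vel (m + 2), G (x 0, Real.sqrt (‖x‖ ^ 2 - x 0 ^ 2)) =
        (Set.Iio 1).indicator 1 ‖x‖ * F (x 0 / ‖x‖) := by
      intro x
      have h0 : 0 ≤ ‖x‖ ^ 2 - x 0 ^ 2 := by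
        have := PiLp.norm_apply_le x 0
        rw [Real.norm_eq_abs] at this
        have := sq_le_sq' (by linarith [neg_abs_le (x 0), norm_nonneg x]) ((le_abs_self _).trans this)
        linarith
      simp only [hG]
      rw [Real.sq_sqrt h0, add_sub_cancel, Real.sqrt_sq (norm_nonneg x)]
    simp only [e]
    rw [lintegral_ofPolar]
    · have e2 : ∀ (ω : Sph (m + 2)) (r : Set.Ioi (0 : ℝ)),
          (ofPolar (ω, r) : Vel (m + 2)) 0 / ‖ofPolar (ω, r)‖ = (ω : Vel (m + 2)) 0 := by
        intro ω r
        rw [norm_ofPolar, ofPolar]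
        simp only [PiLp.smul_apply, smul_eq_mul]
        field_simp [ne_of_gt r.2.out]
      simp only [e2]
      simp only [norm_ofPolar]
      have e3 : ∀ ω : Sph (m + 2), ∫⁻ r : Set.Ioi (0 : ℝ), (Set.Iio 1).indicator 1 (r : ℝ) *
          F ((ω : Vel (m + 2)) 0) ∂radialMeasure (m + 2) =
          ENNReal.ofReal (1 / (m + 2)) * F ((ω : Vel (m + 2)) 0) := by
        intro ω
        rw [lintegral_mul_const (f := fun r : Set.Ioi (0 : ℝ) => (Set.Iio (1 : ℝ)).indicator
          (1 : ℝ → ℝ≥0∞) r) _ ((measurable_one.indicator measurableSet_Iio).comp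
          measurable_subtype_coe)]
        congr 1
        have h5 := Measure.volumeIoiPow_apply_Iio (m + 1) ⟨1, Set.mem_Ioi.2 one_pos⟩
        rw [radialMeasure, show m + 2 - 1 = m + 1 by rfl]
        rw [← lintegral_indicator_one measurableSet_Iio] at h5
        convert h5 using 2
        · rfl
        · push_cast
          rw [one_pow, add_assoc]; norm_num
      simp only [e3]
      rw [lintegral_const_mul _ (by fun_prop)]
    · refine Measurable.mul ((measurable_one.indicator measurableSet_Iio).comp measurable_norm)
        (hF.comp (by fun_prop))
  have hr : ∫⁻ t : ℝ, ∫⁻ r in Set.Ioi (0 : ℝ), ENNReal.ofReal (r ^ m) * G (t, r) ≤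
      ∫⁻ θ in Set.Ioo 0 Real.pi, F (Real.cos θ) * ENNReal.ofReal (Real.sin θ ^ m) := by
    set K : ℝ × ℝ → ℝ≥0∞ := fun p => (Set.Ioi 0).indicator 1 p.2 *
      (ENNReal.ofReal (p.2 ^ m) * G p) with hK
    have hKm : Measurable K := by
      refine Measurable.mul ((measurable_one.indicator measurableSet_Ioi).comp measurable_snd)
        (Measurable.mul (by fun_prop) hGm)
    have e1 : ∫⁻ t : ℝ, ∫⁻ r in Set.Ioi (0 : ℝ), ENNReal.ofReal (r ^ m) * G (t, r) =
        ∫⁻ p : ℝ × ℝ, K p := by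
      rw [Measure.volume_eq_prod, lintegral_prod _ hKm.aemeasurable]
      congr 1; ext1 t
      rw [← lintegral_indicator measurableSet_Ioi]
      congr 1; ext1 r
      by_cases h : r ∈ Set.Ioi (0 : ℝ) <;> simp [hK, h]
    rw [e1, ← lintegral_comp_polarCoord_symm]
    -- Only angles in (0, π) survive the condition of a positive distance to the axis, and the
    -- radial factors `r · r^m` are at most 1 for `r < 1`.
    have e2 : ∀ p ∈ polarCoord.target, ENNReal.ofReal p.1 • K (polarCoord.symm p) ≤
        (Set.Ioo 0 1).indicator 1 p.1 * ((Set.Ioo 0 Real.pi).indicator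
          (fun θ => F (Real.cos θ) * ENNReal.ofReal (Real.sin θ ^ m)) p.2) := by
      rintro ⟨r, θ⟩ ⟨hr, hθ⟩
      simp only [Set.mem_Ioi] at hr
      have hs : Real.sqrt ((r * Real.cos θ) ^ 2 + (r * Real.sin θ) ^ 2) = r := by
        rw [show (r * Real.cos θ) ^ 2 + (r * Real.sin θ) ^ 2 =
          r ^ 2 * (Real.sin θ ^ 2 + Real.cos θ ^ 2) by ring, Real.sin_sq_add_cos_sq, mul_one,
          Real.sqrt_sq hr.le]
      simp only [hK, hG, polarCoord_symm_apply, hs, smul_eq_mul]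
      rw [mul_div_cancel_left₀ _ hr.ne']
      by_cases hr1 : r < 1
      swap
      · simp [hr1]
      by_cases hθ0 : 0 < θ
      swap
      · have : Real.sin θ ≤ 0 := Real.sin_nonpos_of_nonpos_of_neg_pi_le (not_lt.1 hθ0) hθ.1.le
        have : ¬ 0 < r * Real.sin θ := not_lt.2 (mul_nonpos_of_nonneg_of_nonpos hr.le this)
        simp [this]
      have hsin : 0 < Real.sin θ := Real.sin_pos_of_pos_of_lt_pi hθ0 hθ.2
      have hmem : θ ∈ Set.Ioo 0 Real.pi := ⟨hθ0, hθ.2⟩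
      have hmr : r ∈ Set.Ioo (0 : ℝ) 1 := ⟨hr, hr1⟩
      rw [Set.indicator_of_mem (show r * Real.sin θ ∈ Set.Ioi 0 from mul_pos hr hsin),
        Set.indicator_of_mem (show r ∈ Set.Iio 1 from hr1), Set.indicator_of_mem hmem,
        Set.indicator_of_mem hmr]
      simp only [Pi.one_apply, one_mul]
      rw [mul_pow, ENNReal.ofReal_mul (by positivity)]
      have a1 : ENNReal.ofReal r ≤ 1 := by simpa using hr1.le
      have a2 : ENNReal.ofReal (r ^ m) ≤ 1 := by simpa using pow_le_one₀ hr.le hr1.le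
      calc _ = ENNReal.ofReal r * ENNReal.ofReal (r ^ m) *
            (F (Real.cos θ) * ENNReal.ofReal (Real.sin θ ^ m)) := by ring
        _ ≤ 1 * 1 * _ := by gcongr
        _ = _ := by simp
    refine (setLIntegral_mono' polarCoord.open_target.measurableSet e2).trans ?_
    refine (setLIntegral_le_lintegral _ _).trans ?_
    have m1 : Measurable ((Set.Ioo (0 : ℝ) 1).indicator (1 : ℝ → ℝ≥0∞)) :=
      measurable_one.indicator measurableSet_Ioo
    have m2 : Measurable ((Set.Ioo 0 Real.pi).indicator
          (fun θ => F (Real.cos θ) * ENNReal.ofReal (Real.sin θ ^ m))) :=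
      Measurable.indicator (Measurable.mul (hF.comp (by fun_prop)) (by fun_prop)) measurableSet_Ioo
    rw [Measure.volume_eq_prod, lintegral_prod_mul m1.aemeasurable m2.aemeasurable,
      lintegral_indicator_one measurableSet_Ioo, lintegral_indicator measurableSet_Ioo]
    simp
  rw [hC G hGm] at hl
  have h6 : ((m + 2 : ℝ≥0) : ℝ≥0∞) * ENNReal.ofReal (1 / (m + 2)) = 1 := by
    have : ((m + 2 : ℝ≥0) : ℝ≥0∞) = ENNReal.ofReal (m + 2) := by
      rw [ENNReal.ofReal]; congr 1; ext; simp
    rw [this, ← ENNReal.ofReal_mul (by positivity), mul_one_div_cancel (by positivity)]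
    simp
  calc _ = ((m + 2 : ℝ≥0) : ℝ≥0∞) * (ENNReal.ofReal (1 / (m + 2)) *
        ∫⁻ ω : Sph (m + 2), F ((ω : Vel (m + 2)) 0) ∂surfaceMeasure (m + 2)) := by
        rw [← mul_assoc, h6, one_mul]
    _ ≤ _ := by
      rw [← hl, ENNReal.coe_mul, mul_assoc]
      gcongr

/-- The angular kernel is square integrable on the sphere, in any direction. -/
theorem exists_lintegral_sphere_sq_le (N : ℕ) (hN : 2 ≤ N) : ∃ C : ℝ≥0, ∀ b : ℝ → ℝ, Measurable b →
    ∀ e : Sph N, ∫⁻ ω : Sph N, ENNReal.ofReal (b (inner ℝ (ω : Vel N) e) ^ 2) ∂surfaceMeasure N ≤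
      C * angularL2Norm N b ^ 2 := by
  obtain ⟨m, rfl⟩ := Nat.exists_eq_add_of_le' hN
  obtain ⟨C, hC⟩ := exists_lintegral_sphere_coord_le m
  refine ⟨C, fun b hb e => ?_⟩
  have h1 := hC (fun t => ENNReal.ofReal (b t ^ 2)) (by fun_prop)
  set e₀ : Sph (m + 2) := ⟨EuclideanSpace.single 0 1, by simp⟩
  have h2 := (measurePreserving_sphereMap (swapReflection e₀ e)).lintegral_comp
    (f := fun ω : Sph (m + 2) => ENNReal.ofReal (b (inner ℝ (ω : Vel (m + 2)) e) ^ 2)) (by fun_prop)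
  rw [← h2]
  have h3 : ∀ ω : Sph (m + 2), inner ℝ ((sphereMap (swapReflection e₀ e) ω : Sph (m + 2)) : Vel (m + 2))
      (e : Vel (m + 2)) = (ω : Vel (m + 2)) 0 := by
    intro ω
    have : (e : Vel (m + 2)) = swapReflection e₀ e e₀ := (swapReflection_left e₀ e).symm
    rw [this]
    change inner ℝ (swapReflection e₀ e ω) (swapReflection e₀ e e₀) = _
    rw [LinearIsometryEquiv.inner_map_map]
    simp [e₀, EuclideanSpace.inner_single_right]
  simp only [h3]
  refine h1.trans (le_of_eq ?_)
  rw [angularL2Norm, ← ENNReal.rpow_natCast, ← ENNReal.rpow_mul]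
  norm_num
  congr 2; ext1 θ
  rw [ENNReal.ofReal_mul (by positivity)]

end SphereEstimates

/-! ### The averaging estimate for the angular kernel -/

section Kernel

variable {N : ℕ} [NeZero N]

/-- The tensor components of the angular average of plane waves. -/
def angularKernel (b : ℝ → ℝ) {j : ℕ} (α : Fin j → Fin N) (ξ w : Vel N) : ℂ :=
  ∫ ω : Sph N, ((b (inner ℝ (ω : Vel N) (direction w)) * ∏ i, (ω : Vel N) (α i) : ℝ) : ℂ) *
    (Real.fourierChar (-(‖w‖ / 2 * inner ℝ (ω : Vel N) ξ)) : ℂ) ∂surfaceMeasure N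

theorem measurable_fourierChar : Measurable fun x : ℝ => (Real.fourierChar x : ℂ) :=
  (continuous_subtype_val.comp Real.continuous_fourierChar).measurable

theorem stronglyMeasurable_angularKernel {b : ℝ → ℝ} (hb : Measurable b) {j : ℕ}
    (α : Fin j → Fin N) (ξ : Vel N) : StronglyMeasurable (angularKernel b α ξ) := by
  unfold angularKernel
  refine StronglyMeasurable.integral_prod_right'
    (f := fun p : Vel N × Sph N => ((b (inner ℝ (p.2 : Vel N) (direction p.1)) *
      ∏ i, (p.2 : Vel N) (α i) : ℝ) : ℂ) *
      (Real.fourierChar (-(‖p.1‖ / 2 * inner ℝ (p.2 : Vel N) ξ)) : ℂ)) ?_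
  refine Measurable.stronglyMeasurable (Measurable.mul ?_ (measurable_fourierChar.comp ?_))
  · refine Complex.measurable_ofReal.comp (Measurable.mul (hb.comp ?_) (by fun_prop))
    have : Measurable fun p : Vel N × Sph N => (direction p.1 : Vel N) :=
      measurable_direction.subtype_val.comp measurable_fst
    exact Measurable.inner (by fun_prop) this
  · fun_prop

variable {b : ℝ → ℝ}

theorem memLp_angular (hb : Measurable b) {B : ℝ≥0∞} (hB : B ≠ ∞) (e : Sph N)
    (h : ∫⁻ ω : Sph N, ENNReal.ofReal (b (inner ℝ (ω : Vel N) e) ^ 2) ∂surfaceMeasure N ≤ B) :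
    MemLp (fun ω : Sph N => b (inner ℝ (ω : Vel N) e)) 2 (surfaceMeasure N) := by
  refine ⟨(hb.comp (by fun_prop)).aestronglyMeasurable, ?_⟩
  rw [eLpNorm_lt_top_iff_lintegral_rpow_enorm_lt_top (by norm_num) (by norm_num)]
  refine lt_of_le_of_lt (le_trans (lintegral_mono fun ω => ?_) h) (lt_top_iff_ne_top.2 hB)
  simp [Real.enorm_eq_ofReal_abs, ← ENNReal.ofReal_pow]

theorem integrable_angular (hb : Measurable b) {B : ℝ≥0∞} (hB : B ≠ ∞) (e : Sph N)
    (h : ∫⁻ ω : Sph N, ENNReal.ofReal (b (inner ℝ (ω : Vel N) e) ^ 2) ∂surfaceMeasure N ≤ B) :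
    Integrable (fun ω : Sph N => b (inner ℝ (ω : Vel N) e)) (surfaceMeasure N) :=
  (memLp_angular hb hB e h).integrable (by norm_num)

theorem abs_coord_le_one (ω : Sph N) (i : Fin N) : |(ω : Vel N) i| ≤ 1 := by
  have := PiLp.norm_apply_le (ω : Vel N) i
  rwa [norm_eq_of_mem_sphere, Real.norm_eq_abs] at this

theorem abs_inner_le_one (ω ω' : Sph N) : |inner ℝ (ω : Vel N) (ω' : Vel N)| ≤ 1 := by
  have := abs_real_inner_le_norm (ω : Vel N) ω'
  simpa [norm_eq_of_mem_sphere] using this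

/-- The double angular average, after summation over all tensor components. -/
def angularGram (b : ℝ → ℝ) (j : ℕ) (e : Sph N) (η : Vel N) : ℂ :=
  ∫ p : Sph N × Sph N, ((b (inner ℝ (p.1 : Vel N) e) * b (inner ℝ (p.2 : Vel N) e) *
    inner ℝ (p.1 : Vel N) (p.2 : Vel N) ^ j : ℝ) : ℂ) *
    (Real.fourierChar (-inner ℝ η ((p.1 : Vel N) - p.2)) : ℂ)
    ∂((surfaceMeasure N).prod (surfaceMeasure N))

theorem integrable_angularGram_aux {e : Sph N}
    (hi : Integrable (fun ω : Sph N => b (inner ℝ (ω : Vel N) e)) (surfaceMeasure N)) (j : ℕ) :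
    Integrable (fun p : Sph N × Sph N => b (inner ℝ (p.1 : Vel N) e) *
      b (inner ℝ (p.2 : Vel N) e) * inner ℝ (p.1 : Vel N) (p.2 : Vel N) ^ j)
      ((surfaceMeasure N).prod (surfaceMeasure N)) := by
  refine (hi.mul_prod hi).mul_bdd (c := 1) (by fun_prop) (Filter.Eventually.of_forall fun p => ?_)
  rw [norm_pow]
  exact pow_le_one₀ (norm_nonneg _) (abs_inner_le_one _ _)

/-- Expand each square as a double integral. Summing the products of coordinates over all `α` gives
(ω·ω')^j, so the number N^j of components never enters the estimates. -/
theorem sum_sq_angularKernel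
    (hi : ∀ e : Sph N, Integrable (fun ω : Sph N => b (inner ℝ (ω : Vel N) e)) (surfaceMeasure N))
    (j : ℕ) (ξ w : Vel N) :
    ((∑ α : Fin j → Fin N, ‖angularKernel b α ξ w‖ ^ 2 : ℝ) : ℂ) =
      angularGram b j (direction w) ((‖w‖ / 2) • ξ) := by
  push_cast
  have h1 : ∀ α : Fin j → Fin N, Integrable (fun ω : Sph N =>
      ((b (inner ℝ (ω : Vel N) (direction w)) * ∏ i, (ω : Vel N) (α i) : ℝ) : ℂ) *
      (Real.fourierChar (-(‖w‖ / 2 * inner ℝ (ω : Vel N) ξ)) : ℂ)) (surfaceMeasure N) := by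
    intro α
    refine Integrable.mul_bdd (c := 1) (Integrable.ofReal ?_)
      (measurable_fourierChar.comp (by fun_prop)).aestronglyMeasurable
      (Filter.Eventually.of_forall fun ω => by rw [Circle.norm_coe])
    refine (hi _).mul_bdd (c := 1) (by fun_prop) (Filter.Eventually.of_forall fun ω => ?_)
    rw [norm_prod]
    exact Finset.prod_le_one (fun _ _ => norm_nonneg _) fun i _ => abs_coord_le_one _ _
  have h2 : ∀ α : Fin j → Fin N, ((‖angularKernel b α ξ w‖ : ℂ)) ^ 2 =
      ∫ p : Sph N × Sph N, (((b (inner ℝ (p.1 : Vel N) (direction w)) *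
        ∏ i, (p.1 : Vel N) (α i) : ℝ) : ℂ) *
        (Real.fourierChar (-(‖w‖ / 2 * inner ℝ (p.1 : Vel N) ξ)) : ℂ)) *
        (starRingEnd ℂ) (((b (inner ℝ (p.2 : Vel N) (direction w)) *
        ∏ i, (p.2 : Vel N) (α i) : ℝ) : ℂ) *
        (Real.fourierChar (-(‖w‖ / 2 * inner ℝ (p.2 : Vel N) ξ)) : ℂ))
        ∂((surfaceMeasure N).prod (surfaceMeasure N)) := by
    intro α
    rw [integral_prod_mul (fun ω : Sph N => ((b (inner ℝ (ω : Vel N) (direction w)) *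
        ∏ i, (ω : Vel N) (α i) : ℝ) : ℂ) *
        (Real.fourierChar (-(‖w‖ / 2 * inner ℝ (ω : Vel N) ξ)) : ℂ)) (fun ω : Sph N =>
        (starRingEnd ℂ) (((b (inner ℝ (ω : Vel N) (direction w)) *
        ∏ i, (ω : Vel N) (α i) : ℝ) : ℂ) *
        (Real.fourierChar (-(‖w‖ / 2 * inner ℝ (ω : Vel N) ξ)) : ℂ))), integral_conj,
      ← angularKernel, Complex.mul_conj, Complex.normSq_eq_norm_sq]
    push_cast; rfl
  rw [Finset.sum_congr rfl fun α _ => h2 α, ← integral_finsetSum]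
  · refine integral_congr_ae (Filter.Eventually.of_forall fun p => ?_)
    have e1 : ∀ x : ℝ, (starRingEnd ℂ) (Real.fourierChar x : ℂ) = Real.fourierChar (-x) := by
      intro x
      rw [AddChar.map_neg_eq_inv, Circle.coe_inv_eq_conj]
    have e2 : (Real.fourierChar (-inner ℝ ((‖w‖ / 2) • ξ) ((p.1 : Vel N) - p.2)) : ℂ) =
        (Real.fourierChar (-(‖w‖ / 2 * inner ℝ (p.1 : Vel N) ξ)) : ℂ) *
        (Real.fourierChar (-(-(‖w‖ / 2 * inner ℝ (p.2 : Vel N) ξ))) : ℂ) := by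
      rw [← Circle.coe_mul, ← AddChar.map_add_eq_mul]
      congr 2
      rw [inner_smul_left, inner_sub_right, real_inner_comm (p.1 : Vel N), real_inner_comm (p.2 : Vel N)]
      simp; ring
    simp only [map_mul, Complex.conj_ofReal, e1, e2]
    have e3 : (inner ℝ (p.1 : Vel N) (p.2 : Vel N) ^ j : ℝ) =
        ∑ α : Fin j → Fin N, (∏ i, (p.1 : Vel N) (α i)) * ∏ i, (p.2 : Vel N) (α i) := by
      have : inner ℝ (p.1 : Vel N) (p.2 : Vel N) = ∑ i, (p.1 : Vel N) i * (p.2 : Vel N) i := by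
        simp [PiLp.inner_apply, mul_comm]
      rw [this, Fintype.sum_pow]
      exact Finset.sum_congr rfl fun α _ => Finset.prod_mul_distrib
    rw [e3]
    push_cast
    rw [Finset.mul_sum, Finset.sum_mul]
    exact Finset.sum_congr rfl fun α _ => by ring
  · intro α _
    exact (h1 α).mul_prod (Integrable.congr ((Complex.conjCLE : ℂ →L[ℝ] ℂ).integrable_comp (h1 α))
      (Filter.Eventually.of_forall fun _ => rfl))

/-- The reflection exchanging the directions of `w` and `ξ` preserves the surface measure and inner
products. On the right-hand side `w` has left the argument of `b` and remains only in the phase,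
where it can be integrated out. -/
theorem angularGram_direction_swap (hb : Measurable b) (j : ℕ) {ξ : Vel N} (w : Vel N) :
    angularGram b j (direction w) ((‖w‖ / 2) • ξ) =
      angularGram b j (direction ξ) ((‖ξ‖ / 2) • w) := by
  set R := swapReflection (direction w) (direction ξ) with hR
  have hp := (measurePreserving_sphereMap R).prod (measurePreserving_sphereMap R)
  unfold angularGram
  rw [← hp.map_eq, integral_map hp.measurable.aemeasurable, hp.map_eq]
  · refine integral_congr_ae (Filter.Eventually.of_forall fun p => ?_)
    have hw : ∀ σ : Vel N, inner ℝ (R σ) (direction w : Vel N) = inner ℝ σ (direction ξ : Vel N) := by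
      intro σ
      rw [← swapReflection_right (direction w) (direction ξ), ← hR, R.inner_map_map]
    have h1 : ∀ ω : Sph N, ((sphereMap R ω : Sph N) : Vel N) = R ω := fun ω => rfl
    have h2 : inner ℝ ((‖w‖ / 2) • ξ) (R p.1 - R p.2) =
        inner ℝ ((‖ξ‖ / 2) • w) ((p.1 : Vel N) - p.2) := by
      rw [← map_sub]
      have hx : ξ = ‖ξ‖ • R (direction w) := by
        rw [hR, swapReflection_left, norm_smul_direction]
      have hw' : w = ‖w‖ • (direction w : Vel N) := (norm_smul_direction w).symm
      conv_lhs => rw [hx]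
      conv_rhs => rw [hw']
      rw [inner_smul_left, inner_smul_left, inner_smul_left, inner_smul_left, R.inner_map_map]
      simp; ring
    simp only [Prod.map_fst, Prod.map_snd, h1, hw, h2, R.inner_map_map]
  · rw [hp.map_eq]
    refine (Measurable.mul (Complex.measurable_ofReal.comp ?_)
      (measurable_fourierChar.comp (by fun_prop))).aestronglyMeasurable
    refine Measurable.mul (Measurable.mul (hb.comp (by fun_prop)) (hb.comp (by fun_prop)))
      (by fun_prop)

/-- Schur's test: |b b'| ≤ (b² + b'²)/2, and for each of the two squares the kernel is integrated in
the other variable. -/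
theorem lintegral_schur_sphere {B D : ℝ≥0∞} {e : Sph N} (hb : Measurable b)
    (h : ∫⁻ ω : Sph N, ENNReal.ofReal (b (inner ℝ (ω : Vel N) e) ^ 2) ∂surfaceMeasure N ≤ B)
    {G : ℝ → ℝ≥0∞} (hG : Measurable G)
    (hD : ∀ τ : Sph N, ∫⁻ σ : Sph N, G ‖(σ : Vel N) - τ‖ ∂surfaceMeasure N ≤ D) :
    ∫⁻ p : Sph N × Sph N, ‖b (inner ℝ (p.1 : Vel N) e)‖ₑ * ‖b (inner ℝ (p.2 : Vel N) e)‖ₑ *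
      G ‖(p.1 : Vel N) - p.2‖ ∂((surfaceMeasure N).prod (surfaceMeasure N)) ≤ D * B := by
  set β : Sph N → ℝ≥0∞ := fun ω => ENNReal.ofReal (b (inner ℝ (ω : Vel N) e) ^ 2) with hβ
  have hβm : Measurable β := ENNReal.measurable_ofReal.comp ((hb.comp (by fun_prop)).pow_const 2)
  have hGm : Measurable fun p : Sph N × Sph N => G ‖(p.1 : Vel N) - p.2‖ := hG.comp (by fun_prop)
  have hpt : ∀ p : Sph N × Sph N, ‖b (inner ℝ (p.1 : Vel N) e)‖ₑ * ‖b (inner ℝ (p.2 : Vel N) e)‖ₑ *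
      G ‖(p.1 : Vel N) - p.2‖ ≤ 2⁻¹ * (β p.1 * G ‖(p.1 : Vel N) - p.2‖) +
        2⁻¹ * (β p.2 * G ‖(p.1 : Vel N) - p.2‖) := by
    intro p
    rw [← mul_assoc, ← mul_assoc, ← add_mul]
    gcongr
    have h2 : (2⁻¹ : ℝ≥0∞) = ENNReal.ofReal (1 / 2) := by
      rw [one_div, ENNReal.ofReal_inv_of_pos two_pos]; simp
    rw [h2, Real.enorm_eq_ofReal_abs, Real.enorm_eq_ofReal_abs, ← ENNReal.ofReal_mul (abs_nonneg _),
      ← ENNReal.ofReal_mul (by norm_num), ← ENNReal.ofReal_mul (by norm_num),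
      ← ENNReal.ofReal_add (by positivity) (by positivity)]
    refine ENNReal.ofReal_le_ofReal ?_
    rw [← sq_abs (b (inner ℝ (p.1 : Vel N) e)), ← sq_abs (b (inner ℝ (p.2 : Vel N) e))]
    nlinarith [sq_nonneg (|b (inner ℝ (p.1 : Vel N) e)| - |b (inner ℝ (p.2 : Vel N) e)|)]
  refine (lintegral_mono hpt).trans ?_
  have m1 : Measurable fun p : Sph N × Sph N => β p.1 * G ‖(p.1 : Vel N) - p.2‖ :=
    (hβm.comp measurable_fst).mul hGm
  have m2 : Measurable fun p : Sph N × Sph N => β p.2 * G ‖(p.1 : Vel N) - p.2‖ :=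
    (hβm.comp measurable_snd).mul hGm
  rw [lintegral_add_left (m1.const_mul _), lintegral_const_mul _ m1, lintegral_const_mul _ m2]
  have i1 : ∫⁻ p : Sph N × Sph N, β p.1 * G ‖(p.1 : Vel N) - p.2‖
      ∂((surfaceMeasure N).prod (surfaceMeasure N)) ≤ D * B := by
    rw [lintegral_prod _ m1.aemeasurable]
    calc _ ≤ ∫⁻ ω, β ω * D ∂surfaceMeasure N := by
          refine lintegral_mono fun ω => ?_
          dsimp only
          rw [lintegral_const_mul _ (by fun_prop)]
          gcongr
          simp only [norm_sub_rev (ω : Vel N)]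
          exact hD ω
      _ ≤ _ := by rw [lintegral_mul_const _ hβm, mul_comm]; gcongr
  have i2 : ∫⁻ p : Sph N × Sph N, β p.2 * G ‖(p.1 : Vel N) - p.2‖
      ∂((surfaceMeasure N).prod (surfaceMeasure N)) ≤ D * B := by
    rw [lintegral_prod_symm _ m2.aemeasurable]
    calc _ ≤ ∫⁻ ω, β ω * D ∂surfaceMeasure N := by
          refine lintegral_mono fun ω => ?_
          dsimp only
          rw [lintegral_const_mul _ (by fun_prop)]
          gcongr
          exact hD ω
      _ ≤ _ := by rw [lintegral_mul_const _ hβm, mul_comm]; gcongr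
  calc _ ≤ 2⁻¹ * (D * B) + 2⁻¹ * (D * B) := by gcongr
    _ = D * B := by rw [← add_mul, ENNReal.inv_two_add_inv_two, one_mul]

/-- After the swap the integral in `w` is the Fourier transform of a Gaussian at |ξ|(ω - ω')/2, that
is, a Gaussian in ω - ω', and Schur's test applies. Since |(ω·ω')^j| ≤ 1, the bound is uniform in
`j`. -/
theorem lintegral_gaussian_mul_sum_sq_angularKernel_le (hb : Measurable b) {B D : ℝ≥0∞} (hB : B ≠ ∞)
    (h : ∀ e : Sph N,
      ∫⁻ ω : Sph N, ENNReal.ofReal (b (inner ℝ (ω : Vel N) e) ^ 2) ∂surfaceMeasure N ≤ B)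
    (j : ℕ) (ξ : Vel N) {t : ℝ} (ht : 0 < t)
    (hD : ∀ τ : Sph N, ∫⁻ σ : Sph N, ENNReal.ofReal ((Real.pi / t) ^ ((N : ℝ) / 2) *
      Real.exp (-(Real.pi ^ 2 * (‖ξ‖ / 2) ^ 2 / t) * ‖(σ : Vel N) - τ‖ ^ 2)) ∂surfaceMeasure N ≤ D) :
    ∫⁻ w : Vel N, ENNReal.ofReal (Real.exp (-t * ‖w‖ ^ 2) *
      ∑ α : Fin j → Fin N, ‖angularKernel b α ξ w‖ ^ 2) ≤ D * B := by
  have hi := fun e : Sph N => integrable_angular hb hB e (h e)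
  set S : Vel N → ℝ := fun w => ∑ α : Fin j → Fin N, ‖angularKernel b α ξ w‖ ^ 2 with hS
  have hSC : ∀ w, ((S w : ℝ) : ℂ) = angularGram b j (direction ξ) ((‖ξ‖ / 2) • w) := fun w => by
    rw [hS, sum_sq_angularKernel hi, angularGram_direction_swap hb]
  set c : Sph N × Sph N → ℝ := fun p => b (inner ℝ (p.1 : Vel N) (direction ξ)) *
    b (inner ℝ (p.2 : Vel N) (direction ξ)) * inner ℝ (p.1 : Vel N) (p.2 : Vel N) ^ j with hc
  have hci : Integrable c ((surfaceMeasure N).prod (surfaceMeasure N)) :=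
    integrable_angularGram_aux (hi _) j
  have hgi : Integrable (fun w : Vel N => Real.exp (-t * ‖w‖ ^ 2)) volume := by
    by_contra hcon
    have h1 := GaussianFourier.integral_rexp_neg_mul_sq_norm (V := Vel N) ht
    rw [integral_undef hcon] at h1
    have : (0 : ℝ) < (Real.pi / t) ^ ((Module.finrank ℝ (Vel N) : ℝ) / 2) := by positivity
    linarith
  set f : Vel N × (Sph N × Sph N) → ℂ := fun q => ((Real.exp (-t * ‖q.1‖ ^ 2) : ℝ) : ℂ) *
    (((c q.2 : ℝ) : ℂ) *
    (Real.fourierChar (-inner ℝ ((‖ξ‖ / 2) • q.1) ((q.2.1 : Vel N) - q.2.2)) : ℂ)) with hf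
  have hfi : Integrable f (volume.prod ((surfaceMeasure N).prod (surfaceMeasure N))) := by
    have h1 := (hgi.ofReal (𝕜 := ℂ)).mul_prod (hci.ofReal (𝕜 := ℂ))
    have h2 := h1.mul_bdd (c := 1) (g := fun q : Vel N × (Sph N × Sph N) =>
      (Real.fourierChar (-inner ℝ ((‖ξ‖ / 2) • q.1) ((q.2.1 : Vel N) - q.2.2)) : ℂ))
      (measurable_fourierChar.comp (by fun_prop)).aestronglyMeasurable
      (Filter.Eventually.of_forall fun q => by rw [Circle.norm_coe])
    refine h2.congr (Filter.Eventually.of_forall fun q => ?_)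
    simp only [hf]
    exact mul_assoc _ _ _
  have e1 : ∀ w, ((Real.exp (-t * ‖w‖ ^ 2) * S w : ℝ) : ℂ) =
      ∫ p, f (w, p) ∂((surfaceMeasure N).prod (surfaceMeasure N)) := by
    intro w
    rw [Complex.ofReal_mul, hSC, angularGram, ← integral_const_mul]
  have hint : Integrable (fun w => Real.exp (-t * ‖w‖ ^ 2) * S w) volume := by
    have h1 := hfi.integral_prod_left
    simp only [← e1] at h1
    exact h1.re
  rw [← ofReal_integral_eq_lintegral_ofReal hint (Filter.Eventually.of_forall fun w => by positivity)]
  have e2 : ((∫ w, Real.exp (-t * ‖w‖ ^ 2) * S w : ℝ) : ℂ) =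
      ∫ p, ∫ w, f (w, p) ∂volume ∂((surfaceMeasure N).prod (surfaceMeasure N)) := by
    rw [← integral_integral_swap hfi, ← integral_complex_ofReal]
    simp only [e1]
  have e3 : ∀ p : Sph N × Sph N, ∫ w, f (w, p) = ((c p * ((Real.pi / t) ^ ((N : ℝ) / 2) *
      Real.exp (-(Real.pi ^ 2 * (‖ξ‖ / 2) ^ 2 / t) * ‖(p.1 : Vel N) - p.2‖ ^ 2)) : ℝ) : ℂ) := by
    intro p
    have h1 := fourier_gaussian_innerProductSpace (V := Vel N) (b := (t : ℂ)) (by simpa using ht)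
      ((‖ξ‖ / 2) • ((p.1 : Vel N) - p.2))
    rw [Real.fourier_eq, finrank_euclideanSpace_fin] at h1
    have h2 : ∀ w, f (w, p) = ((c p : ℝ) : ℂ) * (Real.fourierChar (-inner ℝ w
        ((‖ξ‖ / 2) • ((p.1 : Vel N) - p.2))) • Complex.exp (-(t : ℂ) * ‖w‖ ^ 2)) := by
      intro w
      simp only [hf, Circle.smul_def, smul_eq_mul, inner_smul_left, inner_smul_right]
      push_cast
      simp
      ring
    simp only [h2]
    rw [integral_const_mul, h1, norm_smul, Real.norm_of_nonneg (by positivity)]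
    push_cast
    rw [Complex.ofReal_cpow (by positivity)]
    push_cast
    congr 3
    ring
  calc ENNReal.ofReal (∫ w, Real.exp (-t * ‖w‖ ^ 2) * S w)
      ≤ ‖((∫ w, Real.exp (-t * ‖w‖ ^ 2) * S w : ℝ) : ℂ)‖ₑ := by
        rw [← ofReal_norm, Complex.norm_real]
        exact ENNReal.ofReal_le_ofReal (le_abs_self _)
    _ ≤ ∫⁻ p : Sph N × Sph N, ‖b (inner ℝ (p.1 : Vel N) (direction ξ))‖ₑ *
          ‖b (inner ℝ (p.2 : Vel N) (direction ξ))‖ₑ *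
          ENNReal.ofReal ((Real.pi / t) ^ ((N : ℝ) / 2) *
          Real.exp (-(Real.pi ^ 2 * (‖ξ‖ / 2) ^ 2 / t) * ‖(p.1 : Vel N) - p.2‖ ^ 2))
          ∂((surfaceMeasure N).prod (surfaceMeasure N)) := by
        rw [e2]
        refine (enorm_integral_le_lintegral_enorm _).trans (lintegral_mono fun p => ?_)
        rw [e3, ← ofReal_norm, Complex.norm_real, norm_mul, norm_mul, norm_mul,
          norm_pow, ENNReal.ofReal_mul (by positivity), Real.norm_of_nonneg (by positivity :
          0 ≤ (Real.pi / t) ^ ((N : ℝ) / 2) * Real.exp (-(Real.pi ^ 2 * (‖ξ‖ / 2) ^ 2 / t) *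
            ‖(p.1 : Vel N) - p.2‖ ^ 2))]
        gcongr
        rw [← ofReal_norm, ← ofReal_norm, ← ENNReal.ofReal_mul (norm_nonneg _)]
        refine ENNReal.ofReal_le_ofReal (mul_le_of_le_one_right (by positivity) ?_)
        exact pow_le_one₀ (norm_nonneg _) (abs_inner_le_one _ _)
    _ ≤ D * B := lintegral_schur_sphere hb (h _) (G := fun r =>
          ENNReal.ofReal ((Real.pi / t) ^ ((N : ℝ) / 2) *
          Real.exp (-(Real.pi ^ 2 * (‖ξ‖ / 2) ^ 2 / t) * r ^ 2))) (by fun_prop) hD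

theorem lintegral_exp_neg_mul {a : ℝ} (ha : 0 < a) :
    ∫⁻ t in Set.Ioi (0 : ℝ), ENNReal.ofReal (Real.exp (-a * t)) = ENNReal.ofReal a⁻¹ := by
  rw [← ofReal_integral_eq_lintegral_ofReal (integrableOn_exp_mul_Ioi (neg_lt_zero.2 ha) 0)
    (Filter.Eventually.of_forall fun _ => by positivity), integral_exp_mul_Ioi (neg_lt_zero.2 ha)]
  simp [neg_div_neg_eq]

/-- The averaging estimate for the angular kernel: the tensor components of the angular average of
plane waves decay like `|ξ|^{-(N-1)/2}`, in a weighted `L²` sense. -/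
theorem exists_lintegral_angularKernel_le (N : ℕ) [NeZero N] : ∃ C : ℝ≥0, ∀ b : ℝ → ℝ, Measurable b →
    ∀ B : ℝ≥0∞, B ≠ ∞ → (∀ e : Sph N,
      ∫⁻ ω : Sph N, ENNReal.ofReal (b (inner ℝ (ω : Vel N) e) ^ 2) ∂surfaceMeasure N ≤ B) →
    ∀ (j : ℕ) (ξ : Vel N), ξ ≠ 0 →
      ∫⁻ w : Vel N, ENNReal.ofReal ((bracket w ^ 2)⁻¹ *
        ∑ α : Fin j → Fin N, ‖angularKernel b α ξ w‖ ^ 2) ≤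
        C * ENNReal.ofReal (‖ξ‖ ^ (-((N : ℝ) - 1))) * B := by
  obtain ⟨C, hC⟩ := exists_lintegral_sphere_gaussian_le N
  -- `I` is Γ(1/2).
  set I : ℝ≥0∞ := ∫⁻ t in Set.Ioi (0 : ℝ), ENNReal.ofReal (Real.exp (-t) * t ^ (-(1 / 2) : ℝ)) with hI
  have hIf : I ≠ ∞ := by
    have h1 := Real.GammaIntegral_convergent (s := 1 / 2) (by norm_num)
    have h2 := h1.lintegral_lt_top.ne
    rw [hI]
    convert h2 using 6
    norm_num
  set A : ℝ := Real.pi ^ ((N : ℝ) / 2) * (Real.pi ^ 2 / 4) ^ (-((N : ℝ) - 1) / 2) with hA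
  refine ⟨C * A.toNNReal * I.toNNReal, fun b hb B hB h j ξ hξ => ?_⟩
  have hξ' : 0 < ‖ξ‖ := norm_pos_iff.2 hξ
  set S : Vel N → ℝ := fun w => ∑ α : Fin j → Fin N, ‖angularKernel b α ξ w‖ ^ 2 with hS
  have hSm : Measurable S := Finset.measurable_sum _ fun α _ =>
    ((stronglyMeasurable_angularKernel hb α ξ).measurable.norm).pow_const 2
  have hS0 : ∀ w, 0 ≤ S w := fun w => Finset.sum_nonneg fun _ _ => by positivity
  -- Superposition of Gaussians: ⟨w⟩^{-2} = ∫₀^∞ e^{-t} e^{-t|w|²} dt.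
  have e1 : ∀ w : Vel N, ENNReal.ofReal ((bracket w ^ 2)⁻¹ * S w) =
      ∫⁻ t in Set.Ioi (0 : ℝ), ENNReal.ofReal (Real.exp (-t)) *
        ENNReal.ofReal (Real.exp (-t * ‖w‖ ^ 2) * S w) := by
    intro w
    have h1 := lintegral_exp_neg_mul (a := bracket w ^ 2) (by have := bracket_pos w; positivity)
    rw [ENNReal.ofReal_mul (by have := bracket_pos w; positivity), ← h1,
      ← lintegral_mul_const _ (by fun_prop)]
    refine lintegral_congr fun t => ?_
    rw [← ENNReal.ofReal_mul (by positivity), ← ENNReal.ofReal_mul (by positivity), ← mul_assoc,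
      ← Real.exp_add, bracket_sq]
    congr 3; ring
  change ∫⁻ w, ENNReal.ofReal ((bracket w ^ 2)⁻¹ * S w) ≤ _
  simp only [e1]
  rw [lintegral_lintegral_swap]
  swap
  · refine Measurable.aemeasurable ?_
    have : Measurable fun p : Vel N × ℝ => S p.1 := hSm.comp measurable_fst
    simp only [Function.uncurry_def]
    fun_prop
  calc _ ≤ ∫⁻ t in Set.Ioi (0 : ℝ), ENNReal.ofReal (Real.exp (-t) * t ^ (-(1 / 2) : ℝ)) *
        (C * ENNReal.ofReal (A * ‖ξ‖ ^ (-((N : ℝ) - 1))) * B) := by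
        refine setLIntegral_mono' measurableSet_Ioi fun t ht => ?_
        have ht : 0 < t := ht
        rw [lintegral_const_mul _ (by fun_prop)]
        have h1 := lintegral_gaussian_mul_sum_sq_angularKernel_le hb hB h j ξ ht
          (D := ENNReal.ofReal ((Real.pi / t) ^ ((N : ℝ) / 2)) * (C * ENNReal.ofReal
            ((Real.pi ^ 2 * (‖ξ‖ / 2) ^ 2 / t) ^ (-((N : ℝ) - 1) / 2)))) ?_
        · rw [ENNReal.ofReal_mul (by positivity), mul_assoc (ENNReal.ofReal (Real.exp (-t)))]
          gcongr
          refine h1.trans (le_of_eq ?_)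
          -- The Gaussian mass t^{-N/2} against the sphere bound (|ξ|²/t)^{-(N-1)/2} leaves t^{-1/2}
          -- |ξ|^{-(N-1)}, which is integrable against e^{-t} down to t = 0.
          have e2 : ENNReal.ofReal ((Real.pi / t) ^ ((N : ℝ) / 2)) * ENNReal.ofReal
              ((Real.pi ^ 2 * (‖ξ‖ / 2) ^ 2 / t) ^ (-((N : ℝ) - 1) / 2)) =
              ENNReal.ofReal (t ^ (-(1 / 2) : ℝ)) *
                ENNReal.ofReal (A * ‖ξ‖ ^ (-((N : ℝ) - 1))) := by
            rw [← ENNReal.ofReal_mul (by positivity), ← ENNReal.ofReal_mul (by positivity)]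
            congr 1
            rw [hA, show Real.pi ^ 2 * (‖ξ‖ / 2) ^ 2 / t = Real.pi ^ 2 / 4 * ‖ξ‖ ^ 2 * t⁻¹ by
              field_simp; norm_num, Real.mul_rpow (by positivity) (by positivity),
              Real.mul_rpow (by positivity) (by positivity), Real.div_rpow (by positivity) ht.le,
              ← Real.rpow_natCast ‖ξ‖ 2, ← Real.rpow_mul hξ'.le, Real.inv_rpow ht.le,
              ← Real.rpow_neg ht.le, div_eq_mul_inv, ← Real.rpow_neg ht.le]
            have : t ^ (-(1 / 2) : ℝ) = t ^ (-((N : ℝ) / 2)) * t ^ (-(-((N : ℝ) - 1) / 2)) := by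
              rw [← Real.rpow_add ht]; congr 1; ring
            rw [this, show ((2 : ℕ) : ℝ) * (-((N : ℝ) - 1) / 2) = -((N : ℝ) - 1) by push_cast; ring]
            ring
          calc _ = C * (ENNReal.ofReal ((Real.pi / t) ^ ((N : ℝ) / 2)) * ENNReal.ofReal
              ((Real.pi ^ 2 * (‖ξ‖ / 2) ^ 2 / t) ^ (-((N : ℝ) - 1) / 2))) * B := by ring
            _ = _ := by rw [e2]; ring
        · intro τ
          have h2 := hC (Real.pi ^ 2 * (‖ξ‖ / 2) ^ 2 / t) (by positivity) τ
          refine le_trans (le_of_eq ?_) (mul_le_mul_right h2 _)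
          rw [← lintegral_const_mul _ (by fun_prop)]
          refine lintegral_congr fun σ => ?_
          rw [ENNReal.ofReal_mul (by positivity)]
    _ = I * (C * ENNReal.ofReal (A * ‖ξ‖ ^ (-((N : ℝ) - 1))) * B) := by
        rw [lintegral_mul_const _ (by fun_prop)]
    _ = _ := by
        rw [ENNReal.ofReal_mul (by positivity), ENNReal.coe_mul, ENNReal.coe_mul,
          ENNReal.coe_toNNReal hIf]
        rw [ENNReal.ofReal]; ring

end Kernel

/-! ### Absolute summability of binomial coefficients -/

section Binomial

theorem choose_succ_mul (a : ℝ) (j : ℕ) :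
    Ring.choose a (j + 1) * (j + 1) = Ring.choose a j * (a - j) := by
  have h1 := Ring.descPochhammer_eq_factorial_smul_choose a (j + 1)
  have h2 := Ring.descPochhammer_eq_factorial_smul_choose a j
  rw [descPochhammer_succ_right, Polynomial.smeval_mul, h2] at h1
  simp [Nat.factorial_succ, Polynomial.smeval_natCast] at h1
  have h3 : (j.factorial : ℝ) ≠ 0 := by positivity
  apply mul_left_cancel₀ h3
  linarith

/-- For `j ≥ a` the recurrence reads (j+1) d_{j+1} = (j-a) d_j, so a d_j = j d_j - (j+1) d_{j+1}
telescopes. For `a = 0` all terms with `j ≥ 1` vanish. Summability at the boundary of the disc of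
convergence is needed because the tilt can have norm arbitrarily close to 1. -/
theorem summable_abs_choose {a : ℝ} (ha : 0 ≤ a) : Summable fun j : ℕ => |Ring.choose a j| := by
  set d : ℕ → ℝ := fun j => |Ring.choose a j| with hd
  have hd0 : ∀ j, 0 ≤ d j := fun j => abs_nonneg _
  set J := ⌈a⌉₊ with hJ
  have hrec : ∀ j, J ≤ j → d (j + 1) * (j + 1) = d j * (j - a) := by
    intro j hj
    have hja : a ≤ j := (Nat.le_ceil a).trans (by exact_mod_cast hj)
    have := congrArg abs (choose_succ_mul a j)
    rw [abs_mul, abs_mul, abs_of_nonneg (by positivity : (0 : ℝ) ≤ j + 1), abs_sub_comm,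
      abs_of_nonneg (by linarith : 0 ≤ (j : ℝ) - a)] at this
    exact this
  rcases ha.eq_or_lt with rfl | ha
  · have hz : ∀ j, d (j + 1) = 0 := by
      intro j
      induction j with
      | zero => have := hrec 0 (by simp [hJ]); simpa using this
      | succ j ih =>
        have h1 := hrec (j + 1) (by simp [hJ])
        rw [ih, zero_mul] at h1
        exact (mul_eq_zero.1 h1).resolve_right (by positivity)
    exact (summable_nat_add_iff 1).1 (by simp [hz, summable_zero])
  · rw [← summable_nat_add_iff J]
    have htel : ∀ n, a * ∑ i ∈ Finset.range n, d (i + J) = J * d J - (n + J) * d (n + J) := by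
      intro n
      induction n with
      | zero => simp
      | succ n ih =>
        have h1 := hrec (n + J) (by omega)
        rw [Finset.sum_range_succ, mul_add, ih, show n + 1 + J = n + J + 1 by ring]
        push_cast at h1 ⊢
        linarith
    refine summable_of_sum_range_le (c := J * d J / a) (fun i => hd0 _) fun n => ?_
    rw [le_div_iff₀ ha, mul_comm, htel]
    have := hd0 (n + J)
    have : 0 ≤ ((n : ℝ) + J) * d (n + J) := by positivity
    linarith

theorem hasSum_one_add_rpow (a : ℝ) {t : ℝ} (ht : |t| < 1) :
    HasSum (fun j : ℕ => Ring.choose a j * t ^ j) ((1 + t) ^ a) := by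
  have h := (Real.one_add_rpow_hasFPowerSeriesOnBall_zero (a := a)).hasSum (y := t) (by
    rw [Metric.mem_eball, edist_zero_right, Real.enorm_eq_ofReal_abs]
    simpa using ht)
  simpa [binomialSeries, FormalMultilinearSeries.ofScalars_apply_eq, zero_add, mul_comm] using h

end Binomial

/-! ### Factorisation of the weight after the change of variables -/

section EnergyWeight

variable {N : ℕ}

/-- The square root of `1 + |x|² + |w|²/4`, the weight comparable to the total energy. -/
def energyWeight (x w : Vel N) : ℝ := Real.sqrt (1 + ‖x‖ ^ 2 + ‖w‖ ^ 2 / 4)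

theorem energyWeight_pos (x w : Vel N) : 0 < energyWeight x w := Real.sqrt_pos.2 (by positivity)

theorem energyWeight_sq (x w : Vel N) : energyWeight x w ^ 2 = 1 + ‖x‖ ^ 2 + ‖w‖ ^ 2 / 4 :=
  Real.sq_sqrt (by positivity)

theorem continuous_energyWeight : Continuous fun p : Vel N × Vel N => energyWeight p.1 p.2 := by
  unfold energyWeight; fun_prop

theorem measurable_energyWeight_rpow (η : ℝ) :
    Measurable fun p : Vel N × Vel N => energyWeight p.1 p.2 ^ η :=
  continuous_energyWeight.measurable.pow_const η

/-- The vector `y` with `⟨x + |w|ω/2⟩² = λ² (1 + y·ω)`, where `λ` is the energy weight. -/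
def tilt (x w : Vel N) : Vel N := (‖w‖ / energyWeight x w ^ 2) • x

theorem measurable_tilt : Measurable fun p : Vel N × Vel N => tilt p.1 p.2 := by
  have := (continuous_energyWeight (N := N)).measurable
  exact Measurable.smul (Measurable.div (by fun_prop) (this.pow_const 2)) measurable_fst

/-- The inequality |x||w| ≤ |x|² + |w|²/4, whose right-hand side is λ² - 1. -/
theorem norm_tilt_lt_one (x w : Vel N) : ‖tilt x w‖ < 1 := by
  rw [tilt, norm_smul, norm_div, norm_norm, Real.norm_of_nonneg (by positivity), div_mul_eq_mul_div,
    div_lt_one (by have := energyWeight_pos x w; positivity), energyWeight_sq]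
  nlinarith [sq_nonneg (‖x‖ - ‖w‖ / 2)]

theorem bracket_preCollision_sq (x w : Vel N) (ω : Sph N) :
    bracket (x + (1 / 2 : ℝ) • (‖w‖ • (ω : Vel N))) ^ 2 =
      energyWeight x w ^ 2 * (1 + inner ℝ (tilt x w) (ω : Vel N)) := by
  have hl := energyWeight_pos x w
  rw [bracket_sq, tilt, inner_smul_left, mul_add, ← mul_assoc]
  simp only [conj_trivial]
  rw [mul_div_cancel₀ _ (by positivity), energyWeight_sq, norm_add_sq_real, norm_smul, norm_smul,
    norm_eq_of_mem_sphere, norm_norm, inner_smul_right, inner_smul_right]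
  norm_num
  ring

/-- The weight at the velocity `v` becomes a function of (x, w) times a power series in `ω`, so that
`ω` can be integrated separately, term by term. -/
theorem bracket_preCollision_rpow (η : ℝ) (x w : Vel N) (ω : Sph N) :
    bracket (x + (1 / 2 : ℝ) • (‖w‖ • (ω : Vel N))) ^ η =
      energyWeight x w ^ η * (1 + inner ℝ (tilt x w) (ω : Vel N)) ^ (η / 2) := by
  have hl := energyWeight_pos x w
  have hb := bracket_pos (x + (1 / 2 : ℝ) • (‖w‖ • (ω : Vel N)))
  have h1 : ∀ r : ℝ, 0 < r → r ^ η = (r ^ 2) ^ (η / 2) := fun r hr => by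
    rw [← Real.rpow_natCast, ← Real.rpow_mul hr.le]; congr 1; push_cast; ring
  have h2 : 0 ≤ 1 + inner ℝ (tilt x w) (ω : Vel N) := by
    have h3 := abs_real_inner_le_norm (tilt x w) (ω : Vel N)
    rw [norm_eq_of_mem_sphere, mul_one] at h3
    linarith [neg_abs_le (inner ℝ (tilt x w) (ω : Vel N)), norm_tilt_lt_one x w]
  rw [h1 _ hb, bracket_preCollision_sq, Real.mul_rpow (by positivity) h2, ← h1 _ hl]

theorem abs_inner_tilt_lt_one (x w : Vel N) (ω : Sph N) :
    |inner ℝ (tilt x w) (ω : Vel N)| < 1 := by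
  have h3 := abs_real_inner_le_norm (tilt x w) (ω : Vel N)
  rw [norm_eq_of_mem_sphere, mul_one] at h3
  exact h3.trans_lt (norm_tilt_lt_one x w)

theorem bracket_preCollision_rpow_le {η : ℝ} (hη : 0 ≤ η) (x w : Vel N) (ω : Sph N) :
    bracket (x + (1 / 2 : ℝ) • (‖w‖ • (ω : Vel N))) ^ η ≤ 2 ^ (η / 2) * energyWeight x w ^ η := by
  rw [bracket_preCollision_rpow, mul_comm]
  have h1 := abs_lt.1 (abs_inner_tilt_lt_one x w ω)
  have := energyWeight_pos x w
  gcongr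
  · linarith
  · linarith

end EnergyWeight

/-! ### Cauchy–Schwarz inequalities -/

section CauchySchwarz

theorem lintegral_mul_sq_le {α : Type*} [MeasurableSpace α] {μ : Measure α} {f g : α → ℝ≥0∞}
    (hf : AEMeasurable f μ) (hg : AEMeasurable g μ) :
    (∫⁻ a, f a * g a ∂μ) ^ 2 ≤ (∫⁻ a, f a ^ 2 ∂μ) * ∫⁻ a, g a ^ 2 ∂μ := by
  have h := ENNReal.lintegral_mul_le_Lp_mul_Lq μ (p := 2) (q := 2)
    ⟨by norm_num, by norm_num, by norm_num⟩ hf hg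
  have h2 := pow_le_pow_left' h 2
  refine h2.trans (le_of_eq ?_)
  rw [mul_pow, ← ENNReal.rpow_natCast, ← ENNReal.rpow_natCast, ← ENNReal.rpow_mul,
    ← ENNReal.rpow_mul]
  norm_num

theorem sum_mul_sq_le {ι : Type*} [Fintype ι] (f g : ι → ℝ≥0∞) :
    (∑ i, f i * g i) ^ 2 ≤ (∑ i, f i ^ 2) * ∑ i, g i ^ 2 := by
  let _ : MeasurableSpace ι := ⊤
  have := lintegral_mul_sq_le (μ := Measure.count) (f := f) (g := g)
    (measurable_of_finite f).aemeasurable (measurable_of_finite g).aemeasurable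
  simpa [lintegral_count, tsum_fintype] using this

theorem tsum_mul_sq_le (a f : ℕ → ℝ≥0∞) :
    (∑' i, a i * f i) ^ 2 ≤ (∑' i, a i) * ∑' i, a i * f i ^ 2 := by
  have h := lintegral_mul_sq_le (μ := (Measure.count : Measure ℕ)) (f := fun i => a i ^ (1 / 2 : ℝ))
    (g := fun i => a i ^ (1 / 2 : ℝ) * f i) (measurable_of_countable _).aemeasurable
    (measurable_of_countable _).aemeasurable
  have e : ∀ x : ℝ≥0∞, (x ^ (1 / 2 : ℝ)) ^ 2 = x := fun x => by
    rw [← ENNReal.rpow_natCast, ← ENNReal.rpow_mul]; norm_num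
  simpa only [lintegral_count, mul_pow, e, ← mul_assoc, ← sq] using h

end CauchySchwarz

/-! ### The gain operator as an operator on tensors -/

section CollisionOp

variable {N : ℕ}

/-- The integrand of `collisionOp`. -/
def collisionIntegrand (b : ℝ → ℝ) (H : Vel N → Vel N → ℂ) (v : Vel N) (p : Vel N × Sph N) : ℂ :=
  (b (cosDev v p.1 p.2) : ℂ) * H ((1 / 2 : ℝ) • (v + p.1)) (‖v - p.1‖ • (p.2 : Vel N))

/-- The gain operator for a function `H` of the centre of mass and of the pre-collisional relative
velocity. -/
def collisionOp (b : ℝ → ℝ) (H : Vel N → Vel N → ℂ) (v : Vel N) : ℂ :=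
  ∫ p, collisionIntegrand b H v p ∂((volume : Measure (Vel N)).prod (surfaceMeasure N))

theorem measurable_collisionIntegrand {b : ℝ → ℝ} (hb : Measurable b) {H : Vel N → Vel N → ℂ}
    (hH : Measurable fun p : Vel N × Vel N => H p.1 p.2) :
    Measurable fun q : Vel N × (Vel N × Sph N) => collisionIntegrand b H q.1 q.2 := by
  unfold collisionIntegrand cosDev
  refine Measurable.mul (Complex.measurable_ofReal.comp (hb.comp ?_))
    (hH.comp (f := fun q : Vel N × (Vel N × Sph N) =>
      ((1 / 2 : ℝ) • (q.1 + q.2.1), ‖q.1 - q.2.1‖ • (q.2.2 : Vel N))) ?_)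
  · have h1 : Measurable fun q : Vel N × (Vel N × Sph N) => ‖q.1 - q.2.1‖⁻¹ • (q.1 - q.2.1) :=
      Measurable.smul (f := fun q : Vel N × (Vel N × Sph N) => ‖q.1 - q.2.1‖⁻¹)
        (Measurable.inv (by fun_prop)) (by fun_prop)
    exact Measurable.inner h1 (by fun_prop)
  · exact (Continuous.measurable (by fun_prop))

variable [NeZero N]

theorem nontrivial_vel : Nontrivial (Vel N) :=
  haveI : Nonempty (Fin N) := ⟨0⟩
  inferInstance

theorem ae_ne_zero : ∀ᵐ w : Vel N, w ≠ 0 := by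
  have := nontrivial_vel (N := N)
  simp [ae_iff]

instance : SFinite (surfaceMeasure N) := by unfold surfaceMeasure; infer_instance

instance : IsFiniteMeasure (surfaceMeasure N) := by unfold surfaceMeasure; infer_instance

/-- In the new variables the deviation angle is that between `ω` and `w`, and `H` is evaluated at
(x, w) itself. For `w = 0` the direction used in the change of variables is arbitrary, hence the
exclusion. -/
theorem collisionIntegrand_collisionMap (b : ℝ → ℝ) (H : Vel N → Vel N → ℂ) (x : Vel N) {w : Vel N}
    (hw : w ≠ 0) (ω : Sph N) :
    collisionIntegrand b H (collisionMap (x, (w, ω))).1 (collisionMap (x, (w, ω))).2 =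
      (b (inner ℝ (ω : Vel N) (direction w)) : ℂ) * H x w := by
  have h1 : (x + (1 / 2 : ℝ) • (‖w‖ • (ω : Vel N))) - (x - (1 / 2 : ℝ) • (‖w‖ • (ω : Vel N))) =
      ‖w‖ • (ω : Vel N) := by module
  have h2 : (1 / 2 : ℝ) • ((x + (1 / 2 : ℝ) • (‖w‖ • (ω : Vel N))) +
      (x - (1 / 2 : ℝ) • (‖w‖ • (ω : Vel N)))) = x := by module
  have h3 : ‖‖w‖ • (ω : Vel N)‖ = ‖w‖ := by
    rw [norm_smul, norm_eq_of_mem_sphere, norm_norm, mul_one]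
  simp only [collisionIntegrand, collisionMap, cosDev, h1, h2, h3, norm_smul_direction]
  rw [smul_smul, inv_mul_cancel₀ (norm_ne_zero_iff.2 hw), one_smul]

theorem ae_collisionIntegrand_collisionMap (b : ℝ → ℝ) (H : Vel N → Vel N → ℂ) :
    ∀ᵐ q ∂((volume : Measure (Vel N)).prod ((volume : Measure (Vel N)).prod (surfaceMeasure N))),
      collisionIntegrand b H (collisionMap q).1 (collisionMap q).2 =
        (b (inner ℝ (q.2.2 : Vel N) (direction q.2.1)) : ℂ) * H q.1 q.2.1 := by
  have h : ∀ᵐ q ∂((volume : Measure (Vel N)).prod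
      ((volume : Measure (Vel N)).prod (surfaceMeasure N))), q.2.1 ≠ 0 :=
    (Measure.quasiMeasurePreserving_fst.comp Measure.quasiMeasurePreserving_snd).ae ae_ne_zero
  filter_upwards [h] with q hq
  exact collisionIntegrand_collisionMap b H q.1 hq q.2.2

theorem lintegral_angular_le {b : ℝ → ℝ} (hb : Measurable b) {B : ℝ≥0∞} {e : Sph N}
    (h : ∫⁻ ω : Sph N, ENNReal.ofReal (b (inner ℝ (ω : Vel N) e) ^ 2) ∂surfaceMeasure N ≤ B) :
    ∫⁻ ω : Sph N, ‖b (inner ℝ (ω : Vel N) e)‖ₑ ∂surfaceMeasure N ≤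
      (B * surfaceMeasure N Set.univ) ^ (1 / 2 : ℝ) := by
  have hm : Measurable fun ω : Sph N => b (inner ℝ (ω : Vel N) e) := hb.comp (by fun_prop)
  have h1 := lintegral_mul_sq_le (μ := surfaceMeasure N)
    (f := fun ω : Sph N => ‖b (inner ℝ (ω : Vel N) e)‖ₑ) (g := fun _ => 1)
    hm.enorm.aemeasurable aemeasurable_const
  simp only [mul_one, one_pow, lintegral_const, one_mul] at h1
  have h2 : ∀ x : ℝ, ‖x‖ₑ ^ 2 = ENNReal.ofReal (x ^ 2) := fun x => by
    rw [Real.enorm_eq_ofReal_abs, ← ENNReal.ofReal_pow (abs_nonneg _), sq_abs]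
  simp only [h2] at h1
  rw [one_div, ENNReal.le_rpow_inv_iff (by norm_num)]
  refine le_trans ?_ (h1.trans (by gcongr))
  norm_num

/-- The weighted integrand of `collisionOp`, after the change of variables. -/
def swappedIntegrand (η : ℝ) (b : ℝ → ℝ) (H : Vel N → Vel N → ℂ) (q : Vel N × (Vel N × Sph N)) : ℂ :=
  ((bracket (q.1 + (1 / 2 : ℝ) • (‖q.2.1‖ • (q.2.2 : Vel N))) ^ η : ℝ) : ℂ) *
    ((b (inner ℝ (q.2.2 : Vel N) (direction q.2.1)) : ℂ) * H q.1 q.2.1)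

theorem measurable_b_direction {b : ℝ → ℝ} (hb : Measurable b) :
    Measurable fun p : Vel N × Sph N => b (inner ℝ (p.2 : Vel N) (direction p.1)) := by
  refine hb.comp ?_
  have : Measurable fun p : Vel N × Sph N => (direction p.1 : Vel N) :=
    measurable_direction.subtype_val.comp measurable_fst
  exact Measurable.inner (by fun_prop) this

theorem measurable_energyWeight_mul {η : ℝ} {H : Vel N → Vel N → ℂ}
    (hH : Measurable fun p : Vel N × Vel N => H p.1 p.2) :
    Measurable fun p : Vel N × Vel N => ((energyWeight p.1 p.2 ^ η : ℝ) : ℂ) * H p.1 p.2 :=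
  (Complex.measurable_ofReal.comp (measurable_energyWeight_rpow η)).mul hH

theorem measurable_fst_snd_fst :
    Measurable fun q : Vel N × (Vel N × Sph N) => ((q.1, q.2.1) : Vel N × Vel N) := by
  fun_prop

theorem lintegral_mul_kernel_le {α β δ : Type*} [MeasurableSpace α] [MeasurableSpace β]
    [MeasurableSpace δ] {μ : Measure α} {ν : Measure β} {τ : Measure δ} [SFinite ν] [SFinite τ]
    {G : α × β → ℝ≥0∞} (hG : Measurable G) {k : β × δ → ℝ≥0∞} (hk : Measurable k) {D : ℝ≥0∞}
    (hD : ∀ w, ∫⁻ ω, k (w, ω) ∂τ ≤ D) :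
    ∫⁻ q, G (q.1, q.2.1) * k q.2 ∂(μ.prod (ν.prod τ)) ≤ D * ∫⁻ p, G p ∂(μ.prod ν) := by
  have hm : Measurable fun q : α × (β × δ) => G (q.1, q.2.1) * k q.2 := by fun_prop
  rw [lintegral_prod _ hm.aemeasurable, lintegral_prod _ hG.aemeasurable,
    ← lintegral_const_mul _ hG.lintegral_prod_right']
  refine lintegral_mono fun x => ?_
  have hmx : Measurable fun p : β × δ => G (x, p.1) * k p := hm.comp measurable_prodMk_left
  have hGx : Measurable fun w => G (x, w) := hG.comp measurable_prodMk_left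
  simp only
  rw [lintegral_prod _ hmx.aemeasurable, ← lintegral_const_mul _ hGx]
  refine lintegral_mono fun w => ?_
  have hkw : Measurable fun ω => k (w, ω) := hk.comp measurable_prodMk_left
  simp only
  rw [lintegral_const_mul _ hkw, mul_comm]
  gcongr
  exact hD w

theorem lintegral_weight_angular_le {η : ℝ} {b : ℝ → ℝ} (hb : Measurable b) {B : ℝ≥0∞}
    (hB : ∀ e : Sph N,
      ∫⁻ ω : Sph N, ENNReal.ofReal (b (inner ℝ (ω : Vel N) e) ^ 2) ∂surfaceMeasure N ≤ B)
    {H : Vel N → Vel N → ℂ} (hH : Measurable fun p : Vel N × Vel N => H p.1 p.2) :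
    ∫⁻ q, ‖((energyWeight q.1 q.2.1 ^ η : ℝ) : ℂ) * H q.1 q.2.1‖ₑ *
      ‖b (inner ℝ (q.2.2 : Vel N) (direction q.2.1))‖ₑ
      ∂((volume : Measure (Vel N)).prod ((volume : Measure (Vel N)).prod (surfaceMeasure N))) ≤
    (B * surfaceMeasure N Set.univ) ^ (1 / 2 : ℝ) *
      ∫⁻ p, ‖((energyWeight p.1 p.2 ^ η : ℝ) : ℂ) * H p.1 p.2‖ₑ
        ∂((volume : Measure (Vel N)).prod volume) := by
  have h1 := (measurable_energyWeight_mul (η := η) hH).enorm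
  have h2 := (measurable_b_direction (N := N) hb).enorm
  have h3 : ∀ w : Vel N, ∫⁻ ω : Sph N, ‖b (inner ℝ (ω : Vel N) (direction w))‖ₑ ∂surfaceMeasure N ≤
    (B * surfaceMeasure N Set.univ) ^ (1 / 2 : ℝ) :=
      fun w => lintegral_angular_le hb (hB (direction w))
  exact lintegral_mul_kernel_le (μ := (volume : Measure (Vel N))) (ν := (volume : Measure (Vel N)))
    (τ := surfaceMeasure N) (k := fun p => ‖b (inner ℝ (p.2 : Vel N) (direction p.1))‖ₑ) h1 h2 h3

theorem integrable_swappedIntegrand_aux {η : ℝ} {b : ℝ → ℝ} (hb : Measurable b) {B : ℝ≥0∞}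
    (hBt : B ≠ ∞) (hB : ∀ e : Sph N,
      ∫⁻ ω : Sph N, ENNReal.ofReal (b (inner ℝ (ω : Vel N) e) ^ 2) ∂surfaceMeasure N ≤ B)
    {H : Vel N → Vel N → ℂ} (hH : Measurable fun p : Vel N × Vel N => H p.1 p.2)
    (hI : Integrable (fun p : Vel N × Vel N => ((energyWeight p.1 p.2 ^ η : ℝ) : ℂ) * H p.1 p.2)
      (volume.prod volume)) :
    Integrable (fun q : Vel N × (Vel N × Sph N) =>
      (((energyWeight q.1 q.2.1 ^ η : ℝ) : ℂ) * H q.1 q.2.1) *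
        (b (inner ℝ (q.2.2 : Vel N) (direction q.2.1)) : ℂ))
      (volume.prod (volume.prod (surfaceMeasure N))) := by
  refine ⟨(Measurable.mul ((measurable_energyWeight_mul hH).comp measurable_fst_snd_fst)
    (Complex.measurable_ofReal.comp
      ((measurable_b_direction hb).comp measurable_snd))).aestronglyMeasurable, ?_⟩
  rw [hasFiniteIntegral_iff_enorm]
  simp only [enorm_mul _ ((b _ : ℝ) : ℂ)]
  have e : ∀ x : ℝ, ‖(x : ℂ)‖ₑ = ‖x‖ₑ := fun x => by simp [enorm_eq_nnnorm]
  simp only [e (b _)]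
  refine (lintegral_weight_angular_le hb hB hH).trans_lt (ENNReal.mul_lt_top ?_ ?_)
  · exact ENNReal.rpow_lt_top_of_nonneg (by norm_num)
      (ENNReal.mul_ne_top hBt (measure_ne_top _ _))
  · exact hasFiniteIntegral_iff_enorm.1 hI.2

theorem enorm_swappedIntegrand_le {η : ℝ} (hη : 0 ≤ η) (b : ℝ → ℝ) (H : Vel N → Vel N → ℂ)
    (q : Vel N × (Vel N × Sph N)) :
    ‖swappedIntegrand η b H q‖ₑ ≤ ENNReal.ofReal (2 ^ (η / 2)) *
      (‖((energyWeight q.1 q.2.1 ^ η : ℝ) : ℂ) * H q.1 q.2.1‖ₑ *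
        ‖b (inner ℝ (q.2.2 : Vel N) (direction q.2.1))‖ₑ) := by
  have e : ∀ x : ℝ, ‖(x : ℂ)‖ₑ = ‖x‖ₑ := fun x => by simp [enorm_eq_nnnorm]
  have h1 := bracket_preCollision_rpow_le hη q.1 q.2.1 q.2.2
  have hl := energyWeight_pos q.1 q.2.1
  have hb := bracket_pos (q.1 + (1 / 2 : ℝ) • (‖q.2.1‖ • (q.2.2 : Vel N)))
  rw [swappedIntegrand, enorm_mul, enorm_mul, enorm_mul, e, e, e,
    Real.enorm_of_nonneg (Real.rpow_nonneg hb.le η), Real.enorm_of_nonneg (Real.rpow_nonneg hl.le η)]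
  calc _ ≤ ENNReal.ofReal (2 ^ (η / 2) * energyWeight q.1 q.2.1 ^ η) * _ := by gcongr
    _ = _ := by rw [ENNReal.ofReal_mul (by positivity)]; ring

/-- The weighted integrand of `collisionOp`, as a function of all variables. -/
def weightedIntegrand (η : ℝ) (b : ℝ → ℝ) (H : Vel N → Vel N → ℂ) (q : Vel N × (Vel N × Sph N)) : ℂ :=
  ((bracket q.1 ^ η : ℝ) : ℂ) * collisionIntegrand b H q.1 q.2

theorem measurable_weightedIntegrand {η : ℝ} {b : ℝ → ℝ} (hb : Measurable b)
    {H : Vel N → Vel N → ℂ} (hH : Measurable fun p : Vel N × Vel N => H p.1 p.2) :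
    Measurable (weightedIntegrand η b H) := by
  have h1 := (continuous_bracket_rpow (N := N) η).measurable
  have h2 := measurable_collisionIntegrand hb hH
  exact (Complex.measurable_ofReal.comp (h1.comp measurable_fst)).mul h2

theorem ae_weightedIntegrand_collisionMap (η : ℝ) (b : ℝ → ℝ) (H : Vel N → Vel N → ℂ) :
    (fun q => weightedIntegrand η b H (collisionMap q))
      =ᵐ[(volume : Measure (Vel N)).prod ((volume : Measure (Vel N)).prod (surfaceMeasure N))]
      swappedIntegrand η b H := by
  filter_upwards [ae_collisionIntegrand_collisionMap b H] with q hq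
  rw [weightedIntegrand, hq, swappedIntegrand]
  rfl

theorem lintegral_weightedIntegrand_le {η : ℝ} (hη : 0 ≤ η) {b : ℝ → ℝ} (hb : Measurable b)
    {B : ℝ≥0∞} (hB : ∀ e : Sph N,
      ∫⁻ ω : Sph N, ENNReal.ofReal (b (inner ℝ (ω : Vel N) e) ^ 2) ∂surfaceMeasure N ≤ B)
    {H : Vel N → Vel N → ℂ} (hH : Measurable fun p : Vel N × Vel N => H p.1 p.2) :
    ∫⁻ q, ‖weightedIntegrand η b H q‖ₑ ∂((volume : Measure (Vel N)).prod
      ((volume : Measure (Vel N)).prod (surfaceMeasure N))) ≤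
    ENNReal.ofReal (2 ^ (η / 2)) * ((B * surfaceMeasure N Set.univ) ^ (1 / 2 : ℝ) *
      ∫⁻ p, ‖((energyWeight p.1 p.2 ^ η : ℝ) : ℂ) * H p.1 p.2‖ₑ
        ∂((volume : Measure (Vel N)).prod volume)) := by
  rw [← (measurePreserving_collisionMap (N := N)).lintegral_comp
    (measurable_weightedIntegrand hb hH).enorm,
    lintegral_congr_ae (f := fun q => ‖weightedIntegrand η b H (collisionMap q)‖ₑ)
      (g := fun q => ‖swappedIntegrand η b H q‖ₑ)
      ((ae_weightedIntegrand_collisionMap η b H).fun_comp enorm)]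
  refine (lintegral_mono fun q => enorm_swappedIntegrand_le hη b H q).trans ?_
  rw [lintegral_const_mul' _ _ ENNReal.ofReal_ne_top]
  gcongr
  exact lintegral_weight_angular_le hb hB hH

variable {η : ℝ} {b : ℝ → ℝ} {B : ℝ≥0∞} {H : Vel N → Vel N → ℂ}

theorem integrable_weightedIntegrand (hη : 0 ≤ η) (hb : Measurable b)
    (hBt : B ≠ ∞) (hB : ∀ e : Sph N,
      ∫⁻ ω : Sph N, ENNReal.ofReal (b (inner ℝ (ω : Vel N) e) ^ 2) ∂surfaceMeasure N ≤ B)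
    (hH : Measurable fun p : Vel N × Vel N => H p.1 p.2)
    (hI : Integrable (fun p : Vel N × Vel N => ((energyWeight p.1 p.2 ^ η : ℝ) : ℂ) * H p.1 p.2)
      (volume.prod volume)) :
    Integrable (weightedIntegrand η b H)
      ((volume : Measure (Vel N)).prod ((volume : Measure (Vel N)).prod (surfaceMeasure N))) := by
  refine ⟨(measurable_weightedIntegrand hb hH).aestronglyMeasurable, ?_⟩
  rw [hasFiniteIntegral_iff_enorm]
  refine (lintegral_weightedIntegrand_le hη hb hB hH).trans_lt (ENNReal.mul_lt_top
    ENNReal.ofReal_lt_top (ENNReal.mul_lt_top ?_ (hasFiniteIntegral_iff_enorm.1 hI.2)))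
  exact ENNReal.rpow_lt_top_of_nonneg (by norm_num)
    (ENNReal.mul_ne_top hBt (measure_ne_top _ _))

theorem ae_integrable_collisionIntegrand
    (h : Integrable (weightedIntegrand η b H)
      ((volume : Measure (Vel N)).prod ((volume : Measure (Vel N)).prod (surfaceMeasure N)))) :
    ∀ᵐ v : Vel N, Integrable (collisionIntegrand b H v) (volume.prod (surfaceMeasure N)) := by
  filter_upwards [h.prod_right_ae] with v hv
  have h0 : ((bracket v ^ η : ℝ) : ℂ) ≠ 0 :=
    Complex.ofReal_ne_zero.2 (Real.rpow_pos_of_pos (bracket_pos v) η).ne'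
  convert hv.const_mul (((bracket v ^ η : ℝ) : ℂ)⁻¹) using 1
  ext p
  rw [weightedIntegrand, inv_mul_cancel_left₀ h0]

theorem weighted_collisionOp (v : Vel N) : weighted η (collisionOp b H) v =
    ∫ p, weightedIntegrand η b H (v, p) ∂((volume : Measure (Vel N)).prod (surfaceMeasure N)) := by
  simp only [weighted, collisionOp, weightedIntegrand, integral_const_mul]

theorem integrable_weighted_collisionOp
    (h : Integrable (weightedIntegrand η b H)
      ((volume : Measure (Vel N)).prod ((volume : Measure (Vel N)).prod (surfaceMeasure N)))) :
    Integrable (weighted η (collisionOp b H)) volume := by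
  convert h.integral_prod_left using 1
  ext v
  exact weighted_collisionOp v

theorem lintegral_weighted_collisionOp_le (hη : 0 ≤ η) (hb : Measurable b)
    (hB : ∀ e : Sph N,
      ∫⁻ ω : Sph N, ENNReal.ofReal (b (inner ℝ (ω : Vel N) e) ^ 2) ∂surfaceMeasure N ≤ B)
    (hH : Measurable fun p : Vel N × Vel N => H p.1 p.2) :
    ∫⁻ v, ‖weighted η (collisionOp b H) v‖ₑ ≤
    ENNReal.ofReal (2 ^ (η / 2)) * ((B * surfaceMeasure N Set.univ) ^ (1 / 2 : ℝ) *
      ∫⁻ p, ‖((energyWeight p.1 p.2 ^ η : ℝ) : ℂ) * H p.1 p.2‖ₑ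
        ∂((volume : Measure (Vel N)).prod volume)) := by
  refine le_trans ?_ (lintegral_weightedIntegrand_le hη hb hB hH)
  rw [lintegral_prod _ (measurable_weightedIntegrand hb hH).enorm.aemeasurable]
  refine lintegral_mono fun v => ?_
  rw [weighted_collisionOp]
  exact enorm_integral_le_lintegral_enorm _

/-- Fubini followed by the collisional change of variables. The phase at v = x + |w|ω/2 is the
product of a phase in `x` and a phase in `ω`, which is what lets the two integrations decouple
afterwards. -/
theorem fourier_weighted_collisionOp
    (h : Integrable (weightedIntegrand η b H)
      ((volume : Measure (Vel N)).prod ((volume : Measure (Vel N)).prod (surfaceMeasure N))))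
    (ξ : Vel N) :
    𝓕 (weighted η (collisionOp b H)) ξ = ∫ q : Vel N × (Vel N × Sph N),
      (Real.fourierChar (-(inner ℝ (q.1 + (1 / 2 : ℝ) • (‖q.2.1‖ • (q.2.2 : Vel N))) ξ)) : ℂ) *
        swappedIntegrand η b H q ∂(volume.prod (volume.prod (surfaceMeasure N))) := by
  set μ := (volume : Measure (Vel N)).prod ((volume : Measure (Vel N)).prod (surfaceMeasure N))
  have hem : Measurable fun q : Vel N × (Vel N × Sph N) =>
      (Real.fourierChar (-(inner ℝ q.1 ξ)) : ℂ) :=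
    measurable_fourierChar.comp (Continuous.measurable (by fun_prop))
  have hint : Integrable (fun q : Vel N × (Vel N × Sph N) =>
      (Real.fourierChar (-(inner ℝ q.1 ξ)) : ℂ) * weightedIntegrand η b H q) μ :=
    h.bdd_mul hem.aestronglyMeasurable 
      (Filter.Eventually.of_forall fun q => (Circle.norm_coe _).le)
  calc 𝓕 (weighted η (collisionOp b H)) ξ
      = ∫ v, ∫ p, (Real.fourierChar (-(inner ℝ v ξ)) : ℂ) * weightedIntegrand η b H (v, p)
          ∂((volume : Measure (Vel N)).prod (surfaceMeasure N)) := by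
        rw [Real.fourier_eq]
        refine integral_congr_ae (Filter.Eventually.of_forall fun v => ?_)
        beta_reduce
        rw [weighted_collisionOp, Circle.smul_def, smul_eq_mul, ← integral_const_mul]
    _ = ∫ q, (Real.fourierChar (-(inner ℝ q.1 ξ)) : ℂ) * weightedIntegrand η b H q ∂μ :=
        (integral_prod _ hint).symm
    _ = ∫ q, (Real.fourierChar (-(inner ℝ (collisionMap q).1 ξ)) : ℂ) *
          weightedIntegrand η b H (collisionMap q) ∂μ := by
        have hm : Measure.map (collisionMap (N := N)) μ = μ := measurePreserving_collisionMap.map_eq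
        conv_lhs => rw [← hm]
        exact integral_map measurePreserving_collisionMap.measurable.aemeasurable
          (by rw [hm]; exact hint.aestronglyMeasurable)
    _ = _ := by
        refine integral_congr_ae ?_
        filter_upwards [ae_weightedIntegrand_collisionMap η b H] with q hq
        rw [hq]
        rfl

end CollisionOp

/-! ### Product kernels and a weighted Cauchy–Schwarz inequality -/

section Fubini

variable {α β δ : Type*} [MeasurableSpace α] [MeasurableSpace β] [MeasurableSpace δ]
  {μ : Measure α} {ν : Measure β} {τ : Measure δ} [SFinite μ] [SFinite ν] [SFinite τ]

theorem integral_mul_kernel {A : α × β → ℂ} {k : β × δ → ℂ}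
    (h : Integrable (fun q : α × (β × δ) => A (q.1, q.2.1) * k q.2) (μ.prod (ν.prod τ))) :
    ∫ q, A (q.1, q.2.1) * k q.2 ∂(μ.prod (ν.prod τ)) =
      ∫ w, (∫ x, A (x, w) ∂μ) * ∫ ω, k (w, ω) ∂τ ∂ν := by
  have h1 : Integrable (fun p : β × δ => (∫ x, A (x, p.1) ∂μ) * k p) (ν.prod τ) := by
    have := h.integral_prod_right
    simpa only [integral_mul_const] using this
  rw [integral_prod_symm _ h]
  simp only [integral_mul_const]
  rw [integral_prod _ h1]
  simp only [integral_const_mul]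

/-- Cauchy–Schwarz simultaneously in the index and in the variable. The weight will be c = ⟨w⟩²: its
inverse makes the angular kernel square integrable. -/
theorem lintegral_sum_mul_sq_le {ι : Type*} [Fintype ι] {f g : ι → α → ℝ≥0∞}
    (hf : ∀ i, Measurable (f i)) (hg : ∀ i, Measurable (g i)) {c : α → ℝ≥0∞} (hc : Measurable c)
    (hc0 : ∀ a, c a ≠ 0) (hct : ∀ a, c a ≠ ∞) :
    (∫⁻ a, ∑ i, f i a * g i a ∂μ) ^ 2 ≤
      (∫⁻ a, c a * ∑ i, f i a ^ 2 ∂μ) * ∫⁻ a, (c a)⁻¹ * ∑ i, g i a ^ 2 ∂μ := by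
  have e : ∀ x : ℝ≥0∞, (x ^ (1 / 2 : ℝ)) ^ 2 = x := fun x => by
    rw [← ENNReal.rpow_natCast, ← ENNReal.rpow_mul]; norm_num
  have e' : ∀ x : ℝ≥0∞, (x ^ 2) ^ (1 / 2 : ℝ) = x := fun x => by
    rw [← ENNReal.rpow_natCast, ← ENNReal.rpow_mul]; norm_num
  have h := lintegral_mul_sq_le (μ := μ) (f := fun a => (c a * ∑ i, f i a ^ 2) ^ (1 / 2 : ℝ))
    (g := fun a => ((c a)⁻¹ * ∑ i, g i a ^ 2) ^ (1 / 2 : ℝ))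
    (Measurable.aemeasurable (by fun_prop)) (Measurable.aemeasurable (by fun_prop))
  simp only [e] at h
  refine le_trans (pow_le_pow_left' (lintegral_mono fun a => ?_) 2) h
  rw [← ENNReal.mul_rpow_of_nonneg _ _ (by norm_num)]
  have h1 : c a * (∑ i, f i a ^ 2) * ((c a)⁻¹ * ∑ i, g i a ^ 2) =
      (∑ i, f i a ^ 2) * ∑ i, g i a ^ 2 := by
    rw [show c a * (∑ i, f i a ^ 2) * ((c a)⁻¹ * ∑ i, g i a ^ 2) =
      (c a * (c a)⁻¹) * ((∑ i, f i a ^ 2) * ∑ i, g i a ^ 2) by ring,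
      ENNReal.mul_inv_cancel (hc0 a) (hct a), one_mul]
  rw [h1]
  calc ∑ i, f i a * g i a = ((∑ i, f i a * g i a) ^ 2) ^ (1 / 2 : ℝ) := (e' _).symm
    _ ≤ _ := by gcongr; exact sum_mul_sq_le _ _

end Fubini

/-! ### Tensor expansion and the gain of (N-1)/2 derivatives -/

section Expansion

variable {N : ℕ} [NeZero N] {η : ℝ} {b : ℝ → ℝ} {B : ℝ≥0∞} {H : Vel N → Vel N → ℂ}

/-- The phase of the Fourier transform of `collisionOp`. -/
def phase (ξ : Vel N) (q : Vel N × (Vel N × Sph N)) : ℂ :=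
  (Real.fourierChar (-(inner ℝ (q.1 + (1 / 2 : ℝ) • (‖q.2.1‖ • (q.2.2 : Vel N))) ξ)) : ℂ)

theorem norm_phase (ξ : Vel N) (q : Vel N × (Vel N × Sph N)) : ‖phase ξ q‖ = 1 :=
  Circle.norm_coe _

theorem measurable_phase (ξ : Vel N) : Measurable (phase ξ) :=
  measurable_fourierChar.comp (Continuous.measurable (by fun_prop))

theorem phase_eq (ξ : Vel N) (q : Vel N × (Vel N × Sph N)) : phase ξ q =
    (Real.fourierChar (-(inner ℝ q.1 ξ)) : ℂ) *
      (Real.fourierChar (-(‖q.2.1‖ / 2 * inner ℝ (q.2.2 : Vel N) ξ)) : ℂ) := by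
  rw [phase, ← Circle.coe_mul, ← AddChar.map_add_eq_mul]
  congr 2
  rw [inner_add_left, inner_smul_left, inner_smul_left]
  simp only [conj_trivial]
  ring

/-- The `j`-th term of the expansion of `𝓕 (⟨·⟩^η collisionOp b H)`. -/
def expansionTerm (η : ℝ) (b : ℝ → ℝ) (H : Vel N → Vel N → ℂ) (ξ : Vel N) (j : ℕ) : ℂ :=
  ∫ q : Vel N × (Vel N × Sph N), (phase ξ q * (inner ℝ (tilt q.1 q.2.1) (q.2.2 : Vel N) : ℂ) ^ j) *
    ((((energyWeight q.1 q.2.1 ^ η : ℝ) : ℂ) * H q.1 q.2.1) *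
        (b (inner ℝ (q.2.2 : Vel N) (direction q.2.1)) : ℂ))
    ∂(volume.prod (volume.prod (surfaceMeasure N)))

/-- The density `λ^η ∏ tilt_{α i} H`. -/
def momentDensity (η : ℝ) (H : Vel N → Vel N → ℂ) {j : ℕ} (α : Fin j → Fin N) (x w : Vel N) : ℂ :=
  ((∏ i, tilt x w (α i) : ℝ) : ℂ) * (((energyWeight x w ^ η : ℝ) : ℂ) * H x w)

theorem measurable_momentDensity (hH : Measurable fun p : Vel N × Vel N => H p.1 p.2) {j : ℕ}
    (α : Fin j → Fin N) : Measurable fun p : Vel N × Vel N => momentDensity η H α p.1 p.2 := by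
  have h1 : Measurable fun p : Vel N × Vel N => ∏ i, tilt p.1 p.2 (α i) :=
    Finset.measurable_prod _ fun i _ =>
      (EuclideanSpace.proj (𝕜 := ℝ) (α i)).continuous.measurable.comp measurable_tilt
  have h2 := measurable_energyWeight_mul (η := η) hH
  exact (Complex.measurable_ofReal.comp h1).mul h2

theorem abs_prod_tilt_le_one {j : ℕ} (α : Fin j → Fin N) (x w : Vel N) :
    |∏ i, tilt x w (α i)| ≤ 1 := by
  rw [Finset.abs_prod]
  refine Finset.prod_le_one (fun i _ => abs_nonneg _) fun i _ => ?_
  have := PiLp.norm_apply_le (tilt x w) (α i)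
  exact this.trans (norm_tilt_lt_one x w).le

/-- The sum equals |y|^{2j} for the tilt y, so the N^j components together cost nothing. -/
theorem sum_prod_tilt_sq_le_one (j : ℕ) (x w : Vel N) :
    ∑ α : Fin j → Fin N, (∏ i, tilt x w (α i)) ^ 2 ≤ 1 := by
  have h : ∑ α : Fin j → Fin N, (∏ i, tilt x w (α i)) ^ 2 = (‖tilt x w‖ ^ 2) ^ j := by
    rw [EuclideanSpace.norm_sq_eq, Fintype.sum_pow]
    simp [Finset.prod_pow]
  rw [h]
  exact pow_le_one₀ (by positivity) (pow_le_one₀ (norm_nonneg _) (norm_tilt_lt_one x w).le)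

theorem inner_tilt_pow (x w ω : Vel N) (j : ℕ) :
    (inner ℝ (tilt x w) ω : ℂ) ^ j =
      ∑ α : Fin j → Fin N, ((∏ i, tilt x w (α i) : ℝ) : ℂ) * ((∏ i, ω (α i) : ℝ) : ℂ) := by
  rw [PiLp.inner_apply, ← Complex.ofReal_pow, Fintype.sum_pow]
  push_cast
  refine Finset.sum_congr rfl fun α _ => ?_
  rw [← Finset.prod_mul_distrib]
  refine Finset.prod_congr rfl fun i _ => ?_
  simp [mul_comm]

theorem measurable_inner_tilt :
    Measurable fun q : Vel N × (Vel N × Sph N) => inner ℝ (tilt q.1 q.2.1) (q.2.2 : Vel N) := by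
  have h := (measurable_tilt (N := N)).comp (measurable_fst_snd_fst (N := N))
  exact Measurable.inner h (by fun_prop)

theorem integrable_phase_mul {F : Vel N × (Vel N × Sph N) → ℂ}
    (hF : Integrable F (volume.prod (volume.prod (surfaceMeasure N)))) (ξ : Vel N)
    {r : Vel N × (Vel N × Sph N) → ℝ} (hr : Measurable r) (hr1 : ∀ q, |r q| ≤ 1) :
    Integrable (fun q => (phase ξ q * (r q : ℂ)) * F q)
      (volume.prod (volume.prod (surfaceMeasure N))) := by
  refine hF.bdd_mul (c := 1) ((measurable_phase ξ).mul
    (Complex.measurable_ofReal.comp hr)).aestronglyMeasurable (Filter.Eventually.of_forall fun q => ?_)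
  rw [norm_mul, norm_phase, one_mul, Complex.norm_real]
  exact hr1 q

/-- The `j`-th term is at most the absolute value of the binomial coefficient times one fixed
integrable function, because |y·ω| < 1. Summability of the coefficients permits exchanging sum and
integral. -/
theorem hasSum_expansionTerm
    (hG : Integrable (fun q : Vel N × (Vel N × Sph N) =>
      (((energyWeight q.1 q.2.1 ^ η : ℝ) : ℂ) * H q.1 q.2.1) *
        (b (inner ℝ (q.2.2 : Vel N) (direction q.2.1)) : ℂ))
      (volume.prod (volume.prod (surfaceMeasure N)))) (hη : 0 ≤ η)
    (h : Integrable (weightedIntegrand η b H)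
      ((volume : Measure (Vel N)).prod ((volume : Measure (Vel N)).prod (surfaceMeasure N))))
    (ξ : Vel N) :
    HasSum (fun j => ((Ring.choose (η / 2) j : ℝ) : ℂ) * expansionTerm η b H ξ j)
      (𝓕 (weighted η (collisionOp b H)) ξ) := by
  set μ := (volume : Measure (Vel N)).prod ((volume : Measure (Vel N)).prod (surfaceMeasure N))
  set G := fun q : Vel N × (Vel N × Sph N) =>
      (((energyWeight q.1 q.2.1 ^ η : ℝ) : ℂ) * H q.1 q.2.1) *
        (b (inner ℝ (q.2.2 : Vel N) (direction q.2.1)) : ℂ)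
  set r := fun q : Vel N × (Vel N × Sph N) => inner ℝ (tilt q.1 q.2.1) (q.2.2 : Vel N) with hr
  have hr1 : ∀ q, |r q| < 1 := fun q => abs_inner_tilt_lt_one _ _ _
  have hrj : ∀ j q, |r q ^ j| ≤ 1 := fun j q => by
    rw [abs_pow]; exact pow_le_one₀ (abs_nonneg _) (hr1 q).le
  set F : ℕ → Vel N × (Vel N × Sph N) → ℂ := fun j q =>
    ((Ring.choose (η / 2) j : ℝ) : ℂ) * ((phase ξ q * ((r q ^ j : ℝ) : ℂ)) * G q) with hF
  have hFi : ∀ j, Integrable (F j) μ := fun j =>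
    (integrable_phase_mul hG ξ (measurable_inner_tilt.pow_const j) (hrj j)).const_mul _
  have hFn : ∀ j q, ‖F j q‖ ≤ |Ring.choose (η / 2) j| * ‖G q‖ := fun j q => by
    rw [hF, norm_mul, norm_mul, norm_mul, norm_phase, Complex.norm_real, Complex.norm_real, one_mul,
      Real.norm_eq_abs, Real.norm_eq_abs]
    gcongr
    exact mul_le_of_le_one_left (norm_nonneg _) (hrj j q)
  have hs : Summable fun j => ∫ q, ‖F j q‖ ∂μ := by
    refine Summable.of_nonneg_of_le (fun j => integral_nonneg fun q => norm_nonneg _) (fun j => ?_)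
      ((summable_abs_choose (by linarith : 0 ≤ η / 2)).mul_right (∫ q, ‖G q‖ ∂μ))
    rw [← integral_const_mul]
    exact integral_mono (hFi j).norm (hG.norm.const_mul _) (hFn j)
  have := hasSum_integral_of_summable_integral_norm hFi hs
  rw [fourier_weighted_collisionOp h]
  have e1 : (fun j => ((Ring.choose (η / 2) j : ℝ) : ℂ) * expansionTerm η b H ξ j) =
      fun j => ∫ q, F j q ∂μ := by
    ext j
    simp only [hF, hr, integral_const_mul, expansionTerm, Complex.ofReal_pow]
    rfl
  have e2 : (∫ q : Vel N × (Vel N × Sph N),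
      (Real.fourierChar (-(inner ℝ (q.1 + (1 / 2 : ℝ) • (‖q.2.1‖ • (q.2.2 : Vel N))) ξ)) : ℂ) *
        swappedIntegrand η b H q ∂(volume.prod (volume.prod (surfaceMeasure N)))) =
      ∫ q, ∑' j, F j q ∂μ := by
    refine integral_congr_ae (Filter.Eventually.of_forall fun q => ?_)
    have h1 := hasSum_one_add_rpow (η / 2) (hr1 q)
    have h2 : HasSum (fun j => F j q) (phase ξ q * swappedIntegrand η b H q) := by
      have h3 := (Complex.hasSum_ofReal.2 h1).mul_left (phase ξ q * G q)
      have e3 : (fun j => F j q) =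
          fun j => phase ξ q * G q * ((Ring.choose (η / 2) j * r q ^ j : ℝ) : ℂ) := by
        ext j
        simp only [hF]
        push_cast
        ring
      have e4 : phase ξ q * swappedIntegrand η b H q =
          phase ξ q * G q * (((1 + r q) ^ (η / 2) : ℝ) : ℂ) := by
        rw [swappedIntegrand, bracket_preCollision_rpow]
        simp only [G, hr]
        push_cast
        ring
      rw [e3, e4]
      exact h3
    exact h2.tsum_eq.symm
  rw [e1, e2]
  exact this

/-- Expanding (y·ω)^j over multi-indices makes the integrand a function of (x, w) times a function
of (w, ω). For fixed `w` the first integrates to a Fourier transform in `x`, the second to the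
angular kernel. -/
theorem expansionTerm_eq
    (hG : Integrable (fun q : Vel N × (Vel N × Sph N) =>
      (((energyWeight q.1 q.2.1 ^ η : ℝ) : ℂ) * H q.1 q.2.1) *
        (b (inner ℝ (q.2.2 : Vel N) (direction q.2.1)) : ℂ))
      (volume.prod (volume.prod (surfaceMeasure N)))) (ξ : Vel N) (j : ℕ) :
    expansionTerm η b H ξ j = ∑ α : Fin j → Fin N,
      ∫ w, 𝓕 (fun x => momentDensity η H α x w) ξ * angularKernel b α ξ w := by
  have hi : ∀ α : Fin j → Fin N, Integrable (fun q : Vel N × (Vel N × Sph N) =>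
      (phase ξ q * (((∏ i, tilt q.1 q.2.1 (α i)) * ∏ i, (q.2.2 : Vel N) (α i) : ℝ) : ℂ)) *
      ((((energyWeight q.1 q.2.1 ^ η : ℝ) : ℂ) * H q.1 q.2.1) *
        (b (inner ℝ (q.2.2 : Vel N) (direction q.2.1)) : ℂ)))
      (volume.prod (volume.prod (surfaceMeasure N))) := fun α => by
    refine integrable_phase_mul hG ξ (Measurable.mul ?_ (by fun_prop)) fun q => ?_
    · refine Finset.measurable_prod _ fun i _ => ?_
      have h := (measurable_tilt (N := N)).comp (measurable_fst_snd_fst (N := N))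
      exact (EuclideanSpace.proj (𝕜 := ℝ) (α i)).continuous.measurable.comp h
    · rw [abs_mul]
      refine mul_le_one₀ (abs_prod_tilt_le_one α _ _) (abs_nonneg _) ?_
      rw [Finset.abs_prod]
      exact Finset.prod_le_one (fun i _ => abs_nonneg _) fun i _ => abs_coord_le_one _ _
  rw [expansionTerm]
  simp only [inner_tilt_pow, Finset.mul_sum, Finset.sum_mul, ← Complex.ofReal_mul]
  rw [integral_finsetSum _ fun α _ => hi α]
  refine Finset.sum_congr rfl fun α _ => ?_
  have hs : ∀ q : Vel N × (Vel N × Sph N),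
      (phase ξ q * (((∏ i, tilt q.1 q.2.1 (α i)) * ∏ i, (q.2.2 : Vel N) (α i) : ℝ) : ℂ)) *
      ((((energyWeight q.1 q.2.1 ^ η : ℝ) : ℂ) * H q.1 q.2.1) *
        (b (inner ℝ (q.2.2 : Vel N) (direction q.2.1)) : ℂ)) =
      ((Real.fourierChar (-(inner ℝ q.1 ξ)) : ℂ) * momentDensity η H α q.1 q.2.1) *
      (((b (inner ℝ (q.2.2 : Vel N) (direction q.2.1)) * ∏ i, (q.2.2 : Vel N) (α i) : ℝ) : ℂ) *
        (Real.fourierChar (-(‖q.2.1‖ / 2 * inner ℝ (q.2.2 : Vel N) ξ)) : ℂ)) := fun q => by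
    rw [phase_eq, momentDensity]
    push_cast
    ring
  have hi' := hi α
  simp only [hs] at hi' ⊢
  refine (integral_mul_kernel (A := fun p : Vel N × Vel N => (Real.fourierChar (-(inner ℝ p.1 ξ)) : ℂ) *
    momentDensity η H α p.1 p.2) (k := fun p : Vel N × Sph N =>
      ((b (inner ℝ (p.2 : Vel N) (direction p.1)) * ∏ i, (p.2 : Vel N) (α i) : ℝ) : ℂ) *
        (Real.fourierChar (-(‖p.1‖ / 2 * inner ℝ (p.2 : Vel N) ξ)) : ℂ)) hi').trans ?_
  refine integral_congr_ae (Filter.Eventually.of_forall fun w => ?_)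
  simp only
  rw [Real.fourier_eq, angularKernel]
  rfl

theorem eLpNorm_two_sq {X : Type*} [MeasurableSpace X] {μ : Measure X} (f : X → ℂ) :
    eLpNorm f 2 μ ^ 2 = ∫⁻ x, ‖f x‖ₑ ^ 2 ∂μ := by
  rw [eLpNorm_eq_lintegral_rpow_enorm_toReal (by norm_num) (by norm_num), ← ENNReal.rpow_natCast,
    ← ENNReal.rpow_mul]
  norm_num

theorem lintegral_enorm_fourier_sq {u : Vel N → ℂ} (h : Integrable u volume) :
    ∫⁻ ξ, ‖𝓕 u ξ‖ₑ ^ 2 = ∫⁻ x, ‖u x‖ₑ ^ 2 := by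
  rw [← eLpNorm_two_sq, ← eLpNorm_two_sq, eLpNorm_fourier_eq h]

theorem enorm_ofReal (x : ℝ) : ‖(x : ℂ)‖ₑ = ‖x‖ₑ := by simp [enorm_eq_nnnorm]

/-- The energy controlling the `j`-th term of the expansion. -/
def expansionEnergy (η : ℝ) (H : Vel N → Vel N → ℂ) (j : ℕ) (ξ : Vel N) : ℝ≥0∞ :=
  ∫⁻ w, ENNReal.ofReal (bracket w ^ 2) *
    ∑ α : Fin j → Fin N, ‖𝓕 (fun x => momentDensity η H α x w) ξ‖ₑ ^ 2

theorem measurable_fourier_momentDensity (hH : Measurable fun p : Vel N × Vel N => H p.1 p.2) {j : ℕ}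
    (α : Fin j → Fin N) :
    Measurable fun p : Vel N × Vel N => 𝓕 (fun x => momentDensity η H α x p.2) p.1 := by
  have h1 : Measurable fun q : (Vel N × Vel N) × Vel N =>
      (Real.fourierChar (-(inner ℝ q.2 q.1.1)) : ℂ) * momentDensity η H α q.2 q.1.2 := by
    have h2 : Measurable fun q : (Vel N × Vel N) × Vel N => (q.2, q.1.2) := by fun_prop
    have h3 := (measurable_momentDensity (η := η) (H := H) hH α).comp h2
    have h4 : Measurable fun q : (Vel N × Vel N) × Vel N => -(inner ℝ q.2 q.1.1) := by fun_prop
    exact (measurable_fourierChar.comp h4).mul h3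
  have h5 := (StronglyMeasurable.integral_prod_right' (ν := (volume : Measure (Vel N)))
    h1.stronglyMeasurable).measurable
  exact h5

theorem measurable_expansionEnergy_aux (hH : Measurable fun p : Vel N × Vel N => H p.1 p.2) (j : ℕ) :
    Measurable fun p : Vel N × Vel N => ENNReal.ofReal (bracket p.2 ^ 2) *
      ∑ α : Fin j → Fin N, ‖𝓕 (fun x => momentDensity η H α x p.2) p.1‖ₑ ^ 2 := by
  have h1 : Measurable fun p : Vel N × Vel N => ENNReal.ofReal (bracket p.2 ^ 2) :=
    ENNReal.measurable_ofReal.comp ((continuous_bracket.measurable.comp measurable_snd).pow_const 2)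
  exact h1.mul (Finset.measurable_sum _ fun α _ =>
    (measurable_fourier_momentDensity hH α).enorm.pow_const 2)

theorem measurable_expansionEnergy (hH : Measurable fun p : Vel N × Vel N => H p.1 p.2) (j : ℕ) :
    Measurable (expansionEnergy η H j) :=
  (measurable_expansionEnergy_aux hH j).lintegral_prod_right'

theorem enorm_expansionTerm_sq_le
    (hG : Integrable (fun q : Vel N × (Vel N × Sph N) =>
      (((energyWeight q.1 q.2.1 ^ η : ℝ) : ℂ) * H q.1 q.2.1) *
        (b (inner ℝ (q.2.2 : Vel N) (direction q.2.1)) : ℂ))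
      (volume.prod (volume.prod (surfaceMeasure N)))) (hb : Measurable b)
    (hH : Measurable fun p : Vel N × Vel N => H p.1 p.2) (ξ : Vel N) (j : ℕ) :
    ‖expansionTerm η b H ξ j‖ₑ ^ 2 ≤ expansionEnergy η H j ξ *
      ∫⁻ w : Vel N, ENNReal.ofReal ((bracket w ^ 2)⁻¹ *
        ∑ α : Fin j → Fin N, ‖angularKernel b α ξ w‖ ^ 2) := by
  have hm : ∀ α : Fin j → Fin N, Measurable fun w => ‖𝓕 (fun x => momentDensity η H α x w) ξ‖ₑ :=
    fun α => ((measurable_fourier_momentDensity hH α).comp measurable_prodMk_left).enorm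
  have hk : ∀ α : Fin j → Fin N, Measurable fun w => ‖angularKernel b α ξ w‖ₑ := fun α =>
    (stronglyMeasurable_angularKernel hb α ξ).measurable.enorm
  have h1 : ‖expansionTerm η b H ξ j‖ₑ ≤ ∫⁻ w, ∑ α : Fin j → Fin N,
      ‖𝓕 (fun x => momentDensity η H α x w) ξ‖ₑ * ‖angularKernel b α ξ w‖ₑ := by
    have hmk : ∀ α : Fin j → Fin N, Measurable fun w =>
        ‖𝓕 (fun x => momentDensity η H α x w) ξ‖ₑ * ‖angularKernel b α ξ w‖ₑ :=
      fun α => (hm α).mul (hk α)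
    rw [expansionTerm_eq hG, lintegral_finsetSum _ fun α _ => hmk α]
    refine (enorm_sum_le _ _).trans (Finset.sum_le_sum fun α _ => ?_)
    refine (enorm_integral_le_lintegral_enorm _).trans (le_of_eq ?_)
    simp only [enorm_mul]
  refine (pow_le_pow_left' h1 2).trans ?_
  have hbp : ∀ w : Vel N, 0 < bracket w ^ 2 := fun w => by have := bracket_pos w; positivity
  refine (lintegral_sum_mul_sq_le (c := fun w => ENNReal.ofReal (bracket w ^ 2)) hm hk
    (ENNReal.measurable_ofReal.comp (continuous_bracket.measurable.pow_const 2))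
    (fun w => (ENNReal.ofReal_pos.2 (hbp w)).ne') fun w => ENNReal.ofReal_ne_top).trans (le_of_eq ?_)
  rw [expansionEnergy]
  congr 1
  refine lintegral_congr fun w => ?_
  rw [ENNReal.ofReal_mul (inv_nonneg.2 (hbp w).le), ENNReal.ofReal_inv_of_pos (hbp w),
    ENNReal.ofReal_sum_of_nonneg fun α _ => by positivity]
  congr 1
  refine Finset.sum_congr rfl fun α _ => ?_
  rw [ENNReal.ofReal_pow (norm_nonneg _), ofReal_norm]

theorem norm_momentDensity_le {j : ℕ} (α : Fin j → Fin N) (x w : Vel N) :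
    ‖momentDensity η H α x w‖ ≤ ‖((energyWeight x w ^ η : ℝ) : ℂ) * H x w‖ := by
  rw [momentDensity, norm_mul, Complex.norm_real, Real.norm_eq_abs]
  exact mul_le_of_le_one_left (norm_nonneg _) (abs_prod_tilt_le_one α x w)

theorem integrable_momentDensity (hH : Measurable fun p : Vel N × Vel N => H p.1 p.2) {w : Vel N}
    (hw : Integrable (fun x : Vel N => ((energyWeight x w ^ η : ℝ) : ℂ) * H x w) volume) {j : ℕ}
    (α : Fin j → Fin N) : Integrable (fun x => momentDensity η H α x w) volume := by
  have hm := (measurable_momentDensity (η := η) hH α).comp (measurable_prodMk_right (y := w))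
  exact hw.mono hm.aestronglyMeasurable
    (Filter.Eventually.of_forall fun x => norm_momentDensity_le α x w)

/-- Plancherel in `x` for almost every `w`, after which the squares of the tensor components sum to
at most 1. The right-hand side does not depend on `j`. -/
theorem lintegral_expansionEnergy_le (hH : Measurable fun p : Vel N × Vel N => H p.1 p.2)
    (hI : Integrable (fun p : Vel N × Vel N => ((energyWeight p.1 p.2 ^ η : ℝ) : ℂ) * H p.1 p.2)
      (volume.prod volume)) (j : ℕ) :
    ∫⁻ ξ, expansionEnergy η H j ξ ≤ ∫⁻ p, ‖((bracket p.2 * energyWeight p.1 p.2 ^ η : ℝ) : ℂ) *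
      H p.1 p.2‖ₑ ^ 2 ∂((volume : Measure (Vel N)).prod volume) := by
  have hm1 : Measurable fun p : Vel N × Vel N =>
      ‖((bracket p.2 * energyWeight p.1 p.2 ^ η : ℝ) : ℂ) * H p.1 p.2‖ₑ ^ 2 := by
    have h1 : Measurable fun p : Vel N × Vel N => bracket p.2 * energyWeight p.1 p.2 ^ η :=
      (continuous_bracket.measurable.comp measurable_snd).mul (measurable_energyWeight_rpow η)
    exact ((Complex.measurable_ofReal.comp h1).mul hH).enorm.pow_const 2
  rw [lintegral_prod_symm _ hm1.aemeasurable]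
  unfold expansionEnergy
  rw [lintegral_lintegral_swap (measurable_expansionEnergy_aux hH j).aemeasurable]
  refine lintegral_mono_ae ?_
  filter_upwards [hI.prod_left_ae] with w hw
  have hmα : ∀ α : Fin j → Fin N, Measurable fun ξ => ‖𝓕 (fun x => momentDensity η H α x w) ξ‖ₑ ^ 2 :=
    fun α => ((measurable_fourier_momentDensity hH α).comp measurable_prodMk_right).enorm.pow_const 2
  have hmx : ∀ α : Fin j → Fin N, Measurable fun x => momentDensity η H α x w := fun α => by
    have hm := (measurable_momentDensity (η := η) hH α).comp (measurable_prodMk_right (y := w))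
    exact hm
  have hint : ∀ α : Fin j → Fin N, Integrable (fun x => momentDensity η H α x w) volume := fun α =>
    integrable_momentDensity (H := H) hH hw α
  rw [lintegral_const_mul _ (Finset.measurable_sum _ fun α _ => hmα α),
    lintegral_finsetSum _ fun α _ => hmα α]
  simp only [lintegral_enorm_fourier_sq (hint _)]
  rw [← lintegral_finsetSum _ fun α _ => (hmx α).enorm.pow_const 2,
    ← lintegral_const_mul' _ _ ENNReal.ofReal_ne_top]
  refine lintegral_mono fun x => ?_
  have hb := bracket_pos w
  rw [Complex.ofReal_mul, mul_assoc, enorm_mul, mul_pow, enorm_ofReal, Real.enorm_of_nonneg hb.le,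
    ← ENNReal.ofReal_pow hb.le]
  gcongr
  simp only [momentDensity, enorm_mul _ (_ * _), mul_pow]
  rw [← Finset.sum_mul]
  refine mul_le_of_le_one_left zero_le ?_
  have h2 : ∀ x : ℝ, ‖(x : ℂ)‖ₑ ^ 2 = ENNReal.ofReal (x ^ 2) := fun x => by
    rw [enorm_ofReal, Real.enorm_eq_ofReal_abs, ← ENNReal.ofReal_pow (abs_nonneg _), sq_abs]
  simp only [h2]
  rw [← ENNReal.ofReal_sum_of_nonneg fun α _ => by positivity]
  exact ENNReal.ofReal_le_one.2 (sum_prod_tilt_sq_le_one j x w)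

/-- The regularity gain: `(N-1)/2` derivatives of the weighted gain operator are controlled in `L²`
by the tensorised argument. -/
theorem exists_lintegral_fourier_collisionOp_le (N : ℕ) [NeZero N] (η : ℝ) (hη : 0 ≤ η) :
    ∃ C : ℝ≥0, ∀ b : ℝ → ℝ, Measurable b → ∀ B : ℝ≥0∞, B ≠ ∞ → (∀ e : Sph N,
      ∫⁻ ω : Sph N, ENNReal.ofReal (b (inner ℝ (ω : Vel N) e) ^ 2) ∂surfaceMeasure N ≤ B) →
    ∀ H : Vel N → Vel N → ℂ, Measurable (fun p : Vel N × Vel N => H p.1 p.2) →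
      Integrable (fun p : Vel N × Vel N => ((energyWeight p.1 p.2 ^ η : ℝ) : ℂ) * H p.1 p.2)
        (volume.prod volume) →
      ∫⁻ ξ, ENNReal.ofReal (‖ξ‖ ^ ((N : ℝ) - 1)) * ‖𝓕 (weighted η (collisionOp b H)) ξ‖ₑ ^ 2 ≤
        C * B * ∫⁻ p, ‖((bracket p.2 * energyWeight p.1 p.2 ^ η : ℝ) : ℂ) * H p.1 p.2‖ₑ ^ 2
          ∂((volume : Measure (Vel N)).prod volume) := by
  obtain ⟨C, hC⟩ := exists_lintegral_angularKernel_le N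
  set c : ℕ → ℝ≥0∞ := fun j => ENNReal.ofReal |Ring.choose (η / 2) j| with hc
  have hct : ∑' j, c j ≠ ∞ := (summable_abs_choose (by linarith : 0 ≤ η / 2)).tsum_ofReal_ne_top
  refine ⟨(∑' j, c j).toNNReal ^ 2 * C, fun b hb B hBt hB H hH hI => ?_⟩
  have hG := integrable_swappedIntegrand_aux hb hBt hB hH hI
  have hW := integrable_weightedIntegrand hη hb hBt hB hH hI
  set X := ∫⁻ p, ‖((bracket p.2 * energyWeight p.1 p.2 ^ η : ℝ) : ℂ) * H p.1 p.2‖ₑ ^ 2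
          ∂((volume : Measure (Vel N)).prod volume)
  have hpt : ∀ ξ : Vel N, ξ ≠ 0 →
      ENNReal.ofReal (‖ξ‖ ^ ((N : ℝ) - 1)) * ‖𝓕 (weighted η (collisionOp b H)) ξ‖ₑ ^ 2 ≤
        (∑' j, c j) * C * B * ∑' j, c j * expansionEnergy η H j ξ := by
    intro ξ hξ
    have h1 : ‖𝓕 (weighted η (collisionOp b H)) ξ‖ₑ ≤ ∑' j, c j * ‖expansionTerm η b H ξ j‖ₑ := by
      rw [← (hasSum_expansionTerm hG hη hW ξ).tsum_eq]
      refine enorm_tsum_le_tsum_enorm.trans (le_of_eq (tsum_congr fun j => ?_))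
      rw [enorm_mul, enorm_ofReal, Real.enorm_eq_ofReal_abs]
    have h2 : ‖𝓕 (weighted η (collisionOp b H)) ξ‖ₑ ^ 2 ≤
        (∑' j, c j) * ∑' j, c j * (expansionEnergy η H j ξ *
          (C * ENNReal.ofReal (‖ξ‖ ^ (-((N : ℝ) - 1))) * B)) := by
      -- Cauchy–Schwarz against the summable weights `c j`; the remaining estimate is uniform in
      -- `j`.
      refine (pow_le_pow_left' h1 2).trans ((tsum_mul_sq_le _ _).trans ?_)
      gcongr with j
      refine (enorm_expansionTerm_sq_le hG hb hH ξ j).trans ?_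
      gcongr
      exact hC b hb B hBt hB j ξ hξ
    have hξ' : 0 < ‖ξ‖ := norm_pos_iff.2 hξ
    have h3 : ENNReal.ofReal (‖ξ‖ ^ ((N : ℝ) - 1)) * ENNReal.ofReal (‖ξ‖ ^ (-((N : ℝ) - 1))) = 1 := by
      rw [← ENNReal.ofReal_mul (by positivity), ← Real.rpow_add hξ', add_neg_cancel, Real.rpow_zero,
        ENNReal.ofReal_one]
    calc _ ≤ ENNReal.ofReal (‖ξ‖ ^ ((N : ℝ) - 1)) * ((∑' j, c j) * ∑' j, c j *
          (expansionEnergy η H j ξ * (C * ENNReal.ofReal (‖ξ‖ ^ (-((N : ℝ) - 1))) * B))) := by gcongr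
      _ = (ENNReal.ofReal (‖ξ‖ ^ ((N : ℝ) - 1)) * ENNReal.ofReal (‖ξ‖ ^ (-((N : ℝ) - 1)))) *
          ((∑' j, c j) * C * B * ∑' j, c j * expansionEnergy η H j ξ) := by
        simp only [← mul_assoc (c _)]
        rw [ENNReal.tsum_mul_right]
        ring
      _ = _ := by rw [h3, one_mul]
  calc _ ≤ ∫⁻ ξ, (∑' j, c j) * C * B * ∑' j, c j * expansionEnergy η H j ξ :=
        lintegral_mono_ae (ae_ne_zero.mono hpt)
    _ = (∑' j, c j) * C * B * ∑' j, c j * ∫⁻ ξ, expansionEnergy η H j ξ := by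
        rw [lintegral_const_mul _ (Measurable.tsum fun j =>
          (measurable_expansionEnergy hH j).const_mul _), lintegral_tsum fun j =>
          ((measurable_expansionEnergy hH j).const_mul _).aemeasurable]
        simp only [lintegral_const_mul _ (measurable_expansionEnergy hH _)]
    _ ≤ (∑' j, c j) * C * B * ∑' j, c j * X := by
        gcongr with j
        exact lintegral_expansionEnergy_le hH hI j
    _ = _ := by
        rw [ENNReal.tsum_mul_right, ENNReal.coe_mul, ENNReal.coe_pow, ENNReal.coe_toNNReal hct]
        ring

end Expansion

/-! ### Commuting differences with weights -/

section WeightedLeibniz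

theorem eLpNorm_le_sum {X ι E F : Type*} [MeasurableSpace X] {μ : Measure X} [NormedAddCommGroup E]
    [NormedAddCommGroup F] {p : ℝ≥0∞} (hp : 1 ≤ p) (s : Finset ι) {c : ι → ℝ} (hc : ∀ i ∈ s, 0 ≤ c i)
    {f : ι → X → E} (hf : ∀ i ∈ s, AEStronglyMeasurable (f i) μ) {g : X → F} (C : ℝ≥0)
    (h : ∀ x, ‖g x‖ ≤ C * ∑ i ∈ s, c i * ‖f i x‖) :
    eLpNorm g p μ ≤ C * ∑ i ∈ s, ENNReal.ofReal (c i) * eLpNorm (f i) p μ := by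
  have h1 : eLpNorm g p μ ≤
      eLpNorm ((C : ℝ) • ∑ i ∈ s, (c i) • (fun x => ‖f i x‖)) p μ := by
    refine eLpNorm_mono_real fun x => (h x).trans (le_of_eq ?_)
    simp [Finset.sum_apply]
  refine h1.trans ((eLpNorm_const_smul_le).trans ?_)
  rw [Real.enorm_eq_ofReal (by positivity), ENNReal.ofReal_coe_nnreal]
  gcongr
  refine (eLpNorm_sum_le (fun i hi => (hf i hi).norm.const_smul _) hp).trans ?_
  refine Finset.sum_le_sum fun i hi => (eLpNorm_const_smul_le).trans (le_of_eq ?_)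
  rw [Real.enorm_eq_ofReal (hc i hi), eLpNorm_norm]

variable {N : ℕ}

theorem fwdDiff_iter_ofReal (h : Vel N) (a : Vel N → ℝ) (i : ℕ) :
    (fwdDiff h)^[i] (fun v => (a v : ℂ)) = fun v => (((fwdDiff h)^[i] a v : ℝ) : ℂ) := by
  induction i generalizing a with
  | zero => rfl
  | succ i ih =>
    rw [Function.iterate_succ_apply, Function.iterate_succ_apply, ← ih]
    congr 1
    ext v
    simp [fwdDiff]

theorem weighted_neg_weighted (p : ℝ) (u : Vel N → ℂ) : weighted (-p) (weighted p u) = u := by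
  ext v
  have := bracket_pos v
  rw [weighted, weighted, ← mul_assoc, ← Complex.ofReal_mul, ← Real.rpow_add this]
  simp

theorem norm_weighted (p : ℝ) (u : Vel N → ℂ) (v : Vel N) :
    ‖weighted p u v‖ = bracket v ^ p * ‖u v‖ := by
  have := bracket_pos v
  rw [weighted, norm_mul, Complex.norm_real, Real.norm_of_nonneg (by positivity)]

/-- Leibniz rule: every difference that falls on the weight is worth a factor `‖h‖`. Exponents of
both signs are covered, since the converse comparison uses `-p`. -/
theorem exists_norm_fwdDiff_weighted_le (N : ℕ) (j : ℕ) (P : ℝ) : ∃ C : ℝ≥0, ∀ p, |p| ≤ P →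
    ∀ h : Vel N, ‖h‖ ≤ 1 → ∀ (u : Vel N → ℂ) (v : Vel N), ∀ i ≤ j,
      ‖(fwdDiff h)^[i] (weighted p u) v‖ ≤ C * (bracket v ^ p *
        ∑ ik ∈ Finset.HasAntidiagonal.antidiagonal i, ‖h‖ ^ ik.1 * ‖(fwdDiff h)^[ik.2] u v‖) := by
  -- The Leibniz rule evaluates the weight at points shifted by at most `j‖h‖ ≤ j`, hence `K = j`.
  obtain ⟨C, hC0, hC⟩ := exists_abs_fwdDiff_bracket_rpow_le (N := N) j P (K := j) (by positivity)
  lift C to ℝ≥0 using hC0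
  refine ⟨2 ^ j * C, fun p hp h hh u v i hi => ?_⟩
  have hb := bracket_pos v
  refine (norm_fwdDiff_iter_mul_le h i (fun v => ((bracket v ^ p : ℝ) : ℂ)) u v).trans ?_
  have h1 : (2 : ℝ) ^ i ≤ 2 ^ j := pow_le_pow_right₀ (by norm_num) hi
  rw [NNReal.coe_mul, NNReal.coe_pow, NNReal.coe_ofNat, mul_assoc]
  refine mul_le_mul h1 ?_ (by positivity) (by positivity)
  rw [← mul_assoc, Finset.mul_sum]
  refine Finset.sum_le_sum fun ik hik => ?_
  have hs := Finset.HasAntidiagonal.mem_antidiagonal.1 hik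
  rw [fwdDiff_iter_ofReal, Complex.norm_real, Real.norm_eq_abs]
  have h2 := hC p hp h hh v (ik.2 • h) (by
    refine (norm_nsmul_le).trans ?_
    calc (ik.2 : ℝ) * ‖h‖ ≤ j * 1 := by gcongr; omega
      _ = j := mul_one _) ik.1 (by omega)
  calc _ ≤ (C * ‖h‖ ^ ik.1 * bracket v ^ p) * ‖(fwdDiff h)^[ik.2] u v‖ := by gcongr
    _ = _ := by ring

theorem aestronglyMeasurable_fwdDiff_iter {u : Vel N → ℂ} (hu : AEStronglyMeasurable u volume)
    (h : Vel N) (j : ℕ) : AEStronglyMeasurable ((fwdDiff h)^[j] u) volume := by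
  induction j generalizing u with
  | zero => exact hu
  | succ j ih =>
    exact ih ((hu.comp_measurePreserving (measurePreserving_add_right volume h)).sub hu)

theorem aestronglyMeasurable_weighted {u : Vel N → ℂ} (hu : AEStronglyMeasurable u volume) (p : ℝ) :
    AEStronglyMeasurable (weighted p u) volume :=
  (Complex.measurable_ofReal.comp (continuous_bracket_rpow p).measurable).aestronglyMeasurable.mul hu

theorem aestronglyMeasurable_of_weighted {u : Vel N → ℂ} {p : ℝ}
    (hu : AEStronglyMeasurable (weighted p u) volume) : AEStronglyMeasurable u volume := by
  rw [← weighted_neg_weighted p u]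
  exact aestronglyMeasurable_weighted hu _

theorem enorm_pow_eq (h : Vel N) (i : ℕ) : ENNReal.ofReal (‖h‖ ^ i) = ‖h‖ₑ ^ i := by
  rw [ENNReal.ofReal_pow (norm_nonneg _), ofReal_norm]

theorem exists_eLpNorm_fwdDiff_weighted_le (N : ℕ) (j : ℕ) (P : ℝ) : ∃ C : ℝ≥0, ∀ p, |p| ≤ P →
    ∀ h : Vel N, ‖h‖ ≤ 1 → ∀ u : Vel N → ℂ, AEStronglyMeasurable u volume → ∀ i ≤ j,
      eLpNorm ((fwdDiff h)^[i] (weighted p u)) 2 volume ≤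
        C * ∑ ik ∈ Finset.HasAntidiagonal.antidiagonal i,
          ‖h‖ₑ ^ ik.1 * eLpNorm (weighted p ((fwdDiff h)^[ik.2] u)) 2 volume := by
  obtain ⟨C, hC⟩ := exists_norm_fwdDiff_weighted_le N j P
  refine ⟨C, fun p hp h hh u hu i hi => ?_⟩
  have := eLpNorm_le_sum (μ := (volume : Measure (Vel N))) (p := 2) (by norm_num)
    (Finset.HasAntidiagonal.antidiagonal i) (c := fun ik => ‖h‖ ^ ik.1) (fun ik _ => by positivity)
    (f := fun ik => weighted p ((fwdDiff h)^[ik.2] u))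
    (fun ik _ => aestronglyMeasurable_weighted (aestronglyMeasurable_fwdDiff_iter hu h _) p)
    (g := (fwdDiff h)^[i] (weighted p u)) C fun v => by
      refine (hC p hp h hh u v i hi).trans (le_of_eq ?_)
      rw [Finset.mul_sum]
      refine congrArg _ (Finset.sum_congr rfl fun ik _ => ?_)
      rw [norm_weighted]
      ring
  simpa only [enorm_pow_eq] using this

/-- The converse comparison: the Leibniz rule with exponent `-p` for the function `weighted p u`,
then multiplication by ⟨v⟩^p. -/
theorem exists_eLpNorm_weighted_fwdDiff_le (N : ℕ) (j : ℕ) (P : ℝ) : ∃ C : ℝ≥0, ∀ p, |p| ≤ P →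
    ∀ h : Vel N, ‖h‖ ≤ 1 → ∀ u : Vel N → ℂ, AEStronglyMeasurable u volume → ∀ i ≤ j,
      eLpNorm (weighted p ((fwdDiff h)^[i] u)) 2 volume ≤
        C * ∑ ik ∈ Finset.HasAntidiagonal.antidiagonal i,
          ‖h‖ₑ ^ ik.1 * eLpNorm ((fwdDiff h)^[ik.2] (weighted p u)) 2 volume := by
  obtain ⟨C, hC⟩ := exists_norm_fwdDiff_weighted_le N j P
  refine ⟨C, fun p hp h hh u hu i hi => ?_⟩
  have := eLpNorm_le_sum (μ := (volume : Measure (Vel N))) (p := 2) (by norm_num)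
    (Finset.HasAntidiagonal.antidiagonal i) (c := fun ik => ‖h‖ ^ ik.1) (fun ik _ => by positivity)
    (f := fun ik => (fwdDiff h)^[ik.2] (weighted p u))
    (fun ik _ => aestronglyMeasurable_fwdDiff_iter (aestronglyMeasurable_weighted hu p) h _)
    (g := weighted p ((fwdDiff h)^[i] u)) C fun v => by
      have h1 := hC (-p) (by rwa [abs_neg]) h hh (weighted p u) v i hi
      rw [weighted_neg_weighted] at h1
      have hb := bracket_pos v
      rw [norm_weighted]
      have h2 : bracket v ^ p * bracket v ^ (-p) = 1 := by
        rw [← Real.rpow_add hb, add_neg_cancel, Real.rpow_zero]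
      refine (mul_le_mul_of_nonneg_left h1 (by positivity)).trans (le_of_eq ?_)
      rw [mul_left_comm (bracket v ^ p), ← mul_assoc (bracket v ^ p) (bracket v ^ (-p)), h2, one_mul]
  simpa only [enorm_pow_eq] using this

end WeightedLeibniz

/-! ### Summation by parts and low frequencies -/

section SummationByParts

variable {N : ℕ} {η : ℝ}

theorem integrable_mul_of_weighted {q g : Vel N → ℂ} (hq : Integrable (weighted η q) volume)
    (hg : Measurable g) {C : ℝ} (hC : ∀ v, ‖g v‖ ≤ C * bracket v ^ η) :
    Integrable (fun v => g v * q v) volume := by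
  have h1 : Integrable (fun v => weighted (-η) g v * weighted η q v) volume := by
    refine hq.bdd_mul (c := C) (aestronglyMeasurable_weighted hg.aestronglyMeasurable _)
      (Filter.Eventually.of_forall fun v => ?_)
    have hb := bracket_pos v
    rw [norm_weighted]
    calc _ ≤ bracket v ^ (-η) * (C * bracket v ^ η) := by gcongr; exact hC v
      _ = C * (bracket v ^ (-η) * bracket v ^ η) := by ring
      _ = C := by rw [← Real.rpow_add hb]; simp
  convert h1 using 1
  ext v
  have hb := bracket_pos v
  have e : ((bracket v ^ (-η) : ℝ) : ℂ) * ((bracket v ^ η : ℝ) : ℂ) = 1 := by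
    rw [← Complex.ofReal_mul, ← Real.rpow_add hb]; simp
  rw [weighted, weighted]
  linear_combination (-(g v * q v)) * e

theorem integrable_weighted_comp_add {q : Vel N → ℂ} (hη : 0 ≤ η)
    (hq : Integrable (weighted η q) volume) (h : Vel N) :
    Integrable (weighted η fun v => q (v + h)) volume := by
  have hq' := aestronglyMeasurable_of_weighted hq.1
  have h1 := hq.comp_add_right h
  refine (h1.norm.const_mul ((1 + ‖-h‖) ^ η)).mono' (aestronglyMeasurable_weighted
    (hq'.comp_measurePreserving (measurePreserving_add_right volume h)) _)
    (Filter.Eventually.of_forall fun v => ?_)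
  have h2 := bracket_rpow_add_le (p := η) (abs_of_nonneg hη).le (v + h) (-h)
  rw [add_neg_cancel_right] at h2
  rw [norm_weighted, norm_weighted, ← mul_assoc]
  gcongr

theorem weighted_sub (p : ℝ) (q q' : Vel N → ℂ) :
    (weighted p fun v => q v - q' v) = fun v => weighted p q v - weighted p q' v := by
  ext v; simp only [weighted]; ring

theorem integrable_weighted_fwdDiff {q : Vel N → ℂ} (hη : 0 ≤ η)
    (hq : Integrable (weighted η q) volume) (h : Vel N) :
    Integrable (weighted η (fwdDiff h q)) volume := by
  unfold fwdDiff
  rw [weighted_sub]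
  exact (integrable_weighted_comp_add hη hq h).sub hq

theorem integrable_weighted_fwdDiff_iter {q : Vel N → ℂ} (hη : 0 ≤ η)
    (hq : Integrable (weighted η q) volume) (h : Vel N) (j : ℕ) :
    Integrable (weighted η ((fwdDiff h)^[j] q)) volume := by
  induction j generalizing q with
  | zero => exact hq
  | succ j ih => exact ih (integrable_weighted_fwdDiff hη hq h)

theorem measurable_fwdDiff {g : Vel N → ℂ} (hg : Measurable g) (h : Vel N) :
    Measurable (fwdDiff h g) := by
  unfold fwdDiff; fun_prop

theorem norm_fwdDiff_le_of_bound {g : Vel N → ℂ} {C : ℝ} (hη : 0 ≤ η) (hC0 : 0 ≤ C)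
    (hC : ∀ v, ‖g v‖ ≤ C * bracket v ^ η) (h v : Vel N) :
    ‖fwdDiff h g v‖ ≤ (C * (1 + ‖h‖) ^ η + C) * bracket v ^ η := by
  have h2 := bracket_rpow_add_le (p := η) (abs_of_nonneg hη).le v h
  calc _ ≤ ‖g (v + h)‖ + ‖g v‖ := norm_sub_le _ _
    _ ≤ C * ((1 + ‖h‖) ^ η * bracket v ^ η) + C * bracket v ^ η := by
      gcongr
      · exact (hC _).trans (by gcongr)
      · exact hC v
    _ = _ := by ring

theorem integral_mul_fwdDiff_iter {q g : Vel N → ℂ} (hη : 0 ≤ η)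
    (hq : Integrable (weighted η q) volume) (hg : Measurable g) {C : ℝ} (hC0 : 0 ≤ C)
    (hC : ∀ v, ‖g v‖ ≤ C * bracket v ^ η) (h : Vel N) (i : ℕ) :
    ∫ v, g v * (fwdDiff h)^[i] q v = ∫ v, (fwdDiff (-h))^[i] g v * q v := by
  induction i generalizing g C with
  | zero => rfl
  | succ i ih =>
    rw [Function.iterate_succ_apply', Function.iterate_succ_apply,
      ← ih (measurable_fwdDiff hg _) (by positivity) (norm_fwdDiff_le_of_bound hη hC0 hC (-h))]
    have hi := integrable_weighted_fwdDiff_iter hη hq h i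
    set r := (fwdDiff h)^[i] q
    have h1 := integrable_mul_of_weighted hi hg hC
    have h2 := integrable_mul_of_weighted (integrable_weighted_comp_add hη hi h) hg hC
    have h3 : Integrable (fun v => g (v + -h) * r v) volume := by
      have := h2.comp_add_right (-h)
      simpa using this
    simp only [fwdDiff, mul_sub, sub_mul]
    rw [integral_sub h2 h1, integral_sub h3 h1]
    congr 1
    rw [← integral_add_right_eq_self (fun v => g (v + -h) * r v) h]
    simp

/-- The plane wave `v ↦ e^{-2πi⟨v,ξ⟩}`. -/
def planeWave (ξ v : Vel N) : ℂ := (Real.fourierChar (-(inner ℝ v ξ)) : ℂ)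

theorem norm_planeWave (ξ v : Vel N) : ‖planeWave ξ v‖ = 1 := Circle.norm_coe _

theorem measurable_planeWave (ξ : Vel N) : Measurable (planeWave ξ) :=
  measurable_fourierChar.comp (by fun_prop)

theorem fwdDiff_iter_planeWave (h ξ : Vel N) (k : ℕ) :
    (fwdDiff (-h))^[k] (planeWave ξ) = fun v => diffSymbol h ξ ^ k * planeWave ξ v := by
  induction k with
  | zero => simp
  | succ k ih =>
    rw [Function.iterate_succ_apply', ih]
    ext v
    have h1 : planeWave ξ (v + -h) = (Real.fourierChar (inner ℝ h ξ) : ℂ) * planeWave ξ v := by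
      rw [planeWave, planeWave, ← Circle.coe_mul, ← AddChar.map_add_eq_mul]
      congr 2
      rw [inner_add_left, inner_neg_left]; ring
    simp only [fwdDiff, h1, diffSymbol]
    ring

/-- Low frequencies of weighted differences, by summation by parts. -/
theorem exists_enorm_fourier_weighted_fwdDiff_le (N : ℕ) (j : ℕ) (hη : 0 ≤ η) : ∃ C : ℝ≥0,
    ∀ h : Vel N, ‖h‖ ≤ 1 → ∀ q : Vel N → ℂ, Integrable (weighted η q) volume → ∀ i ≤ j,
      ∀ ξ, ‖ξ‖ ≤ 1 → ‖𝓕 (weighted η ((fwdDiff h)^[i] q)) ξ‖ₑ ≤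
        C * ‖h‖ₑ ^ i * eLpNorm (weighted η q) 1 volume := by
  obtain ⟨C, hC⟩ := exists_norm_fwdDiff_weighted_le N j η
  refine ⟨C * ((j + 1) * (2 * NNReal.pi + 1) ^ j), fun h hh q hq i hi ξ hξ => ?_⟩
  have hpi := Real.pi_pos
  have e1 : 𝓕 (weighted η ((fwdDiff h)^[i] q)) ξ =
      ∫ v, weighted η (planeWave ξ) v * (fwdDiff h)^[i] q v := by
    rw [Real.fourier_eq]
    refine integral_congr_ae (Filter.Eventually.of_forall fun v => ?_)
    simp only [weighted, Circle.smul_def, smul_eq_mul, planeWave]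
    ring
  have hm : Measurable (weighted η (planeWave ξ)) :=
    (Complex.measurable_ofReal.comp (continuous_bracket_rpow η).measurable).mul
      (measurable_planeWave ξ)
  rw [e1, integral_mul_fwdDiff_iter hη hq hm zero_le_one (fun v => by
    rw [norm_weighted, norm_planeWave, mul_one, one_mul])]
  refine (enorm_integral_le_lintegral_enorm _).trans ?_
  rw [eLpNorm_one_eq_lintegral_enorm, ← lintegral_const_mul' _ _ (by finiteness)]
  refine lintegral_mono fun v => ?_
  have hb := bracket_pos v
  -- The differences now act on ⟨v⟩^η e^{-2πi v·ξ}. One falling on the weight costs `‖h‖`; one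
  -- falling on the plane wave costs the symbol, at most `2π‖h‖` because `‖ξ‖ ≤ 1`. The antidiagonal
  -- has at most `j + 1` terms.
  have h1 : ‖(fwdDiff (-h))^[i] (weighted η (planeWave ξ)) v‖ ≤
      C * ((j + 1) * (2 * Real.pi + 1) ^ j) * ‖h‖ ^ i * bracket v ^ η := by
    refine (hC η (abs_of_nonneg hη).le (-h) (by rwa [norm_neg]) (planeWave ξ) v i hi).trans ?_
    have h2 : ∀ ik ∈ Finset.HasAntidiagonal.antidiagonal i,
        ‖-h‖ ^ ik.1 * ‖(fwdDiff (-h))^[ik.2] (planeWave ξ) v‖ ≤ (2 * Real.pi + 1) ^ j * ‖h‖ ^ i := by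
      intro ik hik
      have hs := Finset.HasAntidiagonal.mem_antidiagonal.1 hik
      rw [fwdDiff_iter_planeWave, norm_mul, norm_planeWave, mul_one, norm_pow, norm_neg]
      have h3 : ‖diffSymbol h ξ‖ ≤ (2 * Real.pi + 1) * ‖h‖ := by
        refine (norm_diffSymbol_le h ξ).trans ?_
        nlinarith [norm_nonneg h, mul_nonneg hpi.le (norm_nonneg h),
          mul_le_mul_of_nonneg_left hξ (mul_nonneg hpi.le (norm_nonneg h))]
      calc _ ≤ ‖h‖ ^ ik.1 * ((2 * Real.pi + 1) * ‖h‖) ^ ik.2 := by gcongr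
        _ = (2 * Real.pi + 1) ^ ik.2 * (‖h‖ ^ ik.1 * ‖h‖ ^ ik.2) := by rw [mul_pow]; ring
        _ = (2 * Real.pi + 1) ^ ik.2 * ‖h‖ ^ i := by rw [← pow_add, hs]
        _ ≤ _ := by gcongr <;> linarith
    have h4 := Finset.sum_le_sum h2
    rw [Finset.sum_const, Finset.Nat.card_antidiagonal, nsmul_eq_mul] at h4
    have h5 : ((i + 1 : ℕ) : ℝ) ≤ j + 1 := by push_cast; gcongr
    calc _ ≤ C * (bracket v ^ η * ((i + 1 : ℕ) * ((2 * Real.pi + 1) ^ j * ‖h‖ ^ i))) := by gcongr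
      _ ≤ C * (bracket v ^ η * ((j + 1) * ((2 * Real.pi + 1) ^ j * ‖h‖ ^ i))) := by gcongr
      _ = _ := by ring
  have h6 : ‖(fwdDiff (-h))^[i] (weighted η (planeWave ξ)) v * q v‖ ≤
      (C * ((j + 1) * (2 * Real.pi + 1) ^ j) * ‖h‖ ^ i) * ‖weighted η q v‖ := by
    rw [norm_mul, norm_weighted, ← mul_assoc]
    gcongr
  rw [← ofReal_norm, ← ofReal_norm (weighted η q v)]
  refine (ENNReal.ofReal_le_ofReal h6).trans (le_of_eq ?_)
  rw [ENNReal.ofReal_mul (by positivity), ENNReal.ofReal_mul (by positivity), enorm_pow_eq]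
  congr 2
  rw [← ENNReal.ofReal_coe_nnreal]
  congr 1

end SummationByParts

/-! ### Trading differences for fractional derivatives -/

section Smoothing

/-- Here e = |h|, r = |ξ| and d is the modulus of the difference symbol. If er ≥ 1 the left side is
at most (2π)^j and (er)^σ ≥ 1. If er ≤ 1 it is at most (2π)^j (er)^n, and σ ≤ n. -/
theorem pow_mul_pow_le_rpow {e r d σ : ℝ} {n j : ℕ} (he : 0 ≤ e) (he1 : e ≤ 1) (hr : 1 ≤ r)
    (hd : 0 ≤ d) (hd2 : d ≤ 2) (hdr : d ≤ 2 * Real.pi * (e * r)) (hj : j ≤ n) (hσ : 0 ≤ σ)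
    (hσn : σ ≤ n) : e ^ (n - j) * d ^ j ≤ (2 * Real.pi) ^ n * (e ^ σ * r ^ σ) := by
  have hpi : (2 : ℝ) ≤ 2 * Real.pi := by linarith [Real.two_le_pi]
  have hpn : (2 * Real.pi) ^ j ≤ (2 * Real.pi) ^ n := pow_le_pow_right₀ (by linarith) hj
  rw [← Real.mul_rpow he (by linarith)]
  rcases le_total 1 (e * r) with h | h
  · calc e ^ (n - j) * d ^ j ≤ 1 * (2 * Real.pi) ^ j := by
          gcongr
          · exact pow_le_one₀ he he1
          · linarith
      _ ≤ (2 * Real.pi) ^ n * 1 := by linarith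
      _ ≤ _ := by gcongr; exact Real.one_le_rpow h hσ
  · calc e ^ (n - j) * d ^ j ≤ (e * r) ^ (n - j) * (2 * Real.pi * (e * r)) ^ j := by
          gcongr
          exact le_mul_of_one_le_right he hr
      _ = (2 * Real.pi) ^ j * (e * r) ^ n := by
          rw [mul_pow (2 * Real.pi), mul_left_comm, ← pow_add, Nat.sub_add_cancel hj]
      _ ≤ _ := by
          gcongr
          rw [← Real.rpow_natCast]
          exact Real.rpow_le_rpow_of_exponent_ge' (by positivity) h hσ hσn

variable {η : ℝ}

/-- Plancherel, with frequencies split at |ξ| = 1. Above it, `N` factors, each `‖h‖` or a symbol,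
are traded for |h|^σ |ξ|^σ. Below it, summation by parts keeps all `N + i` powers of `‖h‖` against
the L¹ norm. -/
theorem exists_pow_mul_eLpNorm_fwdDiff_le (N b : ℕ) (hη : 0 ≤ η) {σ : ℝ} (hσ : 0 ≤ σ)
    (hσN : σ ≤ N) : ∃ C : ℝ≥0, ∀ h : Vel N, ‖h‖ ≤ 1 → ∀ q : Vel N → ℂ,
      Integrable (weighted η q) volume → ∀ i ≤ b, ∀ j ≤ N,
        ‖h‖ₑ ^ (N - j) * eLpNorm ((fwdDiff h)^[j] (weighted η ((fwdDiff h)^[i] q))) 2 volume ≤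
          C * (‖h‖ₑ ^ (N + i) * eLpNorm (weighted η q) 1 volume +
            ENNReal.ofReal (‖h‖ ^ σ) * eLpNorm (fun ξ => ((‖ξ‖ ^ σ : ℝ) : ℂ) *
              𝓕 (weighted η ((fwdDiff h)^[i] q)) ξ) 2 volume) := by
  obtain ⟨C, hC⟩ := exists_enorm_fourier_weighted_fwdDiff_le N b hη
  set V : ℝ≥0∞ := volume (Metric.closedBall (0 : Vel N) 1) ^ (1 / 2 : ℝ) with hV
  have hVt : V ≠ ∞ :=
    ENNReal.rpow_ne_top_of_nonneg (by norm_num) measure_closedBall_lt_top.ne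
  refine ⟨(2 * NNReal.pi) ^ N * (C * V.toNNReal + 1), fun h hh q hq i hi j hj => ?_⟩
  have hpi := Real.pi_pos
  set u := weighted η ((fwdDiff h)^[i] q) with hu
  have hui : Integrable u volume := integrable_weighted_fwdDiff_iter hη hq h i
  set e := ‖h‖ with he
  have he0 : 0 ≤ e := norm_nonneg h
  set A := eLpNorm (weighted η q) 1 volume with hA
  have hAt : A ≠ ∞ := (memLp_one_iff_integrable.2 hq).eLpNorm_ne_top
  set K : ℝ := C * e ^ i * A.toReal with hK
  have hK0 : 0 ≤ K := by positivity
  have hlow : ∀ ξ, ‖ξ‖ ≤ 1 → ‖𝓕 u ξ‖ ≤ K := fun ξ hξ => by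
    have h1 := hC h hh q hq i hi ξ hξ
    have h2 := ENNReal.toReal_mono (by finiteness) h1
    simpa [hK, ENNReal.toReal_mul, he] using h2
  -- The index `true` stands for the fractional derivative (|ξ| ≥ 1), `false` for the constant `K`
  -- on the unit ball (|ξ| ≤ 1).
  have key : ∀ ξ, ‖((e ^ (N - j) : ℝ) : ℂ) * (diffSymbol h ξ ^ j * 𝓕 u ξ)‖ ≤
      ((1 : ℝ≥0) : ℝ) * ∑ t : Bool, (bif t then (2 * Real.pi) ^ N * e ^ σ else (2 * Real.pi) ^ N * e ^ N) *
        ‖(bif t then (fun ξ => ((‖ξ‖ ^ σ : ℝ) : ℂ) * 𝓕 u ξ) else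
          (Metric.closedBall (0 : Vel N) 1).indicator fun _ => (K : ℂ) : Vel N → ℂ) ξ‖ := by
    intro ξ
    rw [NNReal.coe_one, one_mul, Fintype.sum_bool, norm_mul, norm_mul, norm_pow, Complex.norm_real,
      Real.norm_of_nonneg (by positivity)]
    simp only [cond_true, cond_false]
    have hd := norm_diffSymbol_le h ξ
    rcases le_total ‖ξ‖ 1 with hξ | hξ
    · refine le_add_of_nonneg_of_le (by positivity) ?_
      rw [Set.indicator_of_mem (by simpa using hξ), Complex.norm_real, Real.norm_of_nonneg hK0]
      have h1 : ‖diffSymbol h ξ‖ ≤ 2 * Real.pi * e := by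
        refine hd.trans ?_
        gcongr
        exact mul_le_of_le_one_right he0 hξ
      have h2 : (2 * Real.pi) ^ j ≤ (2 * Real.pi) ^ N :=
        pow_le_pow_right₀ (by linarith [Real.two_le_pi]) hj
      calc _ ≤ e ^ (N - j) * ((2 * Real.pi * e) ^ j * K) := by gcongr; exact hlow ξ hξ
        _ = (2 * Real.pi) ^ j * (e ^ (N - j) * e ^ j) * K := by rw [mul_pow]; ring
        _ = (2 * Real.pi) ^ j * e ^ N * K := by rw [← pow_add, Nat.sub_add_cancel hj]
        _ ≤ _ := by gcongr
    · refine le_add_of_le_of_nonneg ?_ (by positivity)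
      rw [norm_mul, Complex.norm_real, Real.norm_of_nonneg (by positivity), ← mul_assoc, ← mul_assoc,
        mul_assoc (_ ^ N)]
      exact mul_le_mul_of_nonneg_right (pow_mul_pow_le_rpow he0 hh hξ (norm_nonneg _)
        (norm_diffSymbol_le_two h ξ) hd hj hσ hσN) (norm_nonneg _)
  have hmeas : ∀ t : Bool, AEStronglyMeasurable (bif t then (fun ξ => ((‖ξ‖ ^ σ : ℝ) : ℂ) * 𝓕 u ξ) else
          (Metric.closedBall (0 : Vel N) 1).indicator fun _ => (K : ℂ) : Vel N → ℂ) volume := by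
    rintro (_ | _)
    · exact aestronglyMeasurable_const.indicator measurableSet_closedBall
    · refine (Measurable.aestronglyMeasurable ?_).mul (continuous_fourier hui).aestronglyMeasurable
      exact Complex.measurable_ofReal.comp (measurable_norm.pow_const σ)
  have h3 := eLpNorm_le_sum (μ := (volume : Measure (Vel N))) (p := 2) (by norm_num) Finset.univ
    (c := fun t : Bool => bif t then (2 * Real.pi) ^ N * e ^ σ else (2 * Real.pi) ^ N * e ^ N)
    (by rintro (_ | _) - <;> simp only [cond_true, cond_false] <;> positivity)
    (fun t _ => hmeas t) 1 key
  have h4 : ‖h‖ₑ ^ (N - j) * eLpNorm ((fwdDiff h)^[j] u) 2 volume =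
      eLpNorm (fun ξ => ((e ^ (N - j) : ℝ) : ℂ) * (diffSymbol h ξ ^ j * 𝓕 u ξ)) 2 volume := by
    rw [← eLpNorm_fourier_eq (integrable_fwdDiff_iter hui h j), ← enorm_pow_eq]
    have : (fun ξ => ((e ^ (N - j) : ℝ) : ℂ) * (diffSymbol h ξ ^ j * 𝓕 u ξ)) =
        ((e ^ (N - j) : ℝ) : ℂ) • 𝓕 ((fwdDiff h)^[j] u) := by
      ext ξ
      rw [Pi.smul_apply, smul_eq_mul, fourier_fwdDiff_iter hui]
    rw [this, eLpNorm_const_smul, enorm_ofReal, Real.enorm_of_nonneg (by positivity)]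
  have h5 : eLpNorm ((Metric.closedBall (0 : Vel N) 1).indicator fun _ => (K : ℂ)) 2 volume =
      C * ‖h‖ₑ ^ i * A * V := by
    rw [eLpNorm_indicator_const measurableSet_closedBall (by norm_num) (by norm_num), hV, enorm_ofReal,
      Real.enorm_of_nonneg hK0, hK, ENNReal.ofReal_mul (by positivity),
      ENNReal.ofReal_mul (by positivity), enorm_pow_eq, ENNReal.ofReal_toReal hAt,
      ENNReal.ofReal_coe_nnreal]
    norm_num
  have h6 : ENNReal.ofReal ((2 * Real.pi) ^ N) = ((2 * NNReal.pi) ^ N : ℝ≥0) := by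
    rw [← ENNReal.ofReal_coe_nnreal]; simp
  rw [h4]
  refine h3.trans ?_
  rw [Fintype.sum_bool]
  simp only [cond_true, cond_false]
  rw [h5, ENNReal.ofReal_mul (by positivity), ENNReal.ofReal_mul (by positivity), h6,
    enorm_pow_eq, ENNReal.coe_mul, ENNReal.coe_add, ENNReal.coe_mul, ENNReal.coe_toNNReal hVt]
  set Z := eLpNorm (fun ξ => ((‖ξ‖ ^ σ : ℝ) : ℂ) * 𝓕 u ξ) 2 volume
  set Q := (((2 * NNReal.pi) ^ N : ℝ≥0) : ℝ≥0∞)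
  calc _ = Q * (C * V * (‖h‖ₑ ^ (N + i) * A) + 1 * (ENNReal.ofReal (e ^ σ) * Z)) := by
        rw [ENNReal.coe_one, pow_add]; ring
    _ ≤ Q * ((C * V + 1) * (‖h‖ₑ ^ (N + i) * A) + (C * V + 1) * (ENNReal.ofReal (e ^ σ) * Z)) := by
        gcongr
        · exact le_self_add
        · exact le_add_self
    _ = _ := by rw [ENNReal.coe_one]; ring

/-- Differences of order `N + b` of a weighted function, in terms of a fractional derivative of
order `σ ≤ N` of weighted differences of order at most `b`. -/
theorem exists_eLpNorm_fwdDiff_le (N b : ℕ) (hη : 0 ≤ η) {σ : ℝ} (hσ : 0 ≤ σ)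
    (hσN : σ ≤ N) : ∃ C : ℝ≥0, ∀ h : Vel N, ‖h‖ ≤ 1 → ∀ q : Vel N → ℂ,
      Integrable (weighted η q) volume →
        eLpNorm ((fwdDiff h)^[N + b] (weighted η q)) 2 volume ≤
          C * (‖h‖ₑ ^ (N + b) * eLpNorm (weighted η q) 1 volume +
            ENNReal.ofReal (‖h‖ ^ σ) * ∑ i ∈ Finset.range (b + 1), ‖h‖ₑ ^ (b - i) *
              eLpNorm (fun ξ => ((‖ξ‖ ^ σ : ℝ) : ℂ) *
              𝓕 (weighted η ((fwdDiff h)^[i] q)) ξ) 2 volume) := by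
  obtain ⟨C₁, hC₁⟩ := exists_eLpNorm_fwdDiff_weighted_le N (N + b) η
  obtain ⟨C₂, hC₂⟩ := exists_eLpNorm_weighted_fwdDiff_le N N η
  obtain ⟨C₃, hC₃⟩ := exists_pow_mul_eLpNorm_fwdDiff_le N b hη hσ hσN
  refine ⟨C₁ * ((N + b + 1 : ℕ) * (C₂ * ((N + 1 : ℕ) * C₃))), fun h hh q hq => ?_⟩
  have hqm := aestronglyMeasurable_of_weighted hq.1
  set A := eLpNorm (weighted η q) 1 volume
  set Z : ℕ → ℝ≥0∞ := fun i => eLpNorm (fun ξ => ((‖ξ‖ ^ σ : ℝ) : ℂ) *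
              𝓕 (weighted η ((fwdDiff h)^[i] q)) ξ) 2 volume with hZ
  set R := ‖h‖ₑ ^ (N + b) * A +
    ENNReal.ofReal (‖h‖ ^ σ) * ∑ i ∈ Finset.range (b + 1), ‖h‖ₑ ^ (b - i) * Z i with hR
  have hηa : |η| ≤ η := (abs_of_nonneg hη).le
  have step : ∀ k ≤ N + b, ‖h‖ₑ ^ (N + b - k) * eLpNorm (weighted η ((fwdDiff h)^[k] q)) 2 volume ≤
      C₂ * ((N + 1 : ℕ) * C₃) * R := by
    intro k hk
    -- At most `b` differences stay inside the weight, later to act on the tensor. The other `k - i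
    -- ≤ N` are moved outside the weight and spent on smoothing.
    set i := min k b with hi
    have hib : i ≤ b := min_le_right _ _
    have hik : i ≤ k := min_le_left _ _
    have haN : k - i ≤ N := by omega
    have e1 : (fwdDiff h)^[k] q = (fwdDiff h)^[k - i] ((fwdDiff h)^[i] q) := by
      rw [← Function.iterate_add_apply, Nat.sub_add_cancel hik]
    rw [e1]
    have h2 := hC₂ η hηa h hh _ (aestronglyMeasurable_fwdDiff_iter hqm h i) (k - i) haN
    calc _ ≤ ‖h‖ₑ ^ (N + b - k) * (C₂ * ∑ ij ∈ Finset.HasAntidiagonal.antidiagonal (k - i),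
          ‖h‖ₑ ^ ij.1 * eLpNorm ((fwdDiff h)^[ij.2] (weighted η ((fwdDiff h)^[i] q))) 2 volume) := by
          gcongr
      _ = C₂ * ∑ ij ∈ Finset.HasAntidiagonal.antidiagonal (k - i), ‖h‖ₑ ^ (N + b - k) *
          (‖h‖ₑ ^ ij.1 * eLpNorm ((fwdDiff h)^[ij.2] (weighted η ((fwdDiff h)^[i] q))) 2 volume) := by
          rw [mul_left_comm, Finset.mul_sum]
      _ ≤ C₂ * ∑ ij ∈ Finset.HasAntidiagonal.antidiagonal (k - i), C₃ * R := by
          refine mul_le_mul_right (Finset.sum_le_sum fun ij hij => ?_) _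
          have hs := Finset.HasAntidiagonal.mem_antidiagonal.1 hij
          have h3 := hC₃ h hh q hq i hib ij.2 (by omega)
          have e2 : ‖h‖ₑ ^ (N + b - k) * ‖h‖ₑ ^ ij.1 = ‖h‖ₑ ^ (b - i) * ‖h‖ₑ ^ (N - ij.2) := by
            rw [← pow_add, ← pow_add]; congr 1; omega
          rw [← mul_assoc, e2, mul_assoc]
          refine (mul_le_mul_right h3 _).trans ?_
          have e3 : ‖h‖ₑ ^ (b - i) * ‖h‖ₑ ^ (N + i) = ‖h‖ₑ ^ (N + b) := by
            rw [← pow_add]; congr 1; omega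
          rw [mul_left_comm, mul_add, ← mul_assoc (‖h‖ₑ ^ (b - i)), e3,
            mul_left_comm _ (ENNReal.ofReal _)]
          refine mul_le_mul_right (add_le_add_right (mul_le_mul_right ?_ _) _) _
          exact Finset.single_le_sum (f := fun i => ‖h‖ₑ ^ (b - i) * Z i) (fun _ _ => zero_le)
            (Finset.mem_range.2 (Order.lt_add_one_iff.2 hib))
      _ ≤ C₂ * ((N + 1 : ℕ) * (C₃ * R)) := by
          rw [Finset.sum_const, Finset.Nat.card_antidiagonal, nsmul_eq_mul]
          gcongr
      _ = _ := by ring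
  refine (hC₁ η hηa h hh q hqm (N + b) le_rfl).trans ?_
  calc _ ≤ C₁ * ∑ ij ∈ Finset.HasAntidiagonal.antidiagonal (N + b), C₂ * ((N + 1 : ℕ) * C₃) * R := by
        refine mul_le_mul_right (Finset.sum_le_sum fun ij hij => ?_) _
        have hs := Finset.HasAntidiagonal.mem_antidiagonal.1 hij
        have := step ij.2 (by omega)
        rwa [show N + b - ij.2 = ij.1 by omega] at this
    _ = _ := by
        rw [Finset.sum_const, Finset.Nat.card_antidiagonal, nsmul_eq_mul]
        push_cast
        ring

end Smoothing

/-! ### Translation invariance of the gain operator -/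

section Differences

variable {N : ℕ} [NeZero N] {η : ℝ} {b : ℝ → ℝ} {H : Vel N → Vel N → ℂ}

theorem energyWeight_add_le (x h w : Vel N) :
    energyWeight (x + h) w ≤ (1 + ‖h‖) * energyWeight x w := by
  refine Real.sqrt_le_iff.2 ⟨by have := energyWeight_pos x w; positivity, ?_⟩
  rw [mul_pow, energyWeight_sq]
  have h1 := norm_add_le x h
  have h2 : ‖x + h‖ ^ 2 ≤ (‖x‖ + ‖h‖) ^ 2 := by gcongr
  have h3 := mul_nonneg (norm_nonneg h) (sq_nonneg (‖x‖ - 1))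
  have h4 := mul_nonneg (sq_nonneg ‖h‖) (sq_nonneg ‖x‖)
  have h5 := mul_nonneg (norm_nonneg h) (sq_nonneg ‖w‖)
  have h6 := mul_nonneg (sq_nonneg ‖h‖) (sq_nonneg ‖w‖)
  nlinarith [norm_nonneg h, norm_nonneg x]

theorem measurable_comp_add_left (hH : Measurable fun p : Vel N × Vel N => H p.1 p.2) (h : Vel N) :
    Measurable fun p : Vel N × Vel N => H (p.1 + h) p.2 := by
  have h1 : Measurable fun p : Vel N × Vel N => (p.1 + h, p.2) := by fun_prop
  have h2 := hH.comp h1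
  exact h2

theorem measurable_fwdDiff_iter_left (hH : Measurable fun p : Vel N × Vel N => H p.1 p.2)
    (h : Vel N) (j : ℕ) : Measurable fun p : Vel N × Vel N => (fwdDiff h)^[j] H p.1 p.2 := by
  induction j generalizing H with
  | zero => exact hH
  | succ j ih => exact ih (H := fwdDiff h H) ((measurable_comp_add_left hH h).sub hH)

theorem measurePreserving_add_fst (h : Vel N) :
    MeasurePreserving (fun p : Vel N × Vel N => (p.1 + h, p.2)) (volume.prod volume)
      (volume.prod volume) :=
  (measurePreserving_add_right volume h).prod (MeasurePreserving.id _)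

theorem integrable_energyWeight_comp_add (hη : 0 ≤ η)
    (hH : Measurable fun p : Vel N × Vel N => H p.1 p.2)
    (hI : Integrable (fun p : Vel N × Vel N => ((energyWeight p.1 p.2 ^ η : ℝ) : ℂ) * H p.1 p.2)
      (volume.prod volume)) (h : Vel N) :
    Integrable (fun p : Vel N × Vel N => ((energyWeight p.1 p.2 ^ η : ℝ) : ℂ) * H (p.1 + h) p.2)
      (volume.prod volume) := by
  have h1 := ((measurePreserving_add_fst h).integrable_comp
    (measurable_energyWeight_mul hH).aestronglyMeasurable).2 hI
  have hm := measurable_energyWeight_mul (η := η) (H := fun x w => H (x + h) w)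
    (measurable_comp_add_left hH h)
  refine (h1.norm.const_mul ((1 + ‖-h‖) ^ η)).mono' hm.aestronglyMeasurable
    (Filter.Eventually.of_forall fun p => ?_)
  have hp := energyWeight_pos p.1 p.2
  have hp' := energyWeight_pos (p.1 + h) p.2
  have h2 := energyWeight_add_le (p.1 + h) (-h) p.2
  rw [add_neg_cancel_right] at h2
  simp only [Function.comp_apply, norm_mul, Complex.norm_real]
  rw [Real.norm_of_nonneg (by positivity), Real.norm_of_nonneg (by positivity), ← mul_assoc,
    ← Real.mul_rpow (by positivity) hp'.le]
  gcongr

theorem integrable_energyWeight_fwdDiff_iter (hη : 0 ≤ η)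
    (hH : Measurable fun p : Vel N × Vel N => H p.1 p.2)
    (hI : Integrable (fun p : Vel N × Vel N => ((energyWeight p.1 p.2 ^ η : ℝ) : ℂ) * H p.1 p.2)
      (volume.prod volume)) (h : Vel N) (j : ℕ) :
    Integrable (fun p : Vel N × Vel N => ((energyWeight p.1 p.2 ^ η : ℝ) : ℂ) *
      (fwdDiff h)^[j] H p.1 p.2) (volume.prod volume) := by
  induction j generalizing H with
  | zero => exact hI
  | succ j ih =>
    refine ih (H := fwdDiff h H) ((measurable_comp_add_left hH h).sub hH) ?_
    have := (integrable_energyWeight_comp_add hη hH hI h).sub hI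
    refine this.congr (Filter.Eventually.of_forall fun p => ?_)
    simp only [fwdDiff, Pi.sub_apply, mul_sub]

theorem collisionIntegrand_comp_add (h v : Vel N) (p : Vel N × Sph N) :
    collisionIntegrand b (fun x w => H (x + h) w) v p =
      collisionIntegrand b H (v + h) (p.1 + h, p.2) := by
  have e1 : v + h - (p.1 + h) = v - p.1 := by abel
  have e2 : (1 / 2 : ℝ) • (v + h + (p.1 + h)) = (1 / 2 : ℝ) • (v + p.1) + h := by module
  simp only [collisionIntegrand, cosDev, e1, e2]

theorem collisionOp_comp_add (h v : Vel N) :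
    collisionOp b (fun x w => H (x + h) w) v = collisionOp b H (v + h) := by
  have hmp : MeasurePreserving (fun p : Vel N × Sph N => (p.1 + h, p.2))
      (volume.prod (surfaceMeasure N)) (volume.prod (surfaceMeasure N)) :=
    (measurePreserving_add_right volume h).prod (MeasurePreserving.id _)
  have he : MeasurableEmbedding fun p : Vel N × Sph N => (p.1 + h, p.2) :=
    (measurableEmbedding_addRight h).prodMap MeasurableEmbedding.id
  simp only [collisionOp, collisionIntegrand_comp_add]
  exact hmp.integral_comp he fun p => collisionIntegrand b H (v + h) p

theorem ae_comp_add {P : Vel N → Prop} (hP : ∀ᵐ v, P v) (h : Vel N) : ∀ᵐ v, P (v + h) :=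
  (measurePreserving_add_right volume h).quasiMeasurePreserving.ae hP

theorem fwdDiff_ae_congr {u v : Vel N → ℂ} (huv : u =ᵐ[volume] v) (h : Vel N) (j : ℕ) :
    (fwdDiff h)^[j] u =ᵐ[volume] (fwdDiff h)^[j] v := by
  induction j generalizing u v with
  | zero => exact huv
  | succ j ih =>
    refine ih ?_
    filter_upwards [huv, ae_comp_add huv h] with x h1 h2
    simp only [fwdDiff, h1, h2]

/-- Translating `v` translates the centre of mass and leaves relative velocities unchanged. For the
gain tensor this means that the merely Hölder factor Φ(|w|) is never differenced. The identity needs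
convergence of the integral at both `v` and `v + h`, which holds almost everywhere. -/
theorem collisionOp_fwdDiff_ae
    (hi : ∀ᵐ v, Integrable (collisionIntegrand b H v) (volume.prod (surfaceMeasure N))) (h : Vel N) :
    collisionOp b (fwdDiff h H) =ᵐ[volume] fwdDiff h (collisionOp b H) := by
  have hmp : MeasurePreserving (fun p : Vel N × Sph N => (p.1 + h, p.2))
      (volume.prod (surfaceMeasure N)) (volume.prod (surfaceMeasure N)) :=
    (measurePreserving_add_right volume h).prod (MeasurePreserving.id _)
  filter_upwards [hi, ae_comp_add hi h] with v h1 h2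
  have h3 : Integrable (collisionIntegrand b (fun x w => H (x + h) w) v)
      (volume.prod (surfaceMeasure N)) := by
    have := (hmp.integrable_comp h2.aestronglyMeasurable).2 h2
    refine this.congr (Filter.Eventually.of_forall fun p => ?_)
    exact (collisionIntegrand_comp_add h v p).symm
  rw [fwdDiff, ← collisionOp_comp_add, collisionOp, collisionOp, collisionOp, ← integral_sub h3 h1]
  refine integral_congr_ae (Filter.Eventually.of_forall fun p => ?_)
  simp only [collisionIntegrand, fwdDiff, Pi.sub_apply, mul_sub]

theorem collisionOp_fwdDiff_iter_ae {B : ℝ≥0∞} (hη : 0 ≤ η) (hb : Measurable b)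
    (hBt : B ≠ ∞) (hB : ∀ e : Sph N,
      ∫⁻ ω : Sph N, ENNReal.ofReal (b (inner ℝ (ω : Vel N) e) ^ 2) ∂surfaceMeasure N ≤ B)
    (hH : Measurable fun p : Vel N × Vel N => H p.1 p.2)
    (hI : Integrable (fun p : Vel N × Vel N => ((energyWeight p.1 p.2 ^ η : ℝ) : ℂ) * H p.1 p.2)
      (volume.prod volume)) (h : Vel N) (j : ℕ) :
    collisionOp b ((fwdDiff h)^[j] H) =ᵐ[volume] (fwdDiff h)^[j] (collisionOp b H) := by
  induction j with
  | zero => rfl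
  | succ j ih =>
    rw [Function.iterate_succ_apply', Function.iterate_succ_apply']
    refine (collisionOp_fwdDiff_ae (ae_integrable_collisionIntegrand
      (integrable_weightedIntegrand hη hb hBt hB (measurable_fwdDiff_iter_left hH h j)
        (integrable_energyWeight_fwdDiff_iter hη hH hI h j))) h).trans ?_
    exact fwdDiff_ae_congr ih h 1

end Differences

/-! ### Weighted bounds for the tensor of g and f -/

section Tensor

variable {N : ℕ}

/-- The tensorised argument of the gain operator, in terms of the centre of mass and of the
pre-collisional relative velocity. -/
def gainTensor (Φ : ℝ≥0 → ℝ) (g f : Vel N → ℂ) (x w : Vel N) : ℂ :=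
  (Φ ‖w‖₊ : ℂ) * (g (x - (1 / 2 : ℝ) • w) * f (x + (1 / 2 : ℝ) • w))

theorem gainIntegrand_eq (Φ : ℝ≥0 → ℝ) (b : ℝ → ℝ) (g f : Vel N → ℂ) (v : Vel N) :
    gainIntegrand Φ b g f v = collisionIntegrand b (gainTensor Φ g f) v := by
  ext p
  have e : ‖‖v - p.1‖ • (p.2 : Vel N)‖₊ = ‖v - p.1‖₊ := by
    rw [← NNReal.coe_inj, coe_nnnorm, coe_nnnorm, norm_smul, norm_eq_of_mem_sphere, norm_norm, mul_one]
  rw [gainIntegrand, collisionIntegrand, gainTensor, e, vPrime, vPrimeStar, smul_smul,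
    one_div_mul_eq_div]
  push_cast
  ring

theorem gain_eq (Φ : ℝ≥0 → ℝ) (b : ℝ → ℝ) (g f : Vel N → ℂ) :
    gain Φ b g f = collisionOp b (gainTensor Φ g f) := by
  ext v
  rw [gain, gainIntegrand_eq, collisionOp]

theorem measurable_gainTensor {Φ : ℝ≥0 → ℝ} (hΦ : Measurable Φ) {g f : Vel N → ℂ}
    (hg : Measurable g) (hf : Measurable f) :
    Measurable fun p : Vel N × Vel N => gainTensor Φ g f p.1 p.2 := by
  unfold gainTensor
  refine Measurable.mul (Complex.measurable_ofReal.comp (hΦ.comp (by fun_prop)))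
    (Measurable.mul (hg.comp (by fun_prop)) (hf.comp (by fun_prop)))

/-- By the parallelogram law the product of the squared brackets is at least 1 + |x - w/2|² + |x +
w/2|² = 1 + 2|x|² + |w|²/2. -/
theorem energyWeight_le_mul (x w : Vel N) : energyWeight x w ≤
    bracket (x - (1 / 2 : ℝ) • w) * bracket (x + (1 / 2 : ℝ) • w) := by
  have h1 := bracket_pos (x - (1 / 2 : ℝ) • w)
  have h2 := bracket_pos (x + (1 / 2 : ℝ) • w)
  refine Real.sqrt_le_iff.2 ⟨by positivity, ?_⟩
  rw [mul_pow, bracket_sq, bracket_sq]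
  have h3 := parallelogram_law_with_norm ℝ x ((1 / 2 : ℝ) • w)
  have h4 : ‖(1 / 2 : ℝ) • w‖ = ‖w‖ / 2 := by rw [norm_smul]; norm_num; ring
  rw [h4] at h3
  have h5 : 0 ≤ ‖x - (1 / 2 : ℝ) • w‖ ^ 2 * ‖x + (1 / 2 : ℝ) • w‖ ^ 2 := by positivity
  nlinarith [sq_nonneg ‖x‖, sq_nonneg ‖w‖]

theorem bracket_le_two_mul (x w : Vel N) : bracket w ≤
    2 * (bracket (x - (1 / 2 : ℝ) • w) * bracket (x + (1 / 2 : ℝ) • w)) := by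
  have h1 := energyWeight_le_mul x w
  have h2 : bracket w ≤ 2 * energyWeight x w := by
    have h3 := energyWeight_pos x w
    refine Real.sqrt_le_iff.2 ⟨by positivity, ?_⟩
    rw [mul_pow, energyWeight_sq]
    nlinarith [sq_nonneg ‖x‖]
  linarith

theorem abs_le_of_memHolder {γ : ℝ≥0} {Φ : ℝ≥0 → ℝ} (h0 : Φ 0 = 0) (h : MemHolder γ Φ) (r : ℝ≥0) :
    |Φ r| ≤ nnHolderNorm γ Φ * (r : ℝ) ^ (γ : ℝ) := by
  have h1 := h.holderWith.dist_le r 0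
  rw [h0, Real.dist_eq, sub_zero] at h1
  simpa [NNReal.dist_eq] using h1

theorem energyWeight_rpow_mul_abs_le {η : ℝ} (hη : 0 ≤ η) {γ : ℝ≥0} (hγ : γ ≤ 2) {Φ : ℝ≥0 → ℝ}
    (h0 : Φ 0 = 0) (h : MemHolder γ Φ) (x w : Vel N) :
    energyWeight x w ^ η * |Φ ‖w‖₊| ≤ 4 * nnHolderNorm γ Φ *
      (bracket (x - (1 / 2 : ℝ) • w) ^ (η + γ) * bracket (x + (1 / 2 : ℝ) • w) ^ (η + γ)) := by
  have hc := bracket_pos (x - (1 / 2 : ℝ) • w)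
  have ha := bracket_pos (x + (1 / 2 : ℝ) • w)
  have hl := energyWeight_pos x w
  have h1 := energyWeight_le_mul x w
  have h2 := bracket_le_two_mul x w
  rw [← Real.mul_rpow hc.le ha.le]
  set t := bracket (x - (1 / 2 : ℝ) • w) * bracket (x + (1 / 2 : ℝ) • w)
  have ht : 0 < t := by positivity
  have h3 : |Φ ‖w‖₊| ≤ nnHolderNorm γ Φ * (4 * t ^ (γ : ℝ)) := by
    refine (abs_le_of_memHolder h0 h _).trans ?_
    gcongr
    calc (‖w‖ : ℝ) ^ (γ : ℝ) ≤ (2 * t) ^ (γ : ℝ) := by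
          gcongr
          exact (norm_le_bracket w).trans h2
      _ = 2 ^ (γ : ℝ) * t ^ (γ : ℝ) := Real.mul_rpow (by norm_num) ht.le
      _ ≤ 4 * t ^ (γ : ℝ) := by
          gcongr
          calc (2 : ℝ) ^ (γ : ℝ) ≤ 2 ^ (2 : ℝ) :=
                Real.rpow_le_rpow_of_exponent_le (by norm_num) (by exact_mod_cast hγ)
            _ = 4 := by norm_num
  calc _ ≤ t ^ η * (nnHolderNorm γ Φ * (4 * t ^ (γ : ℝ))) := by gcongr
    _ = _ := by rw [Real.rpow_add ht]; ring

/-- The factor ⟨w⟩ left by Cauchy–Schwarz in `w` costs one more unit of weight: hence η + γ + 1 in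
the Sobolev norms against η + γ in the L¹ norms. -/
theorem bracket_mul_energyWeight_rpow_mul_abs_le {η : ℝ} (hη : 0 ≤ η) {γ : ℝ≥0} (hγ : γ ≤ 2)
    {Φ : ℝ≥0 → ℝ} (h0 : Φ 0 = 0) (h : MemHolder γ Φ) (x w : Vel N) :
    bracket w * energyWeight x w ^ η * |Φ ‖w‖₊| ≤ 8 * nnHolderNorm γ Φ *
      (bracket (x - (1 / 2 : ℝ) • w) ^ (η + γ + 1) * bracket (x + (1 / 2 : ℝ) • w) ^ (η + γ + 1)) := by
  have hc := bracket_pos (x - (1 / 2 : ℝ) • w)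
  have ha := bracket_pos (x + (1 / 2 : ℝ) • w)
  have hw := bracket_pos w
  have hl := energyWeight_pos x w
  have h1 := energyWeight_rpow_mul_abs_le hη hγ h0 h x w
  have h2 := bracket_le_two_mul x w
  rw [Real.rpow_add_one hc.ne', Real.rpow_add_one ha.ne', mul_assoc]
  calc _ ≤ 2 * (bracket (x - (1 / 2 : ℝ) • w) * bracket (x + (1 / 2 : ℝ) • w)) * _ :=
        mul_le_mul h2 h1 (by positivity) (by positivity)
    _ = _ := by ring

theorem measurable_centre_mul {A A' : Vel N → ℂ} (hA : Measurable A) (hA' : Measurable A') :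
    Measurable fun q : Vel N × Vel N =>
      A (q.1 - (1 / 2 : ℝ) • q.2) * A' (q.1 + (1 / 2 : ℝ) • q.2) := by
  fun_prop

theorem eLpNorm_centre_mul {A A' : Vel N → ℂ} (hA : Measurable A) (hA' : Measurable A') {p : ℝ≥0∞}
    (hp0 : p ≠ 0) (hpt : p ≠ ∞) :
    eLpNorm (fun q : Vel N × Vel N => A (q.1 - (1 / 2 : ℝ) • q.2) * A' (q.1 + (1 / 2 : ℝ) • q.2)) p
      (volume.prod volume) = eLpNorm A p volume * eLpNorm A' p volume := by
  have hm : Measurable fun q : Vel N × Vel N => A q.2 * A' q.1 :=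
    (hA.comp measurable_snd).mul (hA'.comp measurable_fst)
  have h1 := eLpNorm_comp_measurePreserving (p := p) hm.aestronglyMeasurable
    (measurePreserving_centre (N := N))
  have h2 : ((fun q : Vel N × Vel N => A q.2 * A' q.1) ∘
      fun p : Vel N × Vel N => (p.1 + (1 / 2 : ℝ) • p.2, p.1 - (1 / 2 : ℝ) • p.2)) =
      fun q : Vel N × Vel N => A (q.1 - (1 / 2 : ℝ) • q.2) * A' (q.1 + (1 / 2 : ℝ) • q.2) := rfl
  rw [h2] at h1
  have hp : 0 ≤ p.toReal := ENNReal.toReal_nonneg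
  rw [h1, eLpNorm_eq_lintegral_rpow_enorm_toReal hp0 hpt,
    eLpNorm_eq_lintegral_rpow_enorm_toReal hp0 hpt, eLpNorm_eq_lintegral_rpow_enorm_toReal hp0 hpt]
  simp only [enorm_mul, ENNReal.mul_rpow_of_nonneg _ _ hp, mul_comm ‖A _‖ₑ _]
  rw [lintegral_prod_mul (f := fun x => ‖A' x‖ₑ ^ p.toReal) (g := fun x => ‖A x‖ₑ ^ p.toReal)
    (hA'.enorm.pow_const _).aemeasurable (hA.enorm.pow_const _).aemeasurable,
    ENNReal.mul_rpow_of_nonneg _ _ (by positivity), mul_comm]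

theorem fwdDiff_iter_apply_apply (h : Vel N) (j : ℕ) (H : Vel N → Vel N → ℂ) (x w : Vel N) :
    (fwdDiff h)^[j] H x w = (fwdDiff h)^[j] (fun x => H x w) x := by
  induction j generalizing H with
  | zero => rfl
  | succ j ih => exact ih (fwdDiff h H)

theorem measurable_fwdDiff_iter {g : Vel N → ℂ} (hg : Measurable g) (h : Vel N) (j : ℕ) :
    Measurable ((fwdDiff h)^[j] g) := by
  induction j generalizing g with
  | zero => exact hg
  | succ j ih => exact ih (measurable_fwdDiff hg h)

theorem measurable_weighted {g : Vel N → ℂ} (hg : Measurable g) (p : ℝ) :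
    Measurable (weighted p g) :=
  (Complex.measurable_ofReal.comp (continuous_bracket_rpow p).measurable).mul hg

theorem norm_fwdDiff_iter_gainTensor_le (Φ : ℝ≥0 → ℝ) (g f : Vel N → ℂ) (h : Vel N) (j : ℕ)
    (x w : Vel N) : ‖(fwdDiff h)^[j] (gainTensor Φ g f) x w‖ ≤ |Φ ‖w‖₊| * (2 ^ j *
      ∑ ik ∈ Finset.HasAntidiagonal.antidiagonal j,
        ‖(fwdDiff h)^[ik.1] g (x - (1 / 2 : ℝ) • w + ik.2 • h)‖ *
        ‖(fwdDiff h)^[ik.2] f (x + (1 / 2 : ℝ) • w)‖) := by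
  have e : (fun x => gainTensor Φ g f x w) =
      (Φ ‖w‖₊ : ℂ) • fun x => g (x + -((1 / 2 : ℝ) • w)) * f (x + (1 / 2 : ℝ) • w) := by
    ext x; simp only [gainTensor, Pi.smul_apply, smul_eq_mul, sub_eq_add_neg]
  rw [fwdDiff_iter_apply_apply, e, fwdDiff_iter_const_smul, Pi.smul_apply, norm_smul,
    Complex.norm_real, Real.norm_eq_abs]
  gcongr
  refine (norm_fwdDiff_iter_mul_le h j _ _ x).trans (le_of_eq ?_)
  simp only [fwdDiff_iter_comp_add]
  refine congrArg _ (Finset.sum_congr rfl fun ik _ => ?_)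
  rw [sub_eq_add_neg, add_right_comm]

theorem norm_weight_mul_fwdDiff_gainTensor_le {η : ℝ} (hη : 0 ≤ η) {γ : ℝ≥0} (hγ : γ ≤ 2)
    {Φ : ℝ≥0 → ℝ} (h0 : Φ 0 = 0) (hΦ : MemHolder γ Φ) (g f : Vel N → ℂ) {h : Vel N} (hh : ‖h‖ ≤ 1)
    {j b : ℕ} (hj : j ≤ b) (x w : Vel N) :
    ‖((bracket w * energyWeight x w ^ η : ℝ) : ℂ) * (fwdDiff h)^[j] (gainTensor Φ g f) x w‖ ≤
      ((8 * 2 ^ b * (1 + b : ℝ≥0) ^ (η + 3) * nnHolderNorm γ Φ : ℝ≥0) : ℝ) *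
      ∑ ik ∈ Finset.HasAntidiagonal.antidiagonal j,
        ‖weighted (η + γ + 1) ((fwdDiff h)^[ik.1] g) (x - (1 / 2 : ℝ) • w + ik.2 • h) *
          weighted (η + γ + 1) ((fwdDiff h)^[ik.2] f) (x + (1 / 2 : ℝ) • w)‖ := by
  set κ : ℝ := η + γ + 1 with hκ
  have hγ' : (γ : ℝ) ≤ 2 := by exact_mod_cast hγ
  have hκ0 : 0 ≤ κ := by positivity
  have hw := bracket_pos w
  have hl := energyWeight_pos x w
  have hc := bracket_pos (x - (1 / 2 : ℝ) • w)
  have ha := bracket_pos (x + (1 / 2 : ℝ) • w)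
  rw [norm_mul, Complex.norm_real, Real.norm_of_nonneg (by positivity)]
  have h1 := norm_fwdDiff_iter_gainTensor_le Φ g f h j x w
  have h2 := bracket_mul_energyWeight_rpow_mul_abs_le hη hγ h0 hΦ x w
  have h3 : ∀ ik ∈ Finset.HasAntidiagonal.antidiagonal j,
      (bracket (x - (1 / 2 : ℝ) • w) ^ κ * bracket (x + (1 / 2 : ℝ) • w) ^ κ) *
        (‖(fwdDiff h)^[ik.1] g (x - (1 / 2 : ℝ) • w + ik.2 • h)‖ *
        ‖(fwdDiff h)^[ik.2] f (x + (1 / 2 : ℝ) • w)‖) ≤ (1 + b : ℝ) ^ (η + 3) *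
      ‖weighted κ ((fwdDiff h)^[ik.1] g) (x - (1 / 2 : ℝ) • w + ik.2 • h) *
            weighted κ ((fwdDiff h)^[ik.2] f) (x + (1 / 2 : ℝ) • w)‖ := fun ik hik => by
    have hs := Finset.HasAntidiagonal.mem_antidiagonal.1 hik
    -- The Leibniz rule has shifted the argument of `g` by at most `b`; Peetre's inequality moves
    -- the weight along. Since γ ≤ 2, `η + 3` bounds the exponent independently of `γ`.
    have h4 := bracket_rpow_add_le (p := κ) (P := η + 3)
      (by rw [abs_of_nonneg hκ0, hκ]; linarith) (x - (1 / 2 : ℝ) • w + ik.2 • h) (-(ik.2 • h))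
    rw [add_neg_cancel_right] at h4
    have h5 : ‖-(ik.2 • h)‖ ≤ b := by
      rw [norm_neg]
      refine norm_nsmul_le.trans ?_
      calc (ik.2 : ℝ) * ‖h‖ ≤ b * 1 := by gcongr; omega
        _ = b := mul_one _
    have hd := bracket_pos (x - (1 / 2 : ℝ) • w + ik.2 • h)
    have h6 : bracket (x - (1 / 2 : ℝ) • w) ^ κ ≤
        (1 + b : ℝ) ^ (η + 3) * bracket (x - (1 / 2 : ℝ) • w + ik.2 • h) ^ κ :=
      h4.trans (by gcongr)
    rw [norm_mul, norm_weighted, norm_weighted]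
    calc _ ≤ (((1 + b : ℝ) ^ (η + 3) * bracket (x - (1 / 2 : ℝ) • w + ik.2 • h) ^ κ) *
          bracket (x + (1 / 2 : ℝ) • w) ^ κ) *
        (‖(fwdDiff h)^[ik.1] g (x - (1 / 2 : ℝ) • w + ik.2 • h)‖ *
        ‖(fwdDiff h)^[ik.2] f (x + (1 / 2 : ℝ) • w)‖) := by gcongr
      _ = _ := by ring
  have h7 : (2 : ℝ) ^ j ≤ 2 ^ b := pow_le_pow_right₀ (by norm_num) hj
  set S := ∑ ik ∈ Finset.HasAntidiagonal.antidiagonal j,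
    ‖(fwdDiff h)^[ik.1] g (x - (1 / 2 : ℝ) • w + ik.2 • h)‖ *
    ‖(fwdDiff h)^[ik.2] f (x + (1 / 2 : ℝ) • w)‖ with hS
  have hS0 : 0 ≤ S := Finset.sum_nonneg fun _ _ => by positivity
  have h8 := Finset.sum_le_sum h3
  rw [← Finset.mul_sum, ← hS, ← Finset.mul_sum] at h8
  push_cast
  calc _ ≤ bracket w * energyWeight x w ^ η * (|Φ ‖w‖₊| * (2 ^ j * S)) := by gcongr
    _ = (bracket w * energyWeight x w ^ η * |Φ ‖w‖₊|) * (2 ^ j * S) := by ring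
    _ ≤ (8 * nnHolderNorm γ Φ * (bracket (x - (1 / 2 : ℝ) • w) ^ κ *
        bracket (x + (1 / 2 : ℝ) • w) ^ κ)) * (2 ^ b * S) := by gcongr
    _ = 8 * nnHolderNorm γ Φ * 2 ^ b * ((bracket (x - (1 / 2 : ℝ) • w) ^ κ *
        bracket (x + (1 / 2 : ℝ) • w) ^ κ) * S) := by ring
    _ ≤ 8 * nnHolderNorm γ Φ * 2 ^ b * _ := mul_le_mul_of_nonneg_left h8 (by positivity)
    _ = _ := by ring

theorem exists_eLpNorm_fwdDiff_gainTensor_le (N b : ℕ) {η : ℝ} (hη : 0 ≤ η) : ∃ C : ℝ≥0,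
    ∀ γ : ℝ≥0, γ ≤ 2 → ∀ Φ : ℝ≥0 → ℝ, Φ 0 = 0 → MemHolder γ Φ → ∀ g f : Vel N → ℂ,
      Measurable g → Measurable f → ∀ h : Vel N, ‖h‖ ≤ 1 → ∀ j ≤ b,
      eLpNorm (fun p : Vel N × Vel N => ((bracket p.2 * energyWeight p.1 p.2 ^ η : ℝ) : ℂ) *
        (fwdDiff h)^[j] (gainTensor Φ g f) p.1 p.2) 2 (volume.prod volume) ≤
      C * nnHolderNorm γ Φ * ∑ ik ∈ Finset.HasAntidiagonal.antidiagonal j,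
        eLpNorm (weighted (η + γ + 1) ((fwdDiff h)^[ik.1] g)) 2 volume *
        eLpNorm (weighted (η + γ + 1) ((fwdDiff h)^[ik.2] f)) 2 volume := by
  refine ⟨8 * 2 ^ b * (1 + b : ℝ≥0) ^ (η + 3), fun γ hγ Φ h0 hΦ g f hg hf h hh j hj => ?_⟩
  set κ : ℝ := η + γ + 1 with hκ
  have hgm := fun i => measurable_weighted (measurable_fwdDiff_iter hg h i) κ
  have hfm := fun i => measurable_weighted (measurable_fwdDiff_iter hf h i) κ
  have hGm : ∀ ik : ℕ × ℕ,
      Measurable fun y => weighted κ ((fwdDiff h)^[ik.1] g) (y + ik.2 • h) := fun ik => by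
    have h1 := (hgm ik.1).comp (measurable_add_const (ik.2 • h))
    exact h1
  have hGn : ∀ ik : ℕ × ℕ,
      eLpNorm (fun y => weighted κ ((fwdDiff h)^[ik.1] g) (y + ik.2 • h)) 2 volume =
      eLpNorm (weighted κ ((fwdDiff h)^[ik.1] g)) 2 volume := fun ik => by
    have h1 := eLpNorm_comp_measurePreserving (p := 2) (hgm ik.1).aestronglyMeasurable
      (measurePreserving_add_right volume (ik.2 • h))
    exact h1
  have key := eLpNorm_le_sum (μ := (volume : Measure (Vel N)).prod volume) (p := 2) (by norm_num)
    (Finset.HasAntidiagonal.antidiagonal j) (c := fun _ => 1) (fun _ _ => zero_le_one)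
    (f := fun ik (q : Vel N × Vel N) =>
      weighted κ ((fwdDiff h)^[ik.1] g) (q.1 - (1 / 2 : ℝ) • q.2 + ik.2 • h) *
        weighted κ ((fwdDiff h)^[ik.2] f) (q.1 + (1 / 2 : ℝ) • q.2))
    (fun ik _ => (measurable_centre_mul (hGm ik) (hfm ik.2)).aestronglyMeasurable)
    (g := fun p : Vel N × Vel N => ((bracket p.2 * energyWeight p.1 p.2 ^ η : ℝ) : ℂ) *
        (fwdDiff h)^[j] (gainTensor Φ g f) p.1 p.2)
    (8 * 2 ^ b * (1 + b : ℝ≥0) ^ (η + 3) * nnHolderNorm γ Φ) fun p => by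
      simp only [one_mul]
      exact norm_weight_mul_fwdDiff_gainTensor_le hη hγ h0 hΦ g f hh hj p.1 p.2
  refine key.trans (le_of_eq ?_)
  rw [ENNReal.coe_mul]
  refine congrArg _ (Finset.sum_congr rfl fun ik _ => ?_)
  rw [ENNReal.ofReal_one, one_mul, ← hGn]
  exact eLpNorm_centre_mul (hGm ik) (hfm ik.2) (by norm_num) (by norm_num)

end Tensor

/-! ### Dyadic characterisation of powers of |ξ| -/

section Dyadic

theorem four_rpow_eq (x : ℝ) : (4 : ℝ) ^ x = (2 : ℝ) ^ (2 * x) := by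
  rw [Real.rpow_mul (by norm_num)]; norm_num

/-- Dyadic characterisation of powers, upper bound. -/
theorem exists_tsum_dyadic_le {s : ℝ} (hs : 0 < s) {r : ℕ} (hr : s < r) : ∃ C : ℝ≥0, ∀ A : ℝ, 1 ≤ A →
    ∑' n : ℕ, ENNReal.ofReal ((4 : ℝ) ^ (n * s) * (min 1 ((1 / 2) ^ n * A) ^ r) ^ 2) ≤
      C * ENNReal.ofReal (A ^ (2 * s)) := by
  set ρ₁ : ℝ≥0∞ := ENNReal.ofReal ((4 : ℝ) ^ (-s)) with hρ₁
  set ρ₂ : ℝ≥0∞ := ENNReal.ofReal ((4 : ℝ) ^ (s - r)) with hρ₂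
  have h1 : ρ₁ < 1 := by
    rw [hρ₁, ENNReal.ofReal_lt_one]
    exact Real.rpow_lt_one_of_one_lt_of_neg (by norm_num) (by linarith)
  have h2 : ρ₂ < 1 := by
    rw [hρ₂, ENNReal.ofReal_lt_one]
    exact Real.rpow_lt_one_of_one_lt_of_neg (by norm_num) (by linarith)
  have hg : ∀ ρ : ℝ≥0∞, ρ < 1 → (1 - ρ)⁻¹ ≠ ∞ := fun ρ hρ =>
    ENNReal.inv_ne_top.2 (tsub_pos_of_lt hρ).ne'
  have hCt : (1 - ρ₁)⁻¹ + ENNReal.ofReal (4 ^ s) * (1 - ρ₂)⁻¹ ≠ ∞ :=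
    ENNReal.add_ne_top.2 ⟨hg _ h1, ENNReal.mul_ne_top ENNReal.ofReal_ne_top (hg _ h2)⟩
  refine ⟨((1 - ρ₁)⁻¹ + ENNReal.ofReal (4 ^ s) * (1 - ρ₂)⁻¹).toNNReal, fun A hA => ?_⟩
  rw [ENNReal.coe_toNNReal hCt]
  -- With 2^K ≤ A < 2^{K+1}, the terms n ≤ K are dominated by a geometric series of ratio 4^{-s}
  -- counted down from K, and the terms n > K by one of ratio 4^{s-r}. This uses 0 < s and s < r
  -- respectively.
  obtain ⟨K, hK1, hK2⟩ := exists_nat_pow_near hA one_lt_two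
  have hA0 : 0 < A := by linarith
  have hKA : (4 : ℝ) ^ (K * s) ≤ A ^ (2 * s) := by
    rw [four_rpow_eq, show 2 * (K * s) = K * (2 * s) by ring, Real.rpow_mul (by norm_num),
      Real.rpow_natCast]
    gcongr
  set f : ℕ → ℝ≥0∞ := fun n =>
    ENNReal.ofReal ((4 : ℝ) ^ (n * s) * (min 1 ((1 / 2) ^ n * A) ^ r) ^ 2) with hf
  have hm0 : ∀ n : ℕ, 0 ≤ min 1 ((1 / 2 : ℝ) ^ n * A) := fun n => le_min zero_le_one (by positivity)
  have hlow : ∀ n ∈ Finset.range (K + 1), f n ≤ ρ₁ ^ (K + 1 - 1 - n) * ENNReal.ofReal (A ^ (2 * s)) := by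
    intro n hn
    have hnK : n ≤ K := Nat.lt_succ_iff.1 (Finset.mem_range.1 hn)
    rw [hρ₁, ← ENNReal.ofReal_pow (by positivity), ← ENNReal.ofReal_mul (by positivity)]
    refine ENNReal.ofReal_le_ofReal ?_
    have h3 : (min 1 ((1 / 2 : ℝ) ^ n * A) ^ r) ^ 2 ≤ 1 :=
      pow_le_one₀ (pow_nonneg (hm0 n) _) (pow_le_one₀ (hm0 n) (min_le_left _ _))
    calc _ ≤ (4 : ℝ) ^ (n * s) * 1 := by gcongr
      _ = ((4 : ℝ) ^ (-s)) ^ (K + 1 - 1 - n) * 4 ^ (K * s) := by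
        rw [← Real.rpow_mul_natCast (by norm_num), ← Real.rpow_add (by norm_num), mul_one,
          Nat.add_sub_cancel, Nat.cast_sub hnK]
        congr 1; ring
      _ ≤ _ := by gcongr
  have hhigh : ∀ n, f (n + (K + 1)) ≤
      ENNReal.ofReal (4 ^ s) * ENNReal.ofReal (A ^ (2 * s)) * ρ₂ ^ n := by
    intro n
    rw [hρ₂, ← ENNReal.ofReal_pow (by positivity), ← ENNReal.ofReal_mul (by positivity),
      ← ENNReal.ofReal_mul (by positivity)]
    refine ENNReal.ofReal_le_ofReal ?_
    have h3 : min 1 ((1 / 2 : ℝ) ^ (n + (K + 1)) * A) ≤ (1 / 2) ^ n := by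
      refine (min_le_right _ _).trans ?_
      rw [pow_add, mul_assoc]
      refine mul_le_of_le_one_right (by positivity) ?_
      rw [one_div, inv_pow, inv_mul_le_one₀ (by positivity)]
      exact hK2.le
    have h4 : (((1 / 2 : ℝ) ^ n) ^ r) ^ 2 = (4 : ℝ) ^ (-(n * r : ℝ)) := by
      rw [Real.rpow_neg (by norm_num), ← Nat.cast_mul, Real.rpow_natCast, ← pow_mul, ← pow_mul,
        one_div, inv_pow, show n * (r * 2) = 2 * (n * r) by ring, pow_mul 2 2]
      norm_num
    calc _ ≤ (4 : ℝ) ^ (((n + (K + 1) : ℕ) : ℝ) * s) * (((1 / 2) ^ n) ^ r) ^ 2 := by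
          have := hm0 (n + (K + 1))
          gcongr
      _ = 4 ^ s * 4 ^ (K * s) * ((4 : ℝ) ^ (s - r)) ^ n := by
          rw [h4, ← Real.rpow_mul_natCast (by norm_num), ← Real.rpow_add (by norm_num),
            ← Real.rpow_add (by norm_num), ← Real.rpow_add (by norm_num)]
          congr 1; push_cast; ring
      _ ≤ _ := by gcongr
  calc ∑' n, f n = ∑ n ∈ Finset.range (K + 1), f n + ∑' n, f (n + (K + 1)) :=
        (ENNReal.summable.sum_add_tsum_nat_add' (k := K + 1)).symm
    _ ≤ ∑ n ∈ Finset.range (K + 1), ρ₁ ^ (K + 1 - 1 - n) * ENNReal.ofReal (A ^ (2 * s)) +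
        ∑' n, ENNReal.ofReal (4 ^ s) * ENNReal.ofReal (A ^ (2 * s)) * ρ₂ ^ n :=
        add_le_add (Finset.sum_le_sum hlow) (ENNReal.tsum_le_tsum hhigh)
    _ ≤ (1 - ρ₁)⁻¹ * ENNReal.ofReal (A ^ (2 * s)) +
        ENNReal.ofReal (4 ^ s) * ENNReal.ofReal (A ^ (2 * s)) * (1 - ρ₂)⁻¹ := by
        rw [← Finset.sum_mul, Finset.sum_range_reflect (fun i => ρ₁ ^ i) (K + 1), ENNReal.tsum_mul_left,
          ENNReal.tsum_geometric]
        gcongr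
        rw [← ENNReal.tsum_geometric]
        exact ENNReal.sum_le_tsum _
    _ = _ := by ring

variable {N : ℕ}

theorem one_le_norm_diffSymbol {h ξ : Vel N} (h1 : 1 / 4 ≤ |inner ℝ h ξ|) (h2 : |inner ℝ h ξ| ≤ 1 / 2) :
    1 ≤ ‖diffSymbol h ξ‖ := by
  set t : ℝ := inner ℝ h ξ
  have hpi := Real.pi_pos
  have hre : (diffSymbol h ξ).re ≤ -1 := by
    have e : (diffSymbol h ξ).re = Real.cos (2 * Real.pi * t) - 1 := by
      rw [diffSymbol, Real.fourierChar_apply, Complex.sub_re, Complex.one_re, Complex.exp_ofReal_mul_I_re]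
    have h3 : Real.cos (2 * Real.pi * t) ≤ 0 := by
      rw [← Real.cos_abs, abs_mul, abs_of_pos (by positivity : 0 < 2 * Real.pi)]
      refine Real.cos_nonpos_of_pi_div_two_le_of_le ?_ ?_
      · nlinarith
      · nlinarith
    linarith
  have := Complex.abs_re_le_norm (diffSymbol h ξ)
  linarith [neg_abs_le (diffSymbol h ξ).re]

/-- The dyadic steps in the coordinate directions. -/
def dyadicStep (i : Fin N) (n : ℕ) : Vel N := EuclideanSpace.single i ((1 / 2 : ℝ) ^ n)

theorem norm_dyadicStep (i : Fin N) (n : ℕ) : ‖dyadicStep i n‖ = (1 / 2 : ℝ) ^ n := by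
  rw [dyadicStep, PiLp.norm_single, Real.norm_of_nonneg (by positivity)]

theorem inner_dyadicStep (i : Fin N) (n : ℕ) (ξ : Vel N) :
    inner ℝ (dyadicStep i n) ξ = (1 / 2 : ℝ) ^ n * ξ i := by
  rw [dyadicStep, EuclideanSpace.inner_single_left]; simp

/-- Dyadic characterisation of powers, lower bound. -/
theorem rpow_le_tsum_diffSymbol [NeZero N] {s : ℝ} (hs : 0 ≤ s) (M : ℕ) {ξ : Vel N}
    (hξ : Real.sqrt N ≤ ‖ξ‖) :
    ENNReal.ofReal (‖ξ‖ ^ (2 * s)) ≤ ENNReal.ofReal ((N : ℝ) ^ s) *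
      ∑ i : Fin N, ∑' n : ℕ, ENNReal.ofReal ((4 : ℝ) ^ (n * s)) * (‖diffSymbol (dyadicStep i n) ξ‖ₑ ^ M) ^ 2 := by
  have hN : (0 : ℝ) < N := by exact_mod_cast Nat.pos_of_ne_zero (NeZero.ne N)
  -- Some coordinate carries at least the share 1/N of |ξ|²; with |ξ| ≥ √N it has modulus at least
  -- 1.
  obtain ⟨i, hi⟩ : ∃ i, ‖ξ‖ ^ 2 ≤ N * ξ i ^ 2 := by
    by_contra! hcon
    have h1 : ∑ i : Fin N, N * ξ i ^ 2 < ∑ _i : Fin N, ‖ξ‖ ^ 2 :=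
      Finset.sum_lt_sum_of_nonempty ⟨0, Finset.mem_univ _⟩ fun i _ => hcon i
    rw [← Finset.mul_sum, Finset.sum_const, Finset.card_univ, Fintype.card_fin, nsmul_eq_mul,
      EuclideanSpace.norm_sq_eq] at h1
    simp at h1
  have hξ2 : (N : ℝ) ≤ ‖ξ‖ ^ 2 := by
    have := pow_le_pow_left₀ (Real.sqrt_nonneg _) hξ 2
    rwa [Real.sq_sqrt hN.le] at this
  have h1 : 1 ≤ |ξ i| := by
    rw [← one_le_sq_iff_one_le_abs]
    by_contra! hcon
    nlinarith
  -- With 2^k ≤ |ξ_i| < 2^{k+1}, the step 2^{-(k+2)} puts the phase in [1/4, 1/2), where the symbol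
  -- has modulus at least 1. The single term `n = k + 2` of the sum suffices.
  obtain ⟨k, hk1, hk2⟩ := exists_nat_pow_near h1 one_lt_two
  have hin : |inner ℝ (dyadicStep i (k + 2)) ξ| = (1 / 2 : ℝ) ^ (k + 2) * |ξ i| := by
    rw [inner_dyadicStep, abs_mul, abs_of_nonneg (by positivity)]
  have hp : (1 / 2 : ℝ) ^ (k + 2) * 2 ^ k = 1 / 4 := by
    rw [pow_add, mul_right_comm, ← mul_pow]; norm_num
  have hd : 1 ≤ ‖diffSymbol (dyadicStep i (k + 2)) ξ‖ := by
    refine one_le_norm_diffSymbol ?_ ?_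
    · rw [hin, ← hp]; gcongr
    · rw [hin]
      calc _ ≤ (1 / 2 : ℝ) ^ (k + 2) * 2 ^ (k + 1) := by gcongr
        _ = (1 / 2 : ℝ) ^ (k + 2) * 2 ^ k * 2 := by ring
        _ = 1 / 2 := by rw [hp]; norm_num
  have hd' : (1 : ℝ≥0∞) ≤ (‖diffSymbol (dyadicStep i (k + 2)) ξ‖ₑ ^ M) ^ 2 := by
    have : (1 : ℝ≥0∞) ≤ ‖diffSymbol (dyadicStep i (k + 2)) ξ‖ₑ := by
      rw [← ofReal_norm]; exact ENNReal.one_le_ofReal.2 hd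
    exact one_le_pow₀ (one_le_pow₀ this)
  have hreal : ‖ξ‖ ^ (2 * s) ≤ (N : ℝ) ^ s * (4 : ℝ) ^ (((k + 2 : ℕ) : ℝ) * s) := by
    have h2 : ‖ξ‖ ^ 2 ≤ N * 4 ^ (k + 2) := by
      refine hi.trans ?_
      gcongr
      rw [← sq_abs]
      calc |ξ i| ^ 2 ≤ (2 ^ (k + 1)) ^ 2 := by gcongr
        _ = 4 ^ (k + 1) := by rw [← pow_mul, mul_comm, pow_mul]; norm_num
        _ ≤ _ := pow_le_pow_right₀ (by norm_num) (by omega)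
    calc ‖ξ‖ ^ (2 * s) = (‖ξ‖ ^ 2) ^ s := by
          rw [Real.rpow_mul (norm_nonneg _)]; norm_num
      _ ≤ (N * 4 ^ (k + 2)) ^ s := by gcongr
      _ = _ := by
          rw [Real.mul_rpow hN.le (by positivity), Real.rpow_mul (by norm_num), Real.rpow_natCast]
  calc _ ≤ ENNReal.ofReal ((N : ℝ) ^ s * (4 : ℝ) ^ (((k + 2 : ℕ) : ℝ) * s)) :=
        ENNReal.ofReal_le_ofReal hreal
    _ = ENNReal.ofReal ((N : ℝ) ^ s) * (ENNReal.ofReal ((4 : ℝ) ^ (((k + 2 : ℕ) : ℝ) * s)) * 1) := by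
        rw [mul_one, ENNReal.ofReal_mul (by positivity)]
    _ ≤ _ := by
        gcongr
        calc _ ≤ ENNReal.ofReal ((4 : ℝ) ^ (((k + 2 : ℕ) : ℝ) * s)) *
              (‖diffSymbol (dyadicStep i (k + 2)) ξ‖ₑ ^ M) ^ 2 := by gcongr
          _ ≤ ∑' n : ℕ, ENNReal.ofReal ((4 : ℝ) ^ (n * s)) *
              (‖diffSymbol (dyadicStep i n) ξ‖ₑ ^ M) ^ 2 := ENNReal.le_tsum (k + 2)
          _ ≤ _ := Finset.single_le_sum (f := fun i : Fin N => ∑' n : ℕ,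
              ENNReal.ofReal ((4 : ℝ) ^ (n * s)) * (‖diffSymbol (dyadicStep i n) ξ‖ₑ ^ M) ^ 2)
              (fun _ _ => zero_le) (Finset.mem_univ i)

end Dyadic

/-! ### Differences of products -/

section DiffSum

variable {N : ℕ}

/-- The sum `∑_{l ≤ r} |h|^{r-l} ‖Δ_h^l F‖` of `L²` norms of differences. -/
def diffSum (r : ℕ) (h : Vel N) (F : Vel N → ℂ) : ℝ≥0∞ :=
  ∑ l ∈ Finset.range (r + 1), ‖h‖ₑ ^ (r - l) * eLpNorm ((fwdDiff h)^[l] F) 2 volume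

/-- The square of the Sobolev norm of order `s`, in `L²`. -/
def sobolevSq (s : ℝ) (F : Vel N → ℂ) : ℝ≥0∞ :=
  ∫⁻ ξ : Vel N, ENNReal.ofReal ((1 + (2 * Real.pi * ‖ξ‖) ^ 2) ^ s) * ‖fourierL2 F ξ‖ₑ ^ 2

theorem eLpNorm_fwdDiff_iter_le {F : Vel N → ℂ} (hF : AEStronglyMeasurable F volume) (h : Vel N)
    (l : ℕ) : eLpNorm ((fwdDiff h)^[l] F) 2 volume ≤ 2 ^ l * eLpNorm F 2 volume := by
  induction l with
  | zero => simp
  | succ l ih =>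
    rw [Function.iterate_succ_apply']
    have hm := aestronglyMeasurable_fwdDiff_iter hF h l
    have hs := eLpNorm_comp_measurePreserving (p := 2) hm (measurePreserving_add_right volume h)
    have h1 := eLpNorm_sub_le (hm.comp_measurePreserving (measurePreserving_add_right volume h)) hm
      (p := 2) (by norm_num)
    rw [hs] at h1
    refine h1.trans ?_
    rw [← two_mul, pow_succ, mul_comm _ (2 : ℝ≥0∞), mul_assoc]
    gcongr

theorem pow_mul_eLpNorm_fwdDiff_le_diffSum (r : ℕ) (h : Vel N) (F : Vel N → ℂ) {l : ℕ} (hl : l ≤ r) :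
    ‖h‖ₑ ^ (r - l) * eLpNorm ((fwdDiff h)^[l] F) 2 volume ≤ diffSum r h F :=
  Finset.single_le_sum (f := fun l => ‖h‖ₑ ^ (r - l) * eLpNorm ((fwdDiff h)^[l] F) 2 volume)
    (fun _ _ => zero_le) (Finset.mem_range.2 (Order.lt_add_one_iff.2 hl))

theorem eLpNorm_fwdDiff_iter_le_diffSum {F : Vel N → ℂ} (hF : AEStronglyMeasurable F volume) (r : ℕ)
    (h : Vel N) {m : ℕ} (hm : r ≤ m) :
    eLpNorm ((fwdDiff h)^[m] F) 2 volume ≤ 2 ^ (m - r) * diffSum r h F := by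
  have h1 := pow_mul_eLpNorm_fwdDiff_le_diffSum r h F le_rfl
  rw [Nat.sub_self, pow_zero, one_mul] at h1
  have h2 := eLpNorm_fwdDiff_iter_le (aestronglyMeasurable_fwdDiff_iter hF h r) h (m - r)
  rw [← Function.iterate_add_apply, Nat.sub_add_cancel hm] at h2
  refine h2.trans ?_
  gcongr

/-- Either one factor carries more than `r` differences, or the spare power of `‖h‖` supplies the `r
- l` missing ones for `G`. So one factor is always measured by `diffSum` and the differences of the
other are dropped at the price of powers of 2. -/
theorem pow_mul_eLpNorm_mul_eLpNorm_le {G F : Vel N → ℂ} (hG : AEStronglyMeasurable G volume)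
    (hF : AEStronglyMeasurable F volume) {h : Vel N} (hh : ‖h‖ ≤ 1) {r l m : ℕ} (hlm : l + m ≤ 2 * r) :
    ‖h‖ₑ ^ (2 * r - l - m) * (eLpNorm ((fwdDiff h)^[l] G) 2 volume *
      eLpNorm ((fwdDiff h)^[m] F) 2 volume) ≤
      4 ^ r * (diffSum r h G * eLpNorm F 2 volume + eLpNorm G 2 volume * diffSum r h F) := by
  have he : ‖h‖ₑ ≤ 1 := by rw [← ofReal_norm]; exact ENNReal.ofReal_le_one.2 hh
  have h4 : (4 : ℝ≥0∞) ^ r = 2 ^ (2 * r) := by rw [pow_mul]; norm_num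
  have h2 : ∀ a : ℕ, a ≤ 2 * r → (2 : ℝ≥0∞) ^ a ≤ 4 ^ r := fun a ha => by
    rw [h4]; exact pow_le_pow_right₀ (by norm_num) ha
  rw [mul_add]
  rcases le_or_gt m r with hm | hm
  · rcases le_or_gt l r with hl | hl
    · refine le_add_of_le_of_nonneg ?_ zero_le
      have e1 : ‖h‖ₑ ^ (2 * r - l - m) ≤ ‖h‖ₑ ^ (r - l) := pow_le_pow_right_of_le_one' he (by omega)
      calc _ ≤ ‖h‖ₑ ^ (r - l) * (eLpNorm ((fwdDiff h)^[l] G) 2 volume *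
            (2 ^ m * eLpNorm F 2 volume)) := by
            gcongr; exact eLpNorm_fwdDiff_iter_le hF h m
        _ = 2 ^ m * (‖h‖ₑ ^ (r - l) * eLpNorm ((fwdDiff h)^[l] G) 2 volume * eLpNorm F 2 volume) := by
            ring
        _ ≤ _ := mul_le_mul' (h2 m (by omega))
            (mul_le_mul' (pow_mul_eLpNorm_fwdDiff_le_diffSum r h G hl) le_rfl)
    · refine le_add_of_le_of_nonneg ?_ zero_le
      calc _ ≤ 1 * ((2 ^ (l - r) * diffSum r h G) * (2 ^ m * eLpNorm F 2 volume)) := by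
            gcongr
            · exact pow_le_one' he _
            · exact eLpNorm_fwdDiff_iter_le_diffSum hG r h hl.le
            · exact eLpNorm_fwdDiff_iter_le hF h m
        _ = 2 ^ (l - r + m) * (diffSum r h G * eLpNorm F 2 volume) := by rw [pow_add]; ring
        _ ≤ _ := mul_le_mul' (h2 _ (by omega)) le_rfl
  · refine le_add_of_nonneg_of_le zero_le ?_
    calc _ ≤ 1 * ((2 ^ l * eLpNorm G 2 volume) * (2 ^ (m - r) * diffSum r h F)) := by
          gcongr
          · exact pow_le_one' he _
          · exact eLpNorm_fwdDiff_iter_le hG h l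
          · exact eLpNorm_fwdDiff_iter_le_diffSum hF r h hm.le
      _ = 2 ^ (m - r + l) * (eLpNorm G 2 volume * diffSum r h F) := by rw [pow_add]; ring
      _ ≤ _ := mul_le_mul' (h2 _ (by omega)) le_rfl

/-- Weighted differences of the tensorised argument, of order at most `2r`. -/
theorem exists_pow_mul_eLpNorm_fwdDiff_gainTensor_le (N r : ℕ) {η : ℝ} (hη : 0 ≤ η) : ∃ C : ℝ≥0,
    ∀ γ : ℝ≥0, γ ≤ 2 → ∀ Φ : ℝ≥0 → ℝ, Φ 0 = 0 → MemHolder γ Φ → ∀ g f : Vel N → ℂ,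
      Measurable g → Measurable f → ∀ h : Vel N, ‖h‖ ≤ 1 → ∀ j ≤ 2 * r,
      ‖h‖ₑ ^ (2 * r - j) * eLpNorm (fun p : Vel N × Vel N =>
        ((bracket p.2 * energyWeight p.1 p.2 ^ η : ℝ) : ℂ) *
        (fwdDiff h)^[j] (gainTensor Φ g f) p.1 p.2) 2 (volume.prod volume) ≤
      C * nnHolderNorm γ Φ *
        (diffSum r h (weighted (η + γ + 1) g) * eLpNorm (weighted (η + γ + 1) f) 2 volume +
          eLpNorm (weighted (η + γ + 1) g) 2 volume * diffSum r h (weighted (η + γ + 1) f)) := by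
  obtain ⟨C₁, hC₁⟩ := exists_eLpNorm_fwdDiff_gainTensor_le N (2 * r) hη
  obtain ⟨C₂, hC₂⟩ := exists_eLpNorm_weighted_fwdDiff_le N (2 * r) (η + 3)
  refine ⟨C₁ * ((2 * r + 1 : ℕ) * (C₂ * C₂ * ((2 * r + 1 : ℕ) * ((2 * r + 1 : ℕ) * 4 ^ r)))),
    fun γ hγ Φ h0 hΦ g f hg hf h hh j hj => ?_⟩
  set κ : ℝ := η + γ + 1 with hκ
  have hγ' : (γ : ℝ) ≤ 2 := by exact_mod_cast hγ
  have hκ0 : 0 ≤ κ := by positivity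
  have hκ1 : |κ| ≤ η + 3 := by rw [abs_of_nonneg hκ0, hκ]; linarith
  set G := weighted κ g
  set F := weighted κ f
  have hGm : AEStronglyMeasurable G volume := (measurable_weighted hg κ).aestronglyMeasurable
  have hFm : AEStronglyMeasurable F volume := (measurable_weighted hf κ).aestronglyMeasurable
  set D := diffSum r h G * eLpNorm F 2 volume + eLpNorm G 2 volume * diffSum r h F
  have inner : ∀ i k, i + k = j → ‖h‖ₑ ^ (2 * r - j) *
      (eLpNorm (weighted κ ((fwdDiff h)^[i] g)) 2 volume *
        eLpNorm (weighted κ ((fwdDiff h)^[k] f)) 2 volume) ≤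
      C₂ * C₂ * ((2 * r + 1 : ℕ) * ((2 * r + 1 : ℕ) * 4 ^ r)) * D := by
    intro i k hik
    have h1 := hC₂ κ hκ1 h hh g hg.aestronglyMeasurable i (by omega)
    have h2 := hC₂ κ hκ1 h hh f hf.aestronglyMeasurable k (by omega)
    calc _ ≤ ‖h‖ₑ ^ (2 * r - j) *
          ((C₂ * ∑ a ∈ Finset.HasAntidiagonal.antidiagonal i,
            ‖h‖ₑ ^ a.1 * eLpNorm ((fwdDiff h)^[a.2] G) 2 volume) *
          (C₂ * ∑ c ∈ Finset.HasAntidiagonal.antidiagonal k,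
            ‖h‖ₑ ^ c.1 * eLpNorm ((fwdDiff h)^[c.2] F) 2 volume)) :=
          mul_le_mul_right (mul_le_mul' h1 h2) _
      _ = C₂ * C₂ * ∑ a ∈ Finset.HasAntidiagonal.antidiagonal i,
          ∑ c ∈ Finset.HasAntidiagonal.antidiagonal k, ‖h‖ₑ ^ (2 * r - j) *
          ((‖h‖ₑ ^ a.1 * eLpNorm ((fwdDiff h)^[a.2] G) 2 volume) *
            (‖h‖ₑ ^ c.1 * eLpNorm ((fwdDiff h)^[c.2] F) 2 volume)) := by
          simp only [← Finset.mul_sum, ← Finset.sum_mul]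
          ring
      _ ≤ C₂ * C₂ * ∑ a ∈ Finset.HasAntidiagonal.antidiagonal i,
          ∑ c ∈ Finset.HasAntidiagonal.antidiagonal k, 4 ^ r * D := by
          refine mul_le_mul_right (Finset.sum_le_sum fun a ha => Finset.sum_le_sum fun c hc => ?_) _
          have ha' := Finset.HasAntidiagonal.mem_antidiagonal.1 ha
          have hc' := Finset.HasAntidiagonal.mem_antidiagonal.1 hc
          have e : 2 * r - a.2 - c.2 = (2 * r - j) + a.1 + c.1 := by omega
          refine le_trans (le_of_eq ?_) (pow_mul_eLpNorm_mul_eLpNorm_le hGm hFm hh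
            (r := r) (l := a.2) (m := c.2) (by omega))
          rw [e, pow_add, pow_add]
          ring
      _ ≤ C₂ * C₂ * ((2 * r + 1 : ℕ) * ((2 * r + 1 : ℕ) * (4 ^ r * D))) := by
          rw [Finset.sum_const, Finset.sum_const, Finset.Nat.card_antidiagonal,
            Finset.Nat.card_antidiagonal, nsmul_eq_mul, nsmul_eq_mul]
          gcongr <;> omega
      _ = _ := by ring
  refine (mul_le_mul_right (hC₁ γ hγ Φ h0 hΦ g f hg hf h hh j hj) _).trans ?_
  calc _ = C₁ * nnHolderNorm γ Φ * ∑ ik ∈ Finset.HasAntidiagonal.antidiagonal j, ‖h‖ₑ ^ (2 * r - j) *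
        (eLpNorm (weighted κ ((fwdDiff h)^[ik.1] g)) 2 volume *
        eLpNorm (weighted κ ((fwdDiff h)^[ik.2] f)) 2 volume) := by
        rw [mul_left_comm, Finset.mul_sum]
    _ ≤ C₁ * nnHolderNorm γ Φ * ∑ ik ∈ Finset.HasAntidiagonal.antidiagonal j,
        C₂ * C₂ * ((2 * r + 1 : ℕ) * ((2 * r + 1 : ℕ) * 4 ^ r)) * D :=
        mul_le_mul_right (Finset.sum_le_sum fun ik hik =>
          inner _ _ (Finset.HasAntidiagonal.mem_antidiagonal.1 hik)) _
    _ ≤ C₁ * nnHolderNorm γ Φ * ((2 * r + 1 : ℕ) *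
        (C₂ * C₂ * ((2 * r + 1 : ℕ) * ((2 * r + 1 : ℕ) * 4 ^ r)) * D)) := by
        rw [Finset.sum_const, Finset.Nat.card_antidiagonal, nsmul_eq_mul]
        gcongr
    _ = _ := by push_cast; ring

end DiffSum

/-! ### Sobolev norms control dyadic sums of differences -/

section UpperBound

variable {N : ℕ}

theorem sq_sum_le {ι : Type*} (s : Finset ι) (f : ι → ℝ≥0∞) :
    (∑ i ∈ s, f i) ^ 2 ≤ s.card * ∑ i ∈ s, f i ^ 2 := by
  have h := sum_mul_sq_le (ι := s) (fun _ => 1) fun i => f i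
  simp only [one_mul, one_pow, Finset.sum_const, Finset.card_univ, Fintype.card_coe, nsmul_eq_mul,
    mul_one] at h
  rwa [Finset.sum_coe_sort s f, Finset.sum_coe_sort s fun i => f i ^ 2] at h

theorem add_sq_le_two_mul (a b : ℝ≥0∞) : (a + b) ^ 2 ≤ 2 * (a ^ 2 + b ^ 2) := by
  have h := sq_sum_le (Finset.univ : Finset Bool) fun t => bif t then a else b
  simpa using h

theorem measurable_fourierL2 (F : Vel N → ℂ) : AEMeasurable (fun ξ => ‖fourierL2 F ξ‖ₑ) volume :=
  (memLp_fourierL2 F).1.enorm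

theorem sq_eLpNorm_fwdDiff_iter {F : Vel N → ℂ} (hF : MemLp F 2 (volume : Measure (Vel N)))
    (h : Vel N) (l : ℕ) : eLpNorm ((fwdDiff h)^[l] F) 2 volume ^ 2 =
      ∫⁻ ξ, (‖diffSymbol h ξ‖ₑ ^ l) ^ 2 * ‖fourierL2 F ξ‖ₑ ^ 2 := by
  rw [← eLpNorm_fourierL2 (memLp_fwdDiff_iter hF h l), eLpNorm_two_sq]
  refine lintegral_congr_ae ?_
  filter_upwards [fourierL2_fwdDiff_iter hF h l] with ξ hξ
  rw [hξ, enorm_mul, enorm_pow, mul_pow]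

/-- Both `‖h‖` and half the modulus of the symbol are at most min(1, |h|A), where A is the square
root on the right; there are `r` such factors in all. -/
theorem pow_mul_norm_diffSymbol_pow_le {h : Vel N} {n : ℕ} (hn : ‖h‖ = (1 / 2 : ℝ) ^ n) {l r : ℕ}
    (hl : l ≤ r) (ξ : Vel N) : ‖h‖ ^ (r - l) * ‖diffSymbol h ξ‖ ^ l ≤
      2 ^ r * min 1 ((1 / 2) ^ n * Real.sqrt (1 + (2 * Real.pi * ‖ξ‖) ^ 2)) ^ r := by
  set A := Real.sqrt (1 + (2 * Real.pi * ‖ξ‖) ^ 2) with hA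
  have hA1 : 1 ≤ A := Real.one_le_sqrt.2 (by nlinarith [sq_nonneg (2 * Real.pi * ‖ξ‖)])
  have hAξ : 2 * Real.pi * ‖ξ‖ ≤ A := Real.le_sqrt_of_sq_le (by linarith)
  have hh1 : ‖h‖ ≤ 1 := by rw [hn]; exact pow_le_one₀ (by norm_num) (by norm_num)
  rw [← hn]
  have hm : ‖h‖ ≤ min 1 (‖h‖ * A) := le_min hh1 (le_mul_of_one_le_right (norm_nonneg _) hA1)
  have hd : ‖diffSymbol h ξ‖ ≤ 2 * min 1 (‖h‖ * A) := by
    rw [mul_min_of_nonneg _ _ (by norm_num : (0 : ℝ) ≤ 2), mul_one]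
    refine le_min (norm_diffSymbol_le_two h ξ) ((norm_diffSymbol_le h ξ).trans ?_)
    have := mul_le_mul_of_nonneg_left hAξ (norm_nonneg h)
    have : 0 ≤ ‖h‖ * A := by positivity
    linarith
  have hm0 : 0 ≤ min 1 (‖h‖ * A) := (norm_nonneg h).trans hm
  have h2 : (2 : ℝ) ^ l ≤ 2 ^ r := pow_le_pow_right₀ (by norm_num) hl
  calc _ ≤ min 1 (‖h‖ * A) ^ (r - l) * (2 * min 1 (‖h‖ * A)) ^ l := by gcongr
    _ = 2 ^ l * min 1 (‖h‖ * A) ^ r := by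
      rw [mul_pow, mul_left_comm, ← pow_add, Nat.sub_add_cancel hl]
    _ ≤ _ := by gcongr

theorem sq_diffSum_le {F : Vel N → ℂ} (hF : MemLp F 2 (volume : Measure (Vel N))) {h : Vel N} {n : ℕ}
    (hn : ‖h‖ = (1 / 2 : ℝ) ^ n) (r : ℕ) : diffSum r h F ^ 2 ≤ ((r + 1 : ℕ) * (r + 1 : ℕ) * 4 ^ r) *
      ∫⁻ ξ, ENNReal.ofReal ((min 1 ((1 / 2) ^ n *
        Real.sqrt (1 + (2 * Real.pi * ‖ξ‖) ^ 2)) ^ r) ^ 2) * ‖fourierL2 F ξ‖ₑ ^ 2 := by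
  set m : Vel N → ℝ := fun ξ => min 1 ((1 / 2) ^ n * Real.sqrt (1 + (2 * Real.pi * ‖ξ‖) ^ 2)) with hm
  set I := ∫⁻ ξ, ENNReal.ofReal ((m ξ ^ r) ^ 2) * ‖fourierL2 F ξ‖ₑ ^ 2
  have hm0 : ∀ ξ, 0 ≤ m ξ := fun ξ => le_min zero_le_one (by positivity)
  have hterm : ∀ l ∈ Finset.range (r + 1),
      (‖h‖ₑ ^ (r - l) * eLpNorm ((fwdDiff h)^[l] F) 2 volume) ^ 2 ≤ 4 ^ r * I := by
    intro l hl
    have hl' : l ≤ r := Nat.lt_succ_iff.1 (Finset.mem_range.1 hl)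
    rw [mul_pow, sq_eLpNorm_fwdDiff_iter hF, ← lintegral_const_mul' _ _ (by finiteness),
      ← lintegral_const_mul' _ _ (by finiteness)]
    refine lintegral_mono fun ξ => ?_
    have h1 := pow_mul_norm_diffSymbol_pow_le hn hl' ξ
    have h2 : ‖h‖ₑ ^ (r - l) * ‖diffSymbol h ξ‖ₑ ^ l ≤ ENNReal.ofReal (2 ^ r * m ξ ^ r) := by
      rw [← ofReal_norm, ← ofReal_norm, ← ENNReal.ofReal_pow (norm_nonneg _),
        ← ENNReal.ofReal_pow (norm_nonneg _), ← ENNReal.ofReal_mul (by positivity)]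
      exact ENNReal.ofReal_le_ofReal h1
    have h3 : ENNReal.ofReal (2 ^ r * m ξ ^ r) ^ 2 = 4 ^ r * ENNReal.ofReal ((m ξ ^ r) ^ 2) := by
      rw [ENNReal.ofReal_mul (by positivity), mul_pow, ENNReal.ofReal_pow (pow_nonneg (hm0 ξ) r) 2,
        ENNReal.ofReal_pow (by norm_num), ← pow_mul, mul_comm r 2, pow_mul]
      norm_num
    calc _ = (‖h‖ₑ ^ (r - l) * ‖diffSymbol h ξ‖ₑ ^ l) ^ 2 * ‖fourierL2 F ξ‖ₑ ^ 2 := by ring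
      _ ≤ ENNReal.ofReal (2 ^ r * m ξ ^ r) ^ 2 * ‖fourierL2 F ξ‖ₑ ^ 2 := by gcongr
      _ = _ := by rw [h3]; ring
  refine (sq_sum_le _ _).trans ?_
  rw [Finset.card_range]
  calc _ ≤ ((r + 1 : ℕ) : ℝ≥0∞) * ∑ l ∈ Finset.range (r + 1), 4 ^ r * I :=
        mul_le_mul_right (Finset.sum_le_sum hterm) _
    _ = _ := by rw [Finset.sum_const, Finset.card_range, nsmul_eq_mul]; ring

/-- Dyadic sums of differences are controlled by the Sobolev norm. -/
theorem exists_tsum_sq_diffSum_le (N : ℕ) {s : ℝ} (hs : 0 < s) {r : ℕ} (hr : s < r) : ∃ C : ℝ≥0,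
    ∀ F : Vel N → ℂ, MemLp F 2 (volume : Measure (Vel N)) → ∀ h : ℕ → Vel N,
      (∀ n, ‖h n‖ = (1 / 2 : ℝ) ^ n) →
      ∑' n : ℕ, ENNReal.ofReal ((4 : ℝ) ^ (n * s)) * diffSum r (h n) F ^ 2 ≤ C * sobolevSq s F := by
  obtain ⟨C, hC⟩ := exists_tsum_dyadic_le hs hr
  refine ⟨(r + 1 : ℕ) * (r + 1 : ℕ) * 4 ^ r * C, fun F hF h hn => ?_⟩
  set K : ℝ≥0∞ := (r + 1 : ℕ) * (r + 1 : ℕ) * 4 ^ r with hK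
  have hKt : K ≠ ∞ := by rw [hK]; finiteness
  set A : Vel N → ℝ := fun ξ => Real.sqrt (1 + (2 * Real.pi * ‖ξ‖) ^ 2) with hA
  have hA1 : ∀ ξ, 1 ≤ A ξ := fun ξ =>
    Real.one_le_sqrt.2 (by nlinarith [sq_nonneg (2 * Real.pi * ‖ξ‖)])
  have hAs : ∀ ξ, A ξ ^ (2 * s) = (1 + (2 * Real.pi * ‖ξ‖) ^ 2) ^ s := fun ξ => by
    rw [Real.rpow_mul (by have := hA1 ξ; linarith), hA, Real.rpow_two, Real.sq_sqrt (by positivity)]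
  have hmeas : ∀ n : ℕ, AEMeasurable (fun ξ : Vel N => ENNReal.ofReal ((4 : ℝ) ^ (n * s) *
      (min 1 ((1 / 2) ^ n * A ξ) ^ r) ^ 2) * ‖fourierL2 F ξ‖ₑ ^ 2) volume := fun n => by
    refine AEMeasurable.mul (Measurable.aemeasurable ?_) ((measurable_fourierL2 F).pow_const 2)
    exact ENNReal.measurable_ofReal.comp (Continuous.measurable (by fun_prop))
  calc _ ≤ ∑' n : ℕ, ENNReal.ofReal ((4 : ℝ) ^ (n * s)) * (K *
        ∫⁻ ξ, ENNReal.ofReal ((min 1 ((1 / 2) ^ n * A ξ) ^ r) ^ 2) * ‖fourierL2 F ξ‖ₑ ^ 2) :=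
        ENNReal.tsum_le_tsum fun n => mul_le_mul_right (sq_diffSum_le hF (hn n) r) _
    _ = K * ∑' n : ℕ, ∫⁻ ξ, ENNReal.ofReal ((4 : ℝ) ^ (n * s) *
        (min 1 ((1 / 2) ^ n * A ξ) ^ r) ^ 2) * ‖fourierL2 F ξ‖ₑ ^ 2 := by
        rw [← ENNReal.tsum_mul_left]
        refine tsum_congr fun n => ?_
        rw [mul_left_comm, ← lintegral_const_mul' _ _ ENNReal.ofReal_ne_top]
        refine congrArg _ (lintegral_congr fun ξ => ?_)
        rw [← mul_assoc, ENNReal.ofReal_mul (by positivity)]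
    _ = K * ∫⁻ ξ, ∑' n : ℕ, ENNReal.ofReal ((4 : ℝ) ^ (n * s) *
        (min 1 ((1 / 2) ^ n * A ξ) ^ r) ^ 2) * ‖fourierL2 F ξ‖ₑ ^ 2 := by
        rw [lintegral_tsum hmeas]
    _ ≤ K * ∫⁻ ξ, C * (ENNReal.ofReal ((1 + (2 * Real.pi * ‖ξ‖) ^ 2) ^ s) * ‖fourierL2 F ξ‖ₑ ^ 2) := by
        refine mul_le_mul_right (lintegral_mono fun ξ => ?_) _
        rw [ENNReal.tsum_mul_right, ← mul_assoc, ← hAs]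
        exact mul_le_mul_left (hC (A ξ) (hA1 ξ)) _
    _ = _ := by
        rw [lintegral_const_mul' _ _ ENNReal.coe_ne_top, sobolevSq, hK]
        push_cast
        ring

theorem sq_eLpNorm_le_sobolevSq {s : ℝ} (hs : 0 ≤ s) {F : Vel N → ℂ}
    (hF : MemLp F 2 (volume : Measure (Vel N))) : eLpNorm F 2 volume ^ 2 ≤ sobolevSq s F := by
  rw [← eLpNorm_fourierL2 hF, eLpNorm_two_sq]
  refine lintegral_mono fun ξ => le_mul_of_one_le_left zero_le ?_
  exact ENNReal.one_le_ofReal.2 (Real.one_le_rpow (by nlinarith [sq_nonneg (2 * Real.pi * ‖ξ‖)]) hs)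

end UpperBound

/-! ### Dyadic sums of differences control high frequencies -/

section HighFrequency

variable {N : ℕ} [NeZero N]

/-- The pointwise dyadic lower bound, integrated with Plancherel. The cut-off √N forces some |ξ_i| ≥
1, so that a dyadic step of length at most 1 is comparable to 1/|ξ_i|. -/
theorem lintegral_highFrequency_le {u : Vel N → ℂ} (hu : Integrable u volume) {s : ℝ} (hs : 0 ≤ s)
    (M : ℕ) : ∫⁻ ξ in {ξ : Vel N | Real.sqrt N ≤ ‖ξ‖}, ENNReal.ofReal (‖ξ‖ ^ (2 * s)) * ‖𝓕 u ξ‖ₑ ^ 2 ≤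
      ENNReal.ofReal ((N : ℝ) ^ s) * ∑ i : Fin N, ∑' n : ℕ, ENNReal.ofReal ((4 : ℝ) ^ (n * s)) *
        eLpNorm ((fwdDiff (dyadicStep i n))^[M] u) 2 volume ^ 2 := by
  have hm : ∀ i : Fin N, ∀ n : ℕ, Measurable fun ξ => ENNReal.ofReal ((4 : ℝ) ^ (n * s)) *
      ((‖diffSymbol (dyadicStep i n) ξ‖ₑ ^ M) ^ 2 * ‖𝓕 u ξ‖ₑ ^ 2) := fun i n => by
    have h1 := (continuous_diffSymbol (dyadicStep i n)).measurable
    have h2 := (continuous_fourier hu).measurable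
    fun_prop
  have hS : MeasurableSet {ξ : Vel N | Real.sqrt N ≤ ‖ξ‖} :=
    measurableSet_le measurable_const measurable_norm
  calc _ ≤ ∫⁻ ξ in {ξ : Vel N | Real.sqrt N ≤ ‖ξ‖}, ENNReal.ofReal ((N : ℝ) ^ s) *
        ∑ i : Fin N, ∑' n : ℕ, ENNReal.ofReal ((4 : ℝ) ^ (n * s)) *
        ((‖diffSymbol (dyadicStep i n) ξ‖ₑ ^ M) ^ 2 * ‖𝓕 u ξ‖ₑ ^ 2) := by
        refine setLIntegral_mono' hS fun ξ hξ => ?_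
        refine (mul_le_mul_left (rpow_le_tsum_diffSymbol hs M hξ) _).trans (le_of_eq ?_)
        simp only [← mul_assoc, ENNReal.tsum_mul_right, Finset.sum_mul, Finset.mul_sum]
    _ ≤ ∫⁻ ξ, ENNReal.ofReal ((N : ℝ) ^ s) *
        ∑ i : Fin N, ∑' n : ℕ, ENNReal.ofReal ((4 : ℝ) ^ (n * s)) *
        ((‖diffSymbol (dyadicStep i n) ξ‖ₑ ^ M) ^ 2 * ‖𝓕 u ξ‖ₑ ^ 2) := setLIntegral_le_lintegral _ _
    _ = _ := by
        rw [lintegral_const_mul' _ _ ENNReal.ofReal_ne_top, lintegral_finsetSum _ fun i _ =>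
          Measurable.tsum (hm i)]
        refine congrArg _ (Finset.sum_congr rfl fun i _ => ?_)
        rw [lintegral_tsum fun n => (hm i n).aemeasurable]
        refine tsum_congr fun n => ?_
        rw [lintegral_const_mul' _ _ ENNReal.ofReal_ne_top,
          ← eLpNorm_fourier_eq (integrable_fwdDiff_iter hu _ M), eLpNorm_two_sq]
        refine congrArg _ (lintegral_congr fun ξ => ?_)
        rw [fourier_fwdDiff_iter hu, enorm_mul, enorm_pow, mul_pow]

theorem sq_eLpNorm_rpow_mul (v : Vel N → ℂ) : eLpNorm (fun ξ => ((‖ξ‖ ^ (((N : ℝ) - 1) / 2) : ℝ) : ℂ) *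
      v ξ) 2 volume ^ 2 = ∫⁻ ξ, ENNReal.ofReal (‖ξ‖ ^ ((N : ℝ) - 1)) * ‖v ξ‖ₑ ^ 2 := by
  rw [eLpNorm_two_sq]
  refine lintegral_congr fun ξ => ?_
  rw [enorm_mul, mul_pow, enorm_ofReal, Real.enorm_of_nonneg (by positivity),
    ← ENNReal.ofReal_pow (by positivity), ← Real.rpow_mul_natCast (norm_nonneg _)]
  norm_num

end HighFrequency

/-- The data of a gain operator with measurable arguments, whose weighted tensor is integrable and
whose angular kernel has square integral at most `B` around every axis. -/
structure RegularGain {N : ℕ} (η : ℝ) (B : ℝ≥0∞) (γ : ℝ≥0) (Φ : ℝ≥0 → ℝ) (b : ℝ → ℝ)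
    (g f : Vel N → ℂ) : Prop where
  le_two : γ ≤ 2
  map_zero : Φ 0 = 0
  memHolder : MemHolder γ Φ
  measurable_left : Measurable g
  measurable_right : Measurable f
  measurable_kernel : Measurable b
  bound_ne_top : B ≠ ∞
  bound : ∀ e : Sph N,
    ∫⁻ ω : Sph N, ENNReal.ofReal (b (inner ℝ (ω : Vel N) e) ^ 2) ∂surfaceMeasure N ≤ B
  measurable_tensor : Measurable fun p : Vel N × Vel N => gainTensor Φ g f p.1 p.2
  integrable : Integrable (fun p : Vel N × Vel N =>
    ((energyWeight p.1 p.2 ^ η : ℝ) : ℂ) * gainTensor Φ g f p.1 p.2) (volume.prod volume)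

/-! ### Differences of the weighted gain -/

section Assembly

variable {N : ℕ} [NeZero N] {η : ℝ} {B : ℝ≥0∞} {γ : ℝ≥0} {Φ : ℝ≥0 → ℝ} {b : ℝ → ℝ} {g f : Vel N → ℂ}

theorem RegularGain.integrable_weighted (hη : 0 ≤ η) (R : RegularGain η B γ Φ b g f) :
    Integrable (weighted η (collisionOp b (gainTensor Φ g f))) volume :=
  integrable_weighted_collisionOp (integrable_weightedIntegrand hη R.measurable_kernel R.bound_ne_top
    R.bound R.measurable_tensor R.integrable)

/-- The bilinear expression in the difference sums which bounds the smoothness of the tensor. -/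
def tensorDiff (r : ℕ) (h : Vel N) (F G : Vel N → ℂ) : ℝ≥0∞ :=
  diffSum r h G * eLpNorm F 2 volume + eLpNorm G 2 volume * diffSum r h F

theorem exists_sq_pow_mul_eLpNorm_fourier_le (N r : ℕ) [NeZero N] {η : ℝ} (hη : 0 ≤ η) : ∃ C : ℝ≥0,
    ∀ (B : ℝ≥0∞) (γ : ℝ≥0) (Φ : ℝ≥0 → ℝ) (b : ℝ → ℝ) (g f : Vel N → ℂ), RegularGain η B γ Φ b g f →
      ∀ h : Vel N, ‖h‖ ≤ 1 → ∀ j ≤ 2 * r,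
      (‖h‖ₑ ^ (2 * r - j) * eLpNorm (fun ξ => ((‖ξ‖ ^ (((N : ℝ) - 1) / 2) : ℝ) : ℂ) *
        𝓕 (weighted η ((fwdDiff h)^[j] (collisionOp b (gainTensor Φ g f)))) ξ) 2 volume) ^ 2 ≤
      C * (B * (nnHolderNorm γ Φ * tensorDiff r h (weighted (η + γ + 1) f)
        (weighted (η + γ + 1) g)) ^ 2) := by
  obtain ⟨C₁, hC₁⟩ := exists_lintegral_fourier_collisionOp_le N η hη
  obtain ⟨C₂, hC₂⟩ := exists_pow_mul_eLpNorm_fwdDiff_gainTensor_le N r hη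
  refine ⟨C₁ * C₂ ^ 2, fun B γ Φ b g f R h hh j hj => ?_⟩
  have e : 𝓕 (weighted η ((fwdDiff h)^[j] (collisionOp b (gainTensor Φ g f)))) =
      𝓕 (weighted η (collisionOp b ((fwdDiff h)^[j] (gainTensor Φ g f)))) := by
    ext ξ
    rw [Real.fourier_eq, Real.fourier_eq]
    refine integral_congr_ae ?_
    filter_upwards [collisionOp_fwdDiff_iter_ae hη R.measurable_kernel R.bound_ne_top R.bound
      R.measurable_tensor R.integrable h j] with v hv
    simp only [weighted, hv]
  have h1 := hC₁ b R.measurable_kernel B R.bound_ne_top R.bound _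
    (measurable_fwdDiff_iter_left R.measurable_tensor h j)
    (integrable_energyWeight_fwdDiff_iter hη R.measurable_tensor R.integrable h j)
  have h2 := hC₂ γ R.le_two Φ R.map_zero R.memHolder g f R.measurable_left R.measurable_right h hh j hj
  rw [mul_pow, sq_eLpNorm_rpow_mul, e]
  rw [← eLpNorm_two_sq] at h1
  set X := eLpNorm (fun p : Vel N × Vel N => ((bracket p.2 * energyWeight p.1 p.2 ^ η : ℝ) : ℂ) *
    (fwdDiff h)^[j] (gainTensor Φ g f) p.1 p.2) 2 (volume.prod volume)
  calc _ ≤ (‖h‖ₑ ^ (2 * r - j)) ^ 2 * (C₁ * B * X ^ 2) := mul_le_mul_right h1 _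
    _ = C₁ * B * (‖h‖ₑ ^ (2 * r - j) * X) ^ 2 := by ring
    _ ≤ C₁ * B * (C₂ * nnHolderNorm γ Φ * tensorDiff r h (weighted (η + γ + 1) f)
        (weighted (η + γ + 1) g)) ^ 2 := mul_le_mul_right (pow_le_pow_left₀ zero_le h2 2) _
    _ = _ := by push_cast; ring

/-- Of the `N + 2r` differences, at most `2r` act on the tensor under the averaging estimate, and at
most `N ≥ (N-1)/2` are exchanged for |h|^{(N-1)/2}. The low frequencies contribute the L¹ term with
the full power of `‖h‖`. -/
theorem exists_sq_eLpNorm_fwdDiff_gain_le (N r : ℕ) [NeZero N] {η : ℝ} (hη : 0 ≤ η) : ∃ C : ℝ≥0,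
    ∀ (B : ℝ≥0∞) (γ : ℝ≥0) (Φ : ℝ≥0 → ℝ) (b : ℝ → ℝ) (g f : Vel N → ℂ), RegularGain η B γ Φ b g f →
      ∀ h : Vel N, ‖h‖ ≤ 1 →
      eLpNorm ((fwdDiff h)^[N + 2 * r] (weighted η (collisionOp b (gainTensor Φ g f)))) 2 volume ^ 2 ≤
      C * ((‖h‖ₑ ^ (N + 2 * r) *
        eLpNorm (weighted η (collisionOp b (gainTensor Φ g f))) 1 volume) ^ 2 +
        ENNReal.ofReal (‖h‖ ^ (((N : ℝ) - 1) / 2)) ^ 2 *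
        (B * (nnHolderNorm γ Φ * tensorDiff r h (weighted (η + γ + 1) f)
          (weighted (η + γ + 1) g)) ^ 2)) := by
  obtain ⟨C₁, hC₁⟩ := exists_sq_pow_mul_eLpNorm_fourier_le N r hη
  have hN : (1 : ℝ) ≤ N := by exact_mod_cast NeZero.one_le
  obtain ⟨C₂, hC₂⟩ := exists_eLpNorm_fwdDiff_le N (2 * r) hη (σ := ((N : ℝ) - 1) / 2)
    (by linarith) (by linarith)
  refine ⟨C₂ ^ 2 * 2 * (1 + (2 * r + 1 : ℕ) * ((2 * r + 1 : ℕ) * C₁)), fun B γ Φ b g f R h hh => ?_⟩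
  have h1 := hC₂ h hh (collisionOp b (gainTensor Φ g f)) (R.integrable_weighted hη)
  have h2 := hC₁ B γ Φ b g f R h hh
  set T := B * (nnHolderNorm γ Φ * tensorDiff r h (weighted (η + γ + 1) f)
    (weighted (η + γ + 1) g)) ^ 2
  set U := eLpNorm (weighted η (collisionOp b (gainTensor Φ g f))) 1 volume
  set Z : ℕ → ℝ≥0∞ := fun j => ‖h‖ₑ ^ (2 * r - j) *
    eLpNorm (fun ξ => ((‖ξ‖ ^ (((N : ℝ) - 1) / 2) : ℝ) : ℂ) *
        𝓕 (weighted η ((fwdDiff h)^[j] (collisionOp b (gainTensor Φ g f)))) ξ) 2 volume with hZ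
  set ε := ENNReal.ofReal (‖h‖ ^ (((N : ℝ) - 1) / 2))
  have h3 : (∑ i ∈ Finset.range (2 * r + 1), Z i) ^ 2 ≤ (2 * r + 1 : ℕ) * ((2 * r + 1 : ℕ) * (C₁ * T)) := by
    refine (sq_sum_le _ _).trans ?_
    rw [Finset.card_range]
    refine mul_le_mul_right ?_ _
    refine (Finset.sum_le_card_nsmul _ _ (C₁ * T) fun i hi => ?_).trans ?_
    · exact h2 i (Nat.lt_succ_iff.1 (Finset.mem_range.1 hi))
    · rw [Finset.card_range, nsmul_eq_mul]
  calc _ ≤ (C₂ * (‖h‖ₑ ^ (N + 2 * r) * U + ε * ∑ i ∈ Finset.range (2 * r + 1), Z i)) ^ 2 :=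
        pow_le_pow_left₀ zero_le h1 2
    _ = C₂ ^ 2 * (‖h‖ₑ ^ (N + 2 * r) * U + ε * ∑ i ∈ Finset.range (2 * r + 1), Z i) ^ 2 := by ring
    _ ≤ C₂ ^ 2 * (2 * ((‖h‖ₑ ^ (N + 2 * r) * U) ^ 2 +
        (ε * ∑ i ∈ Finset.range (2 * r + 1), Z i) ^ 2)) := mul_le_mul_right (add_sq_le_two_mul _ _) _
    _ ≤ C₂ ^ 2 * (2 * ((‖h‖ₑ ^ (N + 2 * r) * U) ^ 2 +
        ε ^ 2 * ((2 * r + 1 : ℕ) * ((2 * r + 1 : ℕ) * (C₁ * T))))) := by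
        rw [mul_pow ε]
        exact mul_le_mul_right (mul_le_mul_right (add_le_add_right (mul_le_mul_right h3 _) _) _) _
    _ = C₂ ^ 2 * 2 * ((‖h‖ₑ ^ (N + 2 * r) * U) ^ 2 +
        ((2 * r + 1 : ℕ) * ((2 * r + 1 : ℕ) * C₁)) * (ε ^ 2 * T)) := by ring
    _ ≤ C₂ ^ 2 * 2 * ((1 + (2 * r + 1 : ℕ) * ((2 * r + 1 : ℕ) * C₁)) * (‖h‖ₑ ^ (N + 2 * r) * U) ^ 2 +
        (1 + (2 * r + 1 : ℕ) * ((2 * r + 1 : ℕ) * C₁)) * (ε ^ 2 * T)) := by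
        refine mul_le_mul_right (add_le_add (le_mul_of_one_le_left zero_le le_self_add)
          (mul_le_mul_left le_add_self _)) _
    _ = _ := by push_cast; ring

end Assembly

/-! ### Summation over dyadic steps -/

section Summation

variable {N : ℕ}

theorem exists_tsum_sq_tensorDiff_le (N : ℕ) {s : ℝ} (hs : 0 < s) {r : ℕ} (hr : s < r) : ∃ C : ℝ≥0,
    ∀ F G : Vel N → ℂ, MemLp F 2 (volume : Measure (Vel N)) → MemLp G 2 (volume : Measure (Vel N)) →
      ∀ h : ℕ → Vel N, (∀ n, ‖h n‖ = (1 / 2 : ℝ) ^ n) →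
      ∑' n : ℕ, ENNReal.ofReal ((4 : ℝ) ^ (n * s)) * tensorDiff r (h n) F G ^ 2 ≤
        C * (sobolevSq s G * sobolevSq s F) := by
  obtain ⟨C, hC⟩ := exists_tsum_sq_diffSum_le N hs hr
  refine ⟨4 * C, fun F G hF hG h hn => ?_⟩
  have h1 := hC F hF h hn
  have h2 := hC G hG h hn
  have hF2 := sq_eLpNorm_le_sobolevSq hs.le hF
  have hG2 := sq_eLpNorm_le_sobolevSq hs.le hG
  set a : ℕ → ℝ≥0∞ := fun n => ENNReal.ofReal ((4 : ℝ) ^ (n * s)) * diffSum r (h n) F ^ 2 with ha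
  set a' : ℕ → ℝ≥0∞ := fun n => ENNReal.ofReal ((4 : ℝ) ^ (n * s)) * diffSum r (h n) G ^ 2 with ha'
  set x := eLpNorm F 2 volume
  set y := eLpNorm G 2 volume
  calc _ ≤ ∑' n, 2 * (x ^ 2 * a' n + y ^ 2 * a n) := by
        refine ENNReal.tsum_le_tsum fun n => ?_
        calc _ ≤ ENNReal.ofReal ((4 : ℝ) ^ (n * s)) * (2 * ((diffSum r (h n) G * x) ^ 2 +
            (y * diffSum r (h n) F) ^ 2)) := mul_le_mul_right (add_sq_le_two_mul _ _) _
          _ = _ := by simp only [ha, ha']; ring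
    _ = 2 * (x ^ 2 * (∑' n, a' n) + y ^ 2 * ∑' n, a n) := by
        rw [ENNReal.tsum_mul_left, ENNReal.tsum_add, ENNReal.tsum_mul_left, ENNReal.tsum_mul_left]
    _ ≤ 2 * (sobolevSq s F * (C * sobolevSq s G) + sobolevSq s G * (C * sobolevSq s F)) := by
        exact mul_le_mul_right (add_le_add (mul_le_mul' hF2 h2) (mul_le_mul' hG2 h1)) _
    _ = _ := by push_cast; ring

/-- Makes the L¹ contribution summable: the terms are 4^{n(t - M)}, geometric because the order of
the differences exceeds the smoothness. -/
theorem exists_tsum_pow_le {t : ℝ} {M : ℕ} (ht : t < M) : ∃ C : ℝ≥0, ∀ h : ℕ → Vel N,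
    (∀ n, ‖h n‖ = (1 / 2 : ℝ) ^ n) →
    ∑' n : ℕ, ENNReal.ofReal ((4 : ℝ) ^ (n * t)) * (‖h n‖ₑ ^ M) ^ 2 ≤ C := by
  set ρ : ℝ := 4 ^ (t - M) with hρ
  have hρ0 : 0 < ρ := by positivity
  have hρ1 : ρ < 1 := Real.rpow_lt_one_of_one_lt_of_neg (by norm_num) (by linarith)
  have hfin : ∑' n : ℕ, ENNReal.ofReal ρ ^ n ≠ ∞ := by
    rw [ENNReal.tsum_geometric]
    refine ENNReal.inv_ne_top.2 (tsub_pos_of_lt ?_).ne'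
    exact (ENNReal.ofReal_lt_ofReal_iff one_pos).2 hρ1 |>.trans_eq ENNReal.ofReal_one
  refine ⟨(∑' n : ℕ, ENNReal.ofReal ρ ^ n).toNNReal, fun h hn => ?_⟩
  rw [ENNReal.coe_toNNReal hfin]
  refine ENNReal.tsum_le_tsum fun n => le_of_eq ?_
  rw [← ofReal_norm, hn n, one_div, ← ENNReal.ofReal_pow (by positivity),
    ← ENNReal.ofReal_pow (by positivity), ← ENNReal.ofReal_mul (by positivity),
    ← ENNReal.ofReal_pow hρ0.le]
  congr 1
  rw [hρ, ← Real.rpow_mul_natCast (by norm_num), sub_mul, Real.rpow_sub (by norm_num), mul_comm t,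
    div_eq_mul_inv]
  congr 1
  rw [← Nat.cast_mul, Real.rpow_natCast, ← pow_mul, ← pow_mul, inv_pow,
    show (4 : ℝ) = 2 ^ 2 by norm_num, ← pow_mul]
  congr 2; ring

/-- The gain at work: the factor |h|^{2t}, with t = (N-1)/2 in the application, lowers the dyadic
weight from smoothness s + t to smoothness s. -/
theorem ofReal_rpow_mul_dyadic {h : Vel N} {n : ℕ} (hn : ‖h‖ = (1 / 2 : ℝ) ^ n) (s t : ℝ) :
    ENNReal.ofReal ((4 : ℝ) ^ (n * (s + t))) * ENNReal.ofReal (‖h‖ ^ t) ^ 2 =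
      ENNReal.ofReal ((4 : ℝ) ^ (n * s)) := by
  rw [← ENNReal.ofReal_pow (by positivity), ← ENNReal.ofReal_mul (by positivity)]
  congr 1
  have e : (‖h‖ ^ t) ^ 2 = (4 : ℝ) ^ (-(n * t)) := by
    rw [hn, ← Real.rpow_mul_natCast (by positivity), ← Real.rpow_natCast_mul (by norm_num), one_div,
      Real.inv_rpow (by norm_num), ← Real.rpow_neg (by norm_num),
      show (4 : ℝ) = 2 ^ (2 : ℝ) by norm_num, ← Real.rpow_mul (by norm_num)]
    congr 1; push_cast; ring
  rw [e, ← Real.rpow_add (by norm_num)]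
  congr 1; ring

/-- The order of differences is `N + 2r` with an integer `r > s`. It exceeds s + (N-1)/2, so the L¹
term sums, and `r > s` lets the H^s norms bound the sums of tensor differences. -/
theorem exists_lintegral_highFrequency_gain_le_of_pos (N : ℕ) [NeZero N] {s η : ℝ} (hs : 0 < s)
    (hη : 0 ≤ η) : ∃ C : ℝ≥0,
    ∀ (B : ℝ≥0∞) (γ : ℝ≥0) (Φ : ℝ≥0 → ℝ) (b : ℝ → ℝ) (g f : Vel N → ℂ), RegularGain η B γ Φ b g f →
      MemLp (weighted (η + γ + 1) g) 2 (volume : Measure (Vel N)) →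
      MemLp (weighted (η + γ + 1) f) 2 (volume : Measure (Vel N)) →
      ∫⁻ ξ in {ξ : Vel N | Real.sqrt N ≤ ‖ξ‖}, ENNReal.ofReal (‖ξ‖ ^ (2 * (s + ((N : ℝ) - 1) / 2))) *
        ‖𝓕 (weighted η (collisionOp b (gainTensor Φ g f))) ξ‖ₑ ^ 2 ≤
      C * (eLpNorm (weighted η (collisionOp b (gainTensor Φ g f))) 1 volume ^ 2 +
        B * nnHolderNorm γ Φ ^ 2 * (sobolevSq s (weighted (η + γ + 1) g) *
          sobolevSq s (weighted (η + γ + 1) f))) := by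
  obtain ⟨r, hr⟩ := exists_nat_gt s
  have hN : (1 : ℝ) ≤ N := by exact_mod_cast NeZero.one_le
  set t : ℝ := ((N : ℝ) - 1) / 2 with ht
  obtain ⟨C₁, hC₁⟩ := exists_sq_eLpNorm_fwdDiff_gain_le N r hη
  obtain ⟨C₂, hC₂⟩ := exists_tsum_sq_tensorDiff_le N hs hr
  obtain ⟨C₃, hC₃⟩ := exists_tsum_pow_le (N := N) (t := s + t) (M := N + 2 * r)
    (by push_cast; linarith)
  refine ⟨((N : ℝ) ^ (s + t)).toNNReal * N * C₁ * (C₃ + C₂), fun B γ Φ b g f R hG hF => ?_⟩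
  set F := weighted (η + γ + 1) f
  set G := weighted (η + γ + 1) g
  set u := weighted η (collisionOp b (gainTensor Φ g f)) with hu
  have hui : Integrable u volume := R.integrable_weighted hη
  set A := B * nnHolderNorm γ Φ ^ 2 with hA
  have h1 := lintegral_highFrequency_le hui (s := s + t) (by linarith) (N + 2 * r)
  refine h1.trans ?_
  have hterm : ∀ i : Fin N, ∑' n : ℕ, ENNReal.ofReal ((4 : ℝ) ^ (n * (s + t))) *
      eLpNorm ((fwdDiff (dyadicStep i n))^[N + 2 * r] u) 2 volume ^ 2 ≤
      C₁ * ((C₃ + C₂) * (eLpNorm u 1 volume ^ 2 + A * (sobolevSq s G * sobolevSq s F))) := by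
    intro i
    have hn : ∀ n, ‖dyadicStep (N := N) i n‖ = (1 / 2 : ℝ) ^ n := norm_dyadicStep i
    have h3 := hC₃ _ hn
    have h2 := hC₂ F G hF hG _ hn
    calc _ ≤ ∑' n : ℕ, C₁ * (ENNReal.ofReal ((4 : ℝ) ^ (n * (s + t))) *
          (‖dyadicStep (N := N) i n‖ₑ ^ (N + 2 * r)) ^ 2 * eLpNorm u 1 volume ^ 2 +
          A * (ENNReal.ofReal ((4 : ℝ) ^ (n * s)) * tensorDiff r (dyadicStep i n) F G ^ 2)) := by
          refine ENNReal.tsum_le_tsum fun n => ?_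
          have h4 := hC₁ B γ Φ b g f R (dyadicStep i n)
            ((hn n).trans_le (pow_le_one₀ (by norm_num) (by norm_num)))
          refine (mul_le_mul_right h4 _).trans (le_of_eq ?_)
          rw [← ofReal_rpow_mul_dyadic (hn n) s t]
          ring
      _ = C₁ * ((∑' n : ℕ, ENNReal.ofReal ((4 : ℝ) ^ (n * (s + t))) *
          (‖dyadicStep (N := N) i n‖ₑ ^ (N + 2 * r)) ^ 2) * eLpNorm u 1 volume ^ 2 +
          A * ∑' n : ℕ, ENNReal.ofReal ((4 : ℝ) ^ (n * s)) *
            tensorDiff r (dyadicStep i n) F G ^ 2) := by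
          rw [ENNReal.tsum_mul_left, ENNReal.tsum_add, ENNReal.tsum_mul_left, ENNReal.tsum_mul_right]
      _ ≤ C₁ * (C₃ * eLpNorm u 1 volume ^ 2 + A * (C₂ * (sobolevSq s G * sobolevSq s F))) :=
          mul_le_mul_right (add_le_add (mul_le_mul_left h3 _) (mul_le_mul_right h2 _)) _
      _ = C₁ * (C₃ * eLpNorm u 1 volume ^ 2 + C₂ * (A * (sobolevSq s G * sobolevSq s F))) := by
          ring
      _ ≤ C₁ * ((C₃ + C₂) * eLpNorm u 1 volume ^ 2 +
          (C₃ + C₂) * (A * (sobolevSq s G * sobolevSq s F))) :=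
          mul_le_mul_right (add_le_add (mul_le_mul_left le_self_add _)
            (mul_le_mul_left le_add_self _)) _
      _ = _ := by ring
  calc _ ≤ ENNReal.ofReal ((N : ℝ) ^ (s + t)) * (N * (C₁ * ((C₃ + C₂) *
        (eLpNorm u 1 volume ^ 2 + A * (sobolevSq s G * sobolevSq s F))))) := by
        refine mul_le_mul_right ?_ _
        refine (Finset.sum_le_card_nsmul _ _ _ fun i _ => hterm i).trans ?_
        rw [Finset.card_univ, Fintype.card_fin, nsmul_eq_mul]
    _ = _ := by
        rw [ENNReal.ofReal]
        push_cast
        ring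

/-- For `s = 0` the geometric ratio 4^{-s} degenerates to 1, but no differences are needed: the
averaging estimate is used directly, as the case `r = j = 0`. -/
theorem exists_lintegral_highFrequency_gain_le (N : ℕ) [NeZero N] {s η : ℝ} (hs : 0 ≤ s)
    (hη : 0 ≤ η) : ∃ C : ℝ≥0,
    ∀ (B : ℝ≥0∞) (γ : ℝ≥0) (Φ : ℝ≥0 → ℝ) (b : ℝ → ℝ) (g f : Vel N → ℂ), RegularGain η B γ Φ b g f →
      MemLp (weighted (η + γ + 1) g) 2 (volume : Measure (Vel N)) →
      MemLp (weighted (η + γ + 1) f) 2 (volume : Measure (Vel N)) →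
      ∫⁻ ξ in {ξ : Vel N | Real.sqrt N ≤ ‖ξ‖}, ENNReal.ofReal (‖ξ‖ ^ (2 * (s + ((N : ℝ) - 1) / 2))) *
        ‖𝓕 (weighted η (collisionOp b (gainTensor Φ g f))) ξ‖ₑ ^ 2 ≤
      C * (eLpNorm (weighted η (collisionOp b (gainTensor Φ g f))) 1 volume ^ 2 +
        B * nnHolderNorm γ Φ ^ 2 * (sobolevSq s (weighted (η + γ + 1) g) *
          sobolevSq s (weighted (η + γ + 1) f))) := by
  rcases hs.lt_or_eq with hs' | rfl
  · exact exists_lintegral_highFrequency_gain_le_of_pos N hs' hη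
  obtain ⟨C, hC⟩ := exists_sq_pow_mul_eLpNorm_fourier_le N 0 hη
  -- For `r = 0` the two terms of `tensorDiff` coincide; 4 is the square of that factor 2.
  refine ⟨4 * C, fun B γ Φ b g f R hG hF => ?_⟩
  have h1 := hC B γ Φ b g f R 0 (by simp) 0 le_rfl
  have hF2 := sq_eLpNorm_le_sobolevSq le_rfl hF
  have hG2 := sq_eLpNorm_le_sobolevSq le_rfl hG
  set F := weighted (η + γ + 1) f
  set G := weighted (η + γ + 1) g
  rw [tensorDiff, diffSum, diffSum] at h1
  simp only [mul_zero, zero_add, Finset.range_one, Finset.sum_singleton, Nat.sub_self, pow_zero,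
    Function.iterate_zero, id_eq, one_mul] at h1
  rw [sq_eLpNorm_rpow_mul] at h1
  simp only [zero_add, mul_div_cancel₀ ((N : ℝ) - 1) (two_ne_zero' ℝ)]
  calc _ ≤ _ := setLIntegral_le_lintegral _ _
    _ ≤ _ := h1
    _ = 4 * C * (B * nnHolderNorm γ Φ ^ 2 * (eLpNorm G 2 volume ^ 2 * eLpNorm F 2 volume ^ 2)) := by
        ring
    _ ≤ 4 * C * (B * nnHolderNorm γ Φ ^ 2 * (sobolevSq 0 G * sobolevSq 0 F)) :=
        mul_le_mul_right (mul_le_mul_right (mul_le_mul' hG2 hF2) _) _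
    _ ≤ _ := by
        push_cast
        exact mul_le_mul_right le_add_self _

end Summation

/-! ### Weighted Sobolev norms and low frequencies -/

section SobolevNorm

variable {N : ℕ}

theorem MemH.memLp {s k : ℝ} {f : Vel N → ℂ} (h : MemH s k f) :
    MemLp (weighted k f) 2 (volume : Measure (Vel N)) := by
  by_contra hn
  simp [MemH, normH, hn] at h

theorem sq_normH {s k : ℝ} {f : Vel N → ℂ} (h : MemLp (weighted k f) 2 (volume : Measure (Vel N))) :
    normH s k f ^ 2 = sobolevSq s (weighted k f) := by
  rw [normH, dif_pos h, ← fourierL2_of_memLp h, eLpNorm_two_sq, sobolevSq]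
  refine lintegral_congr fun ξ => ?_
  rw [enorm_mul, mul_pow, enorm_ofReal, Real.enorm_of_nonneg (by positivity),
    ← ENNReal.ofReal_pow (by positivity), ← Real.rpow_mul_natCast (by positivity)]
  norm_num

theorem weighted_congr {k : ℝ} {f g : Vel N → ℂ} (h : f =ᵐ[volume] g) :
    weighted k f =ᵐ[volume] weighted k g := by
  filter_upwards [h] with v hv
  simp only [weighted, hv]

theorem normH_congr {s k : ℝ} {f g : Vel N → ℂ} (h : f =ᵐ[volume] g) : normH s k f = normH s k g := by
  have hw := weighted_congr (k := k) h
  by_cases hf : MemLp (weighted k f) 2 (volume : Measure (Vel N))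
  · have hg := (memLp_congr_ae hw).1 hf
    rw [normH, normH, dif_pos hf, dif_pos hg, ← fourierL2_of_memLp hf, ← fourierL2_of_memLp hg,
      fourierL2_congr hw]
  · have hg : ¬ MemLp (weighted k g) 2 (volume : Measure (Vel N)) :=
      fun hg => hf ((memLp_congr_ae hw).2 hg)
    rw [normH, normH, dif_neg hf, dif_neg hg]

theorem enorm_fourier_le (u : Vel N → ℂ) (ξ : Vel N) : ‖𝓕 u ξ‖ₑ ≤ eLpNorm u 1 volume := by
  rw [Real.fourier_eq, eLpNorm_one_eq_lintegral_enorm]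
  refine (enorm_integral_le_lintegral_enorm _).trans (le_of_eq (lintegral_congr fun v => ?_))
  rw [← ofReal_norm, Circle.norm_smul, ofReal_norm]

/-- On the ball |ξ| < √N, of finite volume, the transform is bounded by the L¹ norm; outside it |ξ|
≥ 1, so 1 + |2πξ|² is comparable to |ξ|². -/
theorem exists_lintegral_fourier_le_highFrequency (N : ℕ) [NeZero N] {t : ℝ} (ht : 0 ≤ t) :
    ∃ C : ℝ≥0, ∀ u : Vel N → ℂ,
      ∫⁻ ξ, ENNReal.ofReal ((1 + (2 * Real.pi * ‖ξ‖) ^ 2) ^ t) * ‖𝓕 u ξ‖ₑ ^ 2 ≤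
      C * (eLpNorm u 1 volume ^ 2 + ∫⁻ ξ in {ξ : Vel N | Real.sqrt N ≤ ‖ξ‖},
        ENNReal.ofReal (‖ξ‖ ^ (2 * t)) * ‖𝓕 u ξ‖ₑ ^ 2) := by
  have hN : (1 : ℝ) ≤ N := by exact_mod_cast NeZero.one_le
  have hN' : (1 : ℝ) ≤ Real.sqrt N := Real.one_le_sqrt.2 hN
  set S := {ξ : Vel N | Real.sqrt N ≤ ‖ξ‖} with hS
  have hSm : MeasurableSet S := measurableSet_le measurable_const measurable_norm
  have hV : volume Sᶜ ≠ ∞ := by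
    refine ((measure_mono fun ξ hξ => ?_).trans_lt
      (measure_ball_lt_top (μ := (volume : Measure (Vel N))) (x := 0) (r := Real.sqrt N))).ne
    simpa [hS] using hξ
  set K₁ := ENNReal.ofReal ((1 + (2 * Real.pi * Real.sqrt N) ^ 2) ^ t)
  set K₂ := ENNReal.ofReal ((1 + (2 * Real.pi) ^ 2) ^ t)
  have hC : K₁ * volume Sᶜ + K₂ ≠ ∞ :=
    ENNReal.add_ne_top.2 ⟨ENNReal.mul_ne_top ENNReal.ofReal_ne_top hV, ENNReal.ofReal_ne_top⟩
  refine ⟨(K₁ * volume Sᶜ + K₂).toNNReal, fun u => ?_⟩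
  rw [ENNReal.coe_toNNReal hC, ← lintegral_add_compl _ hSm]
  set I := ∫⁻ ξ in S, ENNReal.ofReal (‖ξ‖ ^ (2 * t)) * ‖𝓕 u ξ‖ₑ ^ 2
  have h1 : ∫⁻ ξ in S, ENNReal.ofReal ((1 + (2 * Real.pi * ‖ξ‖) ^ 2) ^ t) * ‖𝓕 u ξ‖ₑ ^ 2 ≤
      K₂ * I := by
    rw [← lintegral_const_mul' _ _ ENNReal.ofReal_ne_top]
    refine setLIntegral_mono' hSm fun ξ hξ => ?_
    rw [← mul_assoc, ← ENNReal.ofReal_mul (by positivity)]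
    refine mul_le_mul_left (ENNReal.ofReal_le_ofReal ?_) _
    rw [Real.rpow_mul (norm_nonneg _), Real.rpow_two, ← Real.mul_rpow (by positivity) (by positivity)]
    refine Real.rpow_le_rpow (by positivity) ?_ ht
    have : 1 ≤ ‖ξ‖ := hN'.trans hξ
    nlinarith
  have h2 : ∫⁻ ξ in Sᶜ, ENNReal.ofReal ((1 + (2 * Real.pi * ‖ξ‖) ^ 2) ^ t) * ‖𝓕 u ξ‖ₑ ^ 2 ≤
      K₁ * eLpNorm u 1 volume ^ 2 * volume Sᶜ := by
    rw [← setLIntegral_const]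
    refine setLIntegral_mono' hSm.compl fun ξ hξ => ?_
    refine mul_le_mul' (ENNReal.ofReal_le_ofReal ?_) (pow_le_pow_left₀ zero_le (enorm_fourier_le u ξ) 2)
    have h3 : ‖ξ‖ ≤ Real.sqrt N := (not_le.1 (show ¬ Real.sqrt N ≤ ‖ξ‖ from hξ)).le
    have := Real.pi_pos
    gcongr
  calc _ ≤ K₂ * I + K₁ * eLpNorm u 1 volume ^ 2 * volume Sᶜ := add_le_add h1 h2
    _ ≤ (K₁ * volume Sᶜ + K₂) * I + (K₁ * volume Sᶜ + K₂) * eLpNorm u 1 volume ^ 2 := by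
        rw [mul_right_comm K₁]
        exact add_le_add (mul_le_mul_left le_add_self _) (mul_le_mul_left le_self_add _)
    _ = _ := by ring

theorem sobolevSq_eq_lintegral_fourier {t : ℝ} {u : Vel N → ℂ} (hu : Integrable u volume)
    (h2 : MemLp u 2 (volume : Measure (Vel N))) : sobolevSq t u =
      ∫⁻ ξ, ENNReal.ofReal ((1 + (2 * Real.pi * ‖ξ‖) ^ 2) ^ t) * ‖𝓕 u ξ‖ₑ ^ 2 := by
  refine lintegral_congr_ae ?_
  filter_upwards [fourierL2_eq_fourier hu h2] with ξ hξ
  rw [hξ]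

theorem memLp_two_of_lintegral_fourier {t : ℝ} (ht : 0 ≤ t) {u : Vel N → ℂ}
    (hu : Integrable u volume)
    (h : ∫⁻ ξ, ENNReal.ofReal ((1 + (2 * Real.pi * ‖ξ‖) ^ 2) ^ t) * ‖𝓕 u ξ‖ₑ ^ 2 ≠ ∞) :
    MemLp u 2 (volume : Measure (Vel N)) := by
  refine memLp_of_memLp_fourier hu ⟨(continuous_fourier hu).aestronglyMeasurable, ?_⟩
  rw [lt_top_iff_ne_top]
  intro hn
  refine h (top_unique ?_)
  have : eLpNorm (𝓕 u) 2 volume ^ 2 = ∞ := by rw [hn]; rfl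
  rw [← this, eLpNorm_two_sq]
  refine lintegral_mono fun ξ => le_mul_of_one_le_left zero_le ?_
  exact ENNReal.one_le_ofReal.2 (Real.one_le_rpow (by nlinarith [sq_nonneg (2 * Real.pi * ‖ξ‖)]) ht)

end SobolevNorm

/-! ### Integrability of the weighted tensor -/

section TensorIntegrable

variable {N : ℕ} [NeZero N] {η : ℝ} {γ : ℝ≥0} {Φ : ℝ≥0 → ℝ} {g f : Vel N → ℂ}

theorem lintegral_energyWeight_mul_gainTensor_le (hη : 0 ≤ η) (hγ : γ ≤ 2) (h0 : Φ 0 = 0)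
    (h : MemHolder γ Φ) (hg : Measurable g) (hf : Measurable f) :
    ∫⁻ p, ‖((energyWeight p.1 p.2 ^ η : ℝ) : ℂ) * gainTensor Φ g f p.1 p.2‖ₑ
      ∂((volume : Measure (Vel N)).prod volume) ≤
      4 * nnHolderNorm γ Φ * (normL1 (η + γ) g * normL1 (η + γ) f) := by
  have h1 := eLpNorm_centre_mul (measurable_weighted hg (η + γ)) (measurable_weighted hf (η + γ))
    (p := 1) (by norm_num) (by norm_num)
  rw [eLpNorm_one_eq_lintegral_enorm] at h1
  rw [normL1, normL1, ← h1, ← lintegral_const_mul' _ _ (by finiteness)]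
  refine lintegral_mono fun p => ?_
  have h2 := energyWeight_rpow_mul_abs_le hη hγ h0 h p.1 p.2
  have hl := (energyWeight_pos p.1 p.2).le
  have e : (4 * nnHolderNorm γ Φ : ℝ≥0∞) = ENNReal.ofReal (4 * nnHolderNorm γ Φ : ℝ) := by
    rw [ENNReal.ofReal_mul (by norm_num), ENNReal.ofReal_coe_nnreal]; norm_num
  rw [e, ← ofReal_norm, ← ofReal_norm, ← ENNReal.ofReal_mul (by positivity)]
  refine ENNReal.ofReal_le_ofReal ?_
  rw [norm_mul, norm_mul, norm_weighted, norm_weighted, gainTensor, norm_mul, norm_mul,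
    Complex.norm_real, Complex.norm_real, Real.norm_of_nonneg (by positivity), Real.norm_eq_abs]
  have h3 := mul_le_mul_of_nonneg_right h2 (mul_nonneg (norm_nonneg (g (p.1 - (1 / 2 : ℝ) • p.2)))
    (norm_nonneg (f (p.1 + (1 / 2 : ℝ) • p.2))))
  nlinarith [h3]

theorem integrable_energyWeight_mul_gainTensor (hη : 0 ≤ η) (hγ : γ ≤ 2) (h0 : Φ 0 = 0)
    (h : MemHolder γ Φ) (hΦ : Measurable Φ) (hg : Measurable g) (hf : Measurable f)
    (hgI : MemL1 (η + γ) g) (hfI : MemL1 (η + γ) f) :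
    Integrable (fun p : Vel N × Vel N => ((energyWeight p.1 p.2 ^ η : ℝ) : ℂ) *
      gainTensor Φ g f p.1 p.2) (volume.prod volume) := by
  refine ⟨?_, (lintegral_energyWeight_mul_gainTensor_le hη hγ h0 h hg hf).trans_lt ?_⟩
  · exact ((Complex.measurable_ofReal.comp (measurable_energyWeight_rpow η)).mul
      (measurable_gainTensor hΦ hg hf)).aestronglyMeasurable
  · exact ENNReal.mul_lt_top (by finiteness) (ENNReal.mul_lt_top hgI.2 hfI.2)

/-- Positivity of `γ` enters the proof here only, through the continuity of Φ. -/
theorem measurable_of_memHolder (hγ : 0 < γ) (h : MemHolder γ Φ) : Measurable Φ := by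
  obtain ⟨C, hC⟩ := h
  exact (hC.continuous hγ).measurable

end TensorIntegrable

/-! ### The estimate for measurable arguments -/

section Measurable

theorem exists_sobolevSq_gain_le (N : ℕ) [NeZero N] {s η : ℝ} (hs : 0 ≤ s) (hη : 0 ≤ η) : ∃ C : ℝ≥0,
    ∀ (B : ℝ≥0∞) (γ : ℝ≥0) (Φ : ℝ≥0 → ℝ) (b : ℝ → ℝ) (g f : Vel N → ℂ), RegularGain η B γ Φ b g f →
      MemLp (weighted (η + γ + 1) g) 2 (volume : Measure (Vel N)) →
      MemLp (weighted (η + γ + 1) f) 2 (volume : Measure (Vel N)) →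
      ∫⁻ ξ, ENNReal.ofReal ((1 + (2 * Real.pi * ‖ξ‖) ^ 2) ^ (s + ((N : ℝ) - 1) / 2)) *
        ‖𝓕 (weighted η (collisionOp b (gainTensor Φ g f))) ξ‖ₑ ^ 2 ≤
      C * (B * nnHolderNorm γ Φ ^ 2 * (sobolevSq s (weighted (η + γ + 1) g) *
        sobolevSq s (weighted (η + γ + 1) f) + (normL1 (η + γ) g * normL1 (η + γ) f) ^ 2)) := by
  have hN : (1 : ℝ) ≤ N := by exact_mod_cast NeZero.one_le
  obtain ⟨C₁, hC₁⟩ := exists_lintegral_fourier_le_highFrequency N (t := s + ((N : ℝ) - 1) / 2)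
    (by linarith)
  obtain ⟨C₂, hC₂⟩ := exists_lintegral_highFrequency_gain_le N hs hη
  -- The square of the constant in the L¹ bound of the weighted gain: 2^{η/2} from ⟨v⟩^η ≤ 2^{η/2}
  -- λ^η, the area of the sphere from Cauchy–Schwarz for `b`, and 16 = 4² from the tensor bound.
  set K := ENNReal.ofReal (2 ^ (η / 2)) ^ 2 * surfaceMeasure N Set.univ * 16 with hK
  have hKt : K ≠ ∞ := by
    refine ENNReal.mul_ne_top (ENNReal.mul_ne_top (by finiteness) (measure_ne_top _ _)) (by norm_num)
  refine ⟨C₁ * ((1 + C₂) * K.toNNReal + C₂), fun B γ Φ b g f R hG hF => ?_⟩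
  have h1 := hC₁ (weighted η (collisionOp b (gainTensor Φ g f)))
  have h2 := hC₂ B γ Φ b g f R hG hF
  set L := normL1 (η + γ) g * normL1 (η + γ) f with hL
  set S := sobolevSq s (weighted (η + γ + 1) g) * sobolevSq s (weighted (η + γ + 1) f)
  set U := eLpNorm (weighted η (collisionOp b (gainTensor Φ g f))) 1 volume with hU
  have hU1 : U ^ 2 ≤ K * (B * nnHolderNorm γ Φ ^ 2 * L ^ 2) := by
    have h3 := lintegral_weighted_collisionOp_le hη R.measurable_kernel R.bound R.measurable_tensor
    rw [← eLpNorm_one_eq_lintegral_enorm] at h3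
    have h4 := lintegral_energyWeight_mul_gainTensor_le hη R.le_two R.map_zero R.memHolder
      R.measurable_left R.measurable_right
    have h5 : U ≤ ENNReal.ofReal (2 ^ (η / 2)) * ((B * surfaceMeasure N Set.univ) ^ (1 / 2 : ℝ) *
        (4 * nnHolderNorm γ Φ * L)) :=
      h3.trans (mul_le_mul_right (mul_le_mul_right h4 _) _)
    refine (pow_le_pow_left₀ zero_le h5 2).trans (le_of_eq ?_)
    have h6 : ((B * surfaceMeasure N Set.univ) ^ (1 / 2 : ℝ)) ^ 2 = B * surfaceMeasure N Set.univ := by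
      rw [← ENNReal.rpow_mul_natCast]; norm_num
    rw [mul_pow, mul_pow, h6, hK]
    ring
  have h7 : U ^ 2 + C₂ * (U ^ 2 + B * nnHolderNorm γ Φ ^ 2 * S) ≤
      ((1 + C₂) * K + C₂) * (B * nnHolderNorm γ Φ ^ 2 * (S + L ^ 2)) := by
    calc _ = (1 + C₂) * U ^ 2 + C₂ * (B * nnHolderNorm γ Φ ^ 2 * S) := by ring
      _ ≤ (1 + C₂) * (K * (B * nnHolderNorm γ Φ ^ 2 * (S + L ^ 2))) +
          C₂ * (B * nnHolderNorm γ Φ ^ 2 * (S + L ^ 2)) :=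
        add_le_add (mul_le_mul_right (hU1.trans (mul_le_mul_right (mul_le_mul_right le_add_self _) _)) _)
          (mul_le_mul_right (mul_le_mul_right le_self_add _) _)
      _ = _ := by ring
  calc _ ≤ _ := h1
    _ ≤ C₁ * (U ^ 2 + C₂ * (U ^ 2 + B * nnHolderNorm γ Φ ^ 2 * S)) :=
        mul_le_mul_right (add_le_add_right h2 _) _
    _ ≤ C₁ * (((1 + C₂) * K + C₂) * (B * nnHolderNorm γ Φ ^ 2 * (S + L ^ 2))) :=
        mul_le_mul_right h7 _
    _ = _ := by
        push_cast
        rw [ENNReal.coe_toNNReal hKt]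
        ring

theorem exists_normH_gain_le_of_measurable (N : ℕ) (hN : 2 ≤ N) {s η : ℝ} (hs : 0 ≤ s) (hη : 0 ≤ η) :
    ∃ C : ℝ≥0, ∀ γ : ℝ≥0, 0 < γ → γ ≤ 2 → ∀ Φ : ℝ≥0 → ℝ, Φ 0 = 0 → MemHolder γ Φ →
      ∀ b : ℝ → ℝ, Measurable b → angularL2Norm N b < ∞ →
      ∀ g f : Vel N → ℂ, Measurable g → Measurable f →
        MemH s (η + γ + 1) g → MemL1 (η + γ) g → MemH s (η + γ + 1) f → MemL1 (η + γ) f →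
        (∀ᵐ v : Vel N, Integrable (gainIntegrand Φ b g f v)
          ((volume : Measure (Vel N)).prod (surfaceMeasure N))) ∧
        MemH (s + ((N : ℝ) - 1) / 2) η (gain Φ b g f) ∧
        normH (s + ((N : ℝ) - 1) / 2) η (gain Φ b g f) ≤
          C * nnHolderNorm γ Φ * angularL2Norm N b *
            (normH s (η + γ + 1) g * normH s (η + γ + 1) f + normL1 (η + γ) g * normL1 (η + γ) f) := by
  have : NeZero N := ⟨by omega⟩
  have hN1 : (1 : ℝ) ≤ N := by exact_mod_cast NeZero.one_le
  obtain ⟨C₀, hC₀⟩ := exists_lintegral_sphere_sq_le N hN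
  obtain ⟨C₁, hC₁⟩ := exists_sobolevSq_gain_le N hs hη
  -- The estimates so far are for squares. `C₁` comes from the Sobolev bound, `C₀` from B = C₀ ‖b‖².
  refine ⟨NNReal.sqrt (C₁ * C₀), fun γ hγ0 hγ Φ h0 hΦ b hb hbt g f hg hf hgH hgL hfH hfL => ?_⟩
  have hBt : C₀ * angularL2Norm N b ^ 2 ≠ ∞ :=
    ENNReal.mul_ne_top ENNReal.coe_ne_top (ENNReal.pow_ne_top hbt.ne)
  have hΦm := measurable_of_memHolder hγ0 hΦ
  have R : RegularGain η (C₀ * angularL2Norm N b ^ 2) γ Φ b g f :=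
    ⟨hγ, h0, hΦ, hg, hf, hb, hBt, hC₀ b hb, measurable_gainTensor hΦm hg hf,
      integrable_energyWeight_mul_gainTensor hη hγ h0 hΦ hΦm hg hf hgL hfL⟩
  have hest := hC₁ _ γ Φ b g f R hgH.memLp hfH.memLp
  have hi := R.integrable_weighted hη
  rw [← sq_normH hgH.memLp, ← sq_normH hfH.memLp] at hest
  rw [gain_eq]
  set q := collisionOp b (gainTensor Φ g f)
  set X := normH s (η + γ + 1) g * normH s (η + γ + 1) f with hX
  set Y := normL1 (η + γ) g * normL1 (η + γ) f with hY
  have hXt : X ≠ ∞ := ENNReal.mul_ne_top hgH.ne hfH.ne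
  have hYt : Y ≠ ∞ := ENNReal.mul_ne_top hgL.2.ne hfL.2.ne
  set W := (NNReal.sqrt (C₁ * C₀) : ℝ≥0∞) * nnHolderNorm γ Φ * angularL2Norm N b * (X + Y) with hW
  have hWt : W ≠ ∞ := by
    refine ENNReal.mul_ne_top (ENNReal.mul_ne_top (by finiteness) hbt.ne) ?_
    exact ENNReal.add_ne_top.2 ⟨hXt, hYt⟩
  have hsq : ∫⁻ ξ, ENNReal.ofReal ((1 + (2 * Real.pi * ‖ξ‖) ^ 2) ^ (s + ((N : ℝ) - 1) / 2)) *
      ‖𝓕 (weighted η q) ξ‖ₑ ^ 2 ≤ W ^ 2 := by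
    have e1 : (NNReal.sqrt (C₁ * C₀) : ℝ≥0∞) ^ 2 = C₁ * C₀ := by
      rw [← ENNReal.coe_pow, NNReal.sq_sqrt, ENNReal.coe_mul]
    have e2 : X ^ 2 + Y ^ 2 ≤ (X + Y) ^ 2 := by
      calc X ^ 2 + Y ^ 2 ≤ X ^ 2 + Y ^ 2 + 2 * X * Y := le_self_add
        _ = _ := by ring
    calc _ ≤ _ := hest
      _ = C₁ * C₀ * nnHolderNorm γ Φ ^ 2 * angularL2Norm N b ^ 2 * (X ^ 2 + Y ^ 2) := by
          rw [hX]; ring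
      _ ≤ C₁ * C₀ * nnHolderNorm γ Φ ^ 2 * angularL2Norm N b ^ 2 * (X + Y) ^ 2 :=
          mul_le_mul_right e2 _
      _ = _ := by rw [hW, ← e1]; ring
  have h2 : MemLp (weighted η q) 2 (volume : Measure (Vel N)) :=
    memLp_two_of_lintegral_fourier (by linarith) hi (hsq.trans_lt (ENNReal.pow_lt_top hWt.lt_top)).ne
  have hfin : normH (s + ((N : ℝ) - 1) / 2) η q ≤ W := by
    refine (ENNReal.pow_le_pow_left_iff two_ne_zero).1 ?_
    rwa [sq_normH h2, sobolevSq_eq_lintegral_fourier hi h2]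
  refine ⟨?_, hfin.trans_lt hWt.lt_top, hfin⟩
  have := ae_integrable_collisionIntegrand (integrable_weightedIntegrand hη R.measurable_kernel
    R.bound_ne_top R.bound R.measurable_tensor R.integrable)
  filter_upwards [this] with v hv
  rwa [gainIntegrand_eq]

end Measurable

/-! ### Independence of the choice of representatives -/

section NullSets

variable {N : ℕ} [NeZero N]

theorem vPrime_collisionMap (x w : Vel N) (ω : Sph N) : vPrime (collisionMap (x, (w, ω))).1
    (collisionMap (x, (w, ω))).2.1 (collisionMap (x, (w, ω))).2.2 = x + (1 / 2 : ℝ) • w := by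
  have h1 : (x + (1 / 2 : ℝ) • (‖w‖ • (ω : Vel N))) - (x - (1 / 2 : ℝ) • (‖w‖ • (ω : Vel N))) =
      ‖w‖ • (ω : Vel N) := by module
  have h3 : ‖‖w‖ • (ω : Vel N)‖ = ‖w‖ := by
    rw [norm_smul, norm_eq_of_mem_sphere, norm_norm, mul_one]
  simp only [collisionMap, vPrime, h1, h3]
  have h4 : (‖w‖ / 2) • (direction w : Vel N) = (1 / 2 : ℝ) • w := by
    rw [← one_div_mul_eq_div, mul_smul, norm_smul_direction]
  rw [h4]
  module

theorem vPrimeStar_collisionMap (x w : Vel N) (ω : Sph N) : vPrimeStar (collisionMap (x, (w, ω))).1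
    (collisionMap (x, (w, ω))).2.1 (collisionMap (x, (w, ω))).2.2 = x - (1 / 2 : ℝ) • w := by
  have h := vPrime_collisionMap x w ω
  have e : ∀ (v vs : Vel N) (σ : Sph N), vPrimeStar v vs σ = (v + vs) - vPrime v vs σ :=
    fun v vs σ => by simp only [vPrime, vPrimeStar]; module
  rw [e, h]
  simp only [collisionMap]
  module

/-- Under the measure-preserving collision map the velocities v' and v'_* become x ± w/2, which pull
null sets back to null sets. Hence the gain depends only on the classes of `g` and `f`. -/
theorem ae_vPrime_notMem {A : Set (Vel N)} (hA : volume A = 0) :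
    ∀ᵐ v : Vel N, ∀ᵐ p ∂((volume : Measure (Vel N)).prod (surfaceMeasure N)),
      vPrime v p.1 p.2 ∉ A ∧ vPrimeStar v p.1 p.2 ∉ A := by
  -- A measurable null set containing `A` is needed to transfer the almost-everywhere statement
  -- through the push-forward.
  set E := toMeasurable volume A with hE
  have hEm : MeasurableSet E := measurableSet_toMeasurable _ _
  have hE0 : volume E = 0 := by rw [hE, measure_toMeasurable, hA]
  have hEv : ∀ᵐ v : Vel N, v ∉ E := measure_eq_zero_iff_ae_notMem.1 hE0
  set P : Set (Vel N × (Vel N × Sph N)) :=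
    {q | vPrime q.1 q.2.1 q.2.2 ∉ E ∧ vPrimeStar q.1 q.2.1 q.2.2 ∉ E}
  have hPm : MeasurableSet P := by
    have m1 : Measurable fun q : Vel N × (Vel N × Sph N) => vPrime q.1 q.2.1 q.2.2 := by
      unfold vPrime; exact Continuous.measurable (by fun_prop)
    have m2 : Measurable fun q : Vel N × (Vel N × Sph N) => vPrimeStar q.1 q.2.1 q.2.2 := by
      unfold vPrimeStar; exact Continuous.measurable (by fun_prop)
    exact (m1 hEm.compl).inter (m2 hEm.compl)
  suffices h : ∀ᵐ q ∂((volume : Measure (Vel N)).prod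
      ((volume : Measure (Vel N)).prod (surfaceMeasure N))), q ∈ P by
    filter_upwards [Measure.ae_ae_of_ae_prod h] with v hv
    filter_upwards [hv] with p hp
    exact ⟨fun h => hp.1 (subset_toMeasurable _ _ h), fun h => hp.2 (subset_toMeasurable _ _ h)⟩
  have hmp := measurePreserving_collisionMap (N := N)
  have hc : ∀ᵐ q : Vel N × Vel N ∂(volume.prod volume),
      q.1 + (1 / 2 : ℝ) • q.2 ∉ E ∧ q.1 - (1 / 2 : ℝ) • q.2 ∉ E := by
    have hf1 := (Measure.quasiMeasurePreserving_fst (μ := (volume : Measure (Vel N)))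
      (ν := (volume : Measure (Vel N)))).ae hEv
    have hf2 := (Measure.quasiMeasurePreserving_snd (μ := (volume : Measure (Vel N)))
      (ν := (volume : Measure (Vel N)))).ae hEv
    exact (measurePreserving_centre (N := N)).quasiMeasurePreserving.ae (hf1.and hf2)
  have hassoc := (measurePreserving_prodAssoc (volume : Measure (Vel N)) (volume : Measure (Vel N))
    (surfaceMeasure N)).symm MeasurableEquiv.prodAssoc
  have hq := (Measure.quasiMeasurePreserving_fst.comp hassoc.quasiMeasurePreserving).ae hc
  suffices h : ∀ᵐ q ∂(Measure.map collisionMap ((volume : Measure (Vel N)).prod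
      ((volume : Measure (Vel N)).prod (surfaceMeasure N)))), q ∈ P by
    rwa [hmp.map_eq] at h
  refine (ae_map_iff hmp.measurable.aemeasurable hPm).2 ?_
  filter_upwards [hq] with ⟨x, w, ω⟩ h
  rw [vPrime_collisionMap, vPrimeStar_collisionMap]
  exact h

theorem ae_gainIntegrand_eq {Φ : ℝ≥0 → ℝ} {b : ℝ → ℝ} {g g₀ f f₀ : Vel N → ℂ}
    (hg : g =ᵐ[volume] g₀) (hf : f =ᵐ[volume] f₀) :
    ∀ᵐ v : Vel N, gainIntegrand Φ b g f v
      =ᵐ[(volume : Measure (Vel N)).prod (surfaceMeasure N)] gainIntegrand Φ b g₀ f₀ v := by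
  filter_upwards [ae_vPrime_notMem (N := N) (ae_iff.1 hg), ae_vPrime_notMem (N := N) (ae_iff.1 hf)]
    with v h1 h2
  filter_upwards [h1, h2] with p hp1 hp2
  have e1 := not_not.1 hp1.2
  have e2 := not_not.1 hp2.1
  rw [gainIntegrand, gainIntegrand, e1, e2]

end NullSets

end Boltzmann

end

/-! ### The theorem for arbitrary representatives -/

theorem theorem3p4 (N : ℕ) (hN : 2 ≤ N) (s η : ℝ) (hs : 0 ≤ s) (hη : 0 ≤ η) :
    ∃ C : ℝ≥0, ∀ (γ : ℝ≥0), 0 < γ → γ < 2 →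
      ∀ (Φ : ℝ≥0 → ℝ), Φ 0 = 0 → MemHolder γ Φ →
      ∀ (b : ℝ → ℝ), Measurable b → Boltzmann.angularL2Norm N b < ∞ →
      ∀ (g f : Boltzmann.Vel N → ℂ),
        Boltzmann.MemH s (η + γ + 1) g → Boltzmann.MemL1 (η + γ) g →
        Boltzmann.MemH s (η + γ + 1) f → Boltzmann.MemL1 (η + γ) f →
        (∀ᵐ v : Boltzmann.Vel N, Integrable (Boltzmann.gainIntegrand Φ b g f v)
          ((volume : Measure (Boltzmann.Vel N)).prod (Boltzmann.surfaceMeasure N))) ∧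
        Boltzmann.MemH (s + ((N : ℝ) - 1) / 2) η (Boltzmann.gain Φ b g f) ∧
        Boltzmann.normH (s + ((N : ℝ) - 1) / 2) η (Boltzmann.gain Φ b g f) ≤
          C * nnHolderNorm γ Φ * Boltzmann.angularL2Norm N b *
            (Boltzmann.normH s (η + γ + 1) g * Boltzmann.normH s (η + γ + 1) f +
              Boltzmann.normL1 (η + γ) g * Boltzmann.normL1 (η + γ) f) := by
  have : NeZero N := ⟨by omega⟩
  obtain ⟨C, hC⟩ := Boltzmann.exists_normH_gain_le_of_measurable N hN hs hη
  refine ⟨C, fun γ hγ0 hγ Φ h0 hΦ b hb hbt g f hgH hgL hfH hfL => ?_⟩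
  -- The weight is positive and continuous, so measurability of the weighted function passes to `g`
  -- itself; all quantities in the statement are unchanged when `g` and `f` are replaced by
  -- measurable representatives.
  obtain ⟨g₀, hg₀, hg⟩ := Boltzmann.aestronglyMeasurable_of_weighted hgH.memLp.1
  obtain ⟨f₀, hf₀, hf⟩ := Boltzmann.aestronglyMeasurable_of_weighted hfH.memLp.1
  have hN1 (k : ℝ) {u v : Boltzmann.Vel N → ℂ} (h : u =ᵐ[volume] v) :
      Boltzmann.normL1 k u = Boltzmann.normL1 k v :=
    eLpNorm_congr_ae (Boltzmann.weighted_congr h)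
  have hae := Boltzmann.ae_gainIntegrand_eq (Φ := Φ) (b := b) hg hf
  have hgain : Boltzmann.gain Φ b g f =ᵐ[volume] Boltzmann.gain Φ b g₀ f₀ := by
    filter_upwards [hae] with v hv
    exact integral_congr_ae hv
  have hmain := hC γ hγ0 hγ.le Φ h0 hΦ b hb hbt g₀ f₀ hg₀.measurable hf₀.measurable
    (by rwa [Boltzmann.MemH, ← Boltzmann.normH_congr hg])
    ((memLp_congr_ae (Boltzmann.weighted_congr hg)).1 hgL)
    (by rwa [Boltzmann.MemH, ← Boltzmann.normH_congr hf])
    ((memLp_congr_ae (Boltzmann.weighted_congr hf)).1 hfL)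
  rw [Boltzmann.MemH, Boltzmann.normH_congr hgain, Boltzmann.normH_congr hg,
    Boltzmann.normH_congr hf, hN1 _ hg, hN1 _ hf]
  refine ⟨?_, hmain.2⟩
  filter_upwards [hae, hmain.1] with v h1 h2
  exact h2.congr h1.symm
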